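/- Let $N=\mathbb Z^d$, $M=\mathrm{Hom}(N,\mathbb Z)$, and let $\mathcal A=\{v_1,\dots,v_k\}\subset N$ be a set of $k$ distinct elements that generates $N$ as a group and for which there is a homomorphism $\deg:N\to\mathbb Z$ with $\deg(v_i)=1$ for all $i$. Let $K=\sum_i\mathbb R_{\ge0}v_i\subset N\otimes\mathbb R$, and let $\mathbf\Sigma$ be the simplicial fan with support $K$ given by a regular triangulation of $\mathrm{conv}(\mathcal A)$ with vertices in $\mathcal A$ (not every $v_i$ needs to be used). For a cone $\sigma$ let $I(\sigma)$ be the set of $i$ such that $v_i$ generates a ray of $\sigma$, and let $I(\mathbf\Sigma)$ be the union of these sets. Fix a basis $g_1,\dots,g_d$ of $M$. *Modules.* Let $R=\mathbb C[\mathbf\Sigma]$ have basis $[n]$, $n\in N\cap K$, with $[m][n]=[m+n]$ if $m,n$ lie in a common cone of the fan and $[m][n]=0$ otherwise; put $Z_j=\sum_{i\in I(\mathbf\Sigma)}g_j(v_i)[v_i]$. For $\chi\in N\otimes\mathbb R$ let $\mathbb C[\mathbf\Sigma;\chi]$ be the $R$-module with basis $[w]$, $w\in(N+\chi)\cap K$,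 where $[n][w]=[n+w]$ if $n,w$ lie in a common cone and $[n][w]=0$ otherwise. For $\xi\in N\otimes\mathbb R$ let $\mathbb C[\mathbf\Sigma;\chi]_\xi$ be the $R$-submodule generated by the $[w]$ with $w+\epsilon\xi\in K$ for all sufficiently small $\epsilon>0$. *$\Gamma$-series.* For $\beta\in N\otimes\mathbb C$ and $\delta>0$ put $\beta_\delta=\mathrm{Re}\,\beta+\delta\,\mathrm{Im}\,\beta$. Let $\mathrm{Bx}(\mathbf\Sigma;\beta)\subset\mathbb C^k$ be the set of $\alpha$ with $\sum_i\alpha_iv_i\in N+\beta$, $0\le\mathrm{Re}\,\alpha_i<1$ for all $i$, and $\alpha_i=0$ for $i\notin I(\sigma)$, for some maximal cone $\sigma$. For such $\alpha$ put $c(\alpha_\delta)=\sum_i\{\mathrm{Re}\,\alpha_i+\delta\,\mathrm{Im}\,\alpha_i\}v_i$, where $\{\cdot\}$ is the fractional part, and for $v\in K\cap N$ let $L(\alpha,v)$ be the set of $l\in\mathbb C^k$ with $\sum_il_iv_i=\beta-v$ and $l_i-\alpha_i\in\mathbb Z$ for all $i$. For $x\in(\mathbb C^*)^k$ and a choice of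 $\arg x_1,\dots,\arg x_k\in\mathbb R$ put $$\Phi_v(x)=\sum_{\alpha\in\mathrm{Bx}(\mathbf\Sigma;\beta)}\ \sum_{l\in L(\alpha,v)}\ \prod_{i=1}^k\frac{x_i^{\,l_i+D_i}}{\Gamma(l_i+D_i+1)}\cdot[c(\alpha_\delta)],$$ where $D_i=[v_i]$ if $i\in I(\mathbf\Sigma)$ and $D_i=0$ otherwise, $x_i^{z}=e^{z(\log|x_i|+\sqrt{-1}\arg x_i)}$, and each factor is expanded as a power series in $D_i$. This is a formal series with values in the completion of $\mathbb C[\mathbf\Sigma;\beta_\delta]$, i.e. in the space of all formal sums $\sum_wa_w[w]$. For $p\in\mathbb R^k$ let $U_{\mathbf\Sigma}(p)$ be the set of $x\in(\mathbb C^*)^k$ such that the heights $\psi_i=-\log|x_i|-p_i$ induce the triangulation: for every maximal cone $\sigma$, the linear function $\psi_\sigma$ with $\psi_\sigma(v_i)=\psi_i$ for $i\in I(\sigma)$ satisfies $\psi_\sigma(v_j)<\psi_j$ for all $j\notin I(\sigma)$. **Proposition.** There is $p\in\mathbb R^k$ such that $U_{\mathbf\Sigma}=U_{\mathbf\Sigma}(p)$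 is open and non-empty and the following holds. For every $\beta\in N\otimes\mathbb C$ and all sufficiently small $\delta>0$: 1. All but finitely many basis elements $[w]$ of $\mathbb C[\mathbf\Sigma;\beta_\delta]_{\mathrm{Re}\,\beta}$ vanish in $Q:=\mathbb C[\mathbf\Sigma;\beta_\delta]_{\mathrm{Re}\,\beta}/(Z_1,\dots,Z_d)\,\mathbb C[\mathbf\Sigma;\beta_\delta]_{\mathrm{Re}\,\beta}$. For all $v\in K\cap N$, $x\in U_{\mathbf\Sigma}$ and all choices of arguments of $x$, each coefficient of the series $\Phi_v(x)$ converges absolutely, and the coefficients at the $[w]\notin\mathbb C[\mathbf\Sigma;\beta_\delta]_{\mathrm{Re}\,\beta}$ are zero. So $\Phi_v(x)$ has a well-defined class in $Q$, again denoted $\Phi_v(x)$. 2. Let $V\subseteq U_{\mathbf\Sigma}$ be open and non-empty (for example $V=U_{\mathbf\Sigma}$), with any choice of arguments at each point of $V$. If $h:Q\to\mathbb C$ is a linear map such that $h(\Phi_v(x))=0$ for all $v\in K\cap N$ and all $x\in V$, then $h=0$. 3. Consequently, if $h_1,\dots,h_r:Q\to\mathbb C$ are linearly independent linear maps, then the $\Gamma$-series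 solutions $(h_j\circ\Phi_v)_{v\in K\cap N}$, $1\le j\le r$, are linearly independent as families of functions on $V$. -/

import Mathlib

/-!
Lattice `N = ℤ^d`, with `N ⊗ ℝ = ℝ^d` and `N ⊗ ℂ = ℂ^d`.  The set `𝒜 = {v₁, …, v_k} ⊂ N` is given
by `v : Fin k → Fin d → ℤ`.  A simplicial fan whose rays are generated by elements of `𝒜` is given
by the set `T` of the index sets `I(σ) ⊆ {1, …, k}` of its cones `σ`.
-/

noncomputable section

namespace BBGKZ

variable {d k : ℕ}

/-- The inclusion `N → N ⊗ ℝ`. -/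
def toReal (n : Fin d → ℤ) : Fin d → ℝ := fun j => (n j : ℝ)

/-- The inclusion `N → N ⊗ ℂ`. -/
def toComplex (n : Fin d → ℤ) : Fin d → ℂ := fun j => (n j : ℂ)

/-- The cone `σ(I) = ∑_{i ∈ I} ℝ_{≥ 0} v_i`. -/
def cone (v : Fin k → Fin d → ℤ) (I : Finset (Fin k)) : Set (Fin d → ℝ) :=
  {w | ∃ a : Fin k → ℝ, (∀ i, 0 ≤ a i) ∧ (∀ i, i ∉ I → a i = 0) ∧
    w = ∑ i, a i • toReal (v i)}

/-- The cone `K` over the polytope `Δ = conv(𝒜)`. -/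
def K (v : Fin k → Fin d → ℤ) : Set (Fin d → ℝ) := cone v Finset.univ

/-- The cones `σ(I)`, `I ∈ T`, form a simplicial fan with support `K`; equivalently (when `𝒜` lies
in an affine hyperplane) the simplices `conv(v_i : i ∈ I)` triangulate `Δ`.  Not every `v_i` has to
be used. -/
structure IsTriangulation (v : Fin k → Fin d → ℤ) (T : Set (Finset (Fin k))) : Prop where
  down_closed : ∀ I ∈ T, ∀ J, J ⊆ I → J ∈ T
  simplicial : ∀ I ∈ T, LinearIndependent ℝ (fun i : I => toReal (v i))
  inter : ∀ I ∈ T, ∀ J ∈ T, cone v I ∩ cone v J = cone v (I ∩ J)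
  cover : (⋃ I ∈ T, cone v I) = K v

/-- The heights `ψ ∈ ℝ^k` that induce the triangulation `T`: over each maximal cone `σ` the linear
function `g` with `g(v_i) = ψ_i` for `i ∈ I(σ)` satisfies `g(v_j) < ψ_j` for all `j ∉ I(σ)`.
This is the interior of the secondary cone of `T`. -/
def inducingHeights (v : Fin k → Fin d → ℤ) (T : Set (Finset (Fin k))) : Set (Fin k → ℝ) :=
  {ψ | ∀ I, Maximal (· ∈ T) I → ∃ g : (Fin d → ℝ) →ₗ[ℝ] ℝ,
    (∀ i ∈ I, g (toReal (v i)) = ψ i) ∧ (∀ j, j ∉ I → g (toReal (v j)) < ψ j)}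

/-- A regular triangulation: one that is induced by some heights. -/
def IsRegularTriangulation (v : Fin k → Fin d → ℤ) (T : Set (Finset (Fin k))) : Prop :=
  IsTriangulation v T ∧ (inducingHeights v T).Nonempty

/-- The set `U_Σ ⊂ (ℂ^*)^k` of all `x` such that `(-log|x_1|, …, -log|x_k|)` lies in the translate
by `p` of the open secondary cone of `T`. -/
def USigma (v : Fin k → Fin d → ℤ) (T : Set (Finset (Fin k))) (p : Fin k → ℝ) :
    Set (Fin k → ℂ) :=
  {x | (∀ i, x i ≠ 0) ∧ (fun i => - Real.log ‖x i‖ - p i) ∈ inducingHeights v T}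

/-- `I(Σ)`: the indices `i` such that `v_i` generates a ray of the fan. -/
def rays (T : Set (Finset (Fin k))) : Set (Fin k) := {i | {i} ∈ T}

/-! ### The parameter and the twisted sectors -/

/-- `Re β ∈ N ⊗ ℝ`. -/
def rePart (β : Fin d → ℂ) : Fin d → ℝ := fun j => (β j).re

/-- `β_δ = Re β + δ Im β ∈ N ⊗ ℝ`. -/
def betaDelta (β : Fin d → ℂ) (δ : ℝ) : Fin d → ℝ := fun j => (β j).re + δ * (β j).im

/-- `Bx(σ; β) ⊂ ℂ^k` for the cone `σ` with `I(σ) = I`. -/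
def BxCone (v : Fin k → Fin d → ℤ) (β : Fin d → ℂ) (I : Finset (Fin k)) : Set (Fin k → ℂ) :=
  {α | (∃ n : Fin d → ℤ, toComplex n + β = ∑ i, α i • toComplex (v i)) ∧
    (∀ i, 0 ≤ (α i).re ∧ (α i).re < 1) ∧ (∀ i, i ∉ I → α i = 0)}

/-- `Bx(Σ; β)`: the union of the `Bx(σ; β)` over the maximal cones `σ`. -/
def Bx (v : Fin k → Fin d → ℤ) (T : Set (Finset (Fin k))) (β : Fin d → ℂ) : Set (Fin k → ℂ) :=
  {α | ∃ I, Maximal (· ∈ T) I ∧ α ∈ BxCone v β I}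

/-- `(α_δ)_i = {Re α_i + δ Im α_i}`. -/
def alphaDelta (α : Fin k → ℂ) (δ : ℝ) : Fin k → ℝ :=
  fun i => Int.fract ((α i).re + δ * (α i).im)

/-- `c(α_δ) = ∑ (α_δ)_i v_i`. -/
def cPoint (v : Fin k → Fin d → ℤ) (α : Fin k → ℂ) (δ : ℝ) : Fin d → ℝ :=
  ∑ i, alphaDelta α δ i • toReal (v i)

/-- `L(α, u)`: all `l ∈ ℂ^k` with `∑ l_i v_i = β - u` and `l_i - α_i ∈ ℤ`. -/
def L (v : Fin k → Fin d → ℤ) (β : Fin d → ℂ) (α : Fin k → ℂ) (u : Fin d → ℤ) :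
    Set (Fin k → ℂ) :=
  {l | ∑ i, l i • toComplex (v i) = β - toComplex u ∧ ∀ i, ∃ m : ℤ, l i - α i = m}

/-! ### The deformed module `ℂ[Σ; χ]`, its shadow submodule, and the quotient by `Z` -/

/-- The points of `(N + χ) ∩ K`. -/
def Points (v : Fin k → Fin d → ℤ) (χ : Fin d → ℝ) : Type :=
  {w : Fin d → ℝ // w ∈ K v ∧ ∃ n : Fin d → ℤ, w = toReal n + χ}

/-- The vector space `ℂ[Σ; χ]` with basis the elements `[w]`, `w ∈ (N + χ) ∩ K`. -/
abbrev DefModule (v : Fin k → Fin d → ℤ) (χ : Fin d → ℝ) : Type := Points v χ →₀ ℂ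

instance (v : Fin k → Fin d → ℤ) (χ : Fin d → ℝ) : AddCommGroup (DefModule v χ) := inferInstance

open Classical in
/-- The basis element `[w]` (zero if `w` is not in `(N + χ) ∩ K`). -/
def bas (v : Fin k → Fin d → ℤ) (χ : Fin d → ℝ) (w : Fin d → ℝ) : DefModule v χ :=
  if hw : w ∈ K v ∧ ∃ n : Fin d → ℤ, w = toReal n + χ then
    Finsupp.single (⟨w, hw⟩ : Points v χ) 1 else 0

open Classical in
/-- The action of the element `[n]` of the ring `R = ℂ[Σ]` on `ℂ[Σ; χ]`: `[n] · [w] = [n + w]` if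
some cone of the fan contains `n` and `w`, and `[n] · [w] = 0` otherwise.  (`R` is the vector space
with basis `[n]`, `n ∈ N ∩ K`, so these operators determine the `R`-module structure.) -/
def mono (v : Fin k → Fin d → ℤ) (T : Set (Finset (Fin k))) (χ : Fin d → ℝ) (n : Fin d → ℤ) :
    Module.End ℂ (DefModule v χ) :=
  Finsupp.linearCombination ℂ (fun w : Points v χ =>
    if ∃ I ∈ T, toReal n ∈ cone v I ∧ w.1 ∈ cone v I then bas v χ (toReal n + w.1) else 0)

/-- The shadow module `ℂ[Σ; χ]_ξ`: the `R`-submodule of `ℂ[Σ; χ]` generated by all `[w]` such that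
`w + ε ξ ∈ K` for all sufficiently small `ε > 0`. -/
def shadow (v : Fin k → Fin d → ℤ) (T : Set (Finset (Fin k))) (χ ξ : Fin d → ℝ) :
    Submodule ℂ (DefModule v χ) :=
  Submodule.span ℂ {m | ∃ (n : Fin d → ℤ) (w : Points v χ), toReal n ∈ K v ∧
    (∃ ε₀ : ℝ, 0 < ε₀ ∧ ∀ ε : ℝ, 0 < ε → ε < ε₀ → w.1 + ε • ξ ∈ K v) ∧
    m = mono v T χ n (Finsupp.single w 1)}

open Classical in
/-- `D_i = [v_i]` if `v_i` generates a ray of the fan, and `D_i = 0` otherwise. -/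
def D (v : Fin k → Fin d → ℤ) (T : Set (Finset (Fin k))) (χ : Fin d → ℝ) (i : Fin k) :
    Module.End ℂ (DefModule v χ) :=
  if i ∈ rays T then mono v T χ (v i) else 0

/-- The action of `Z_g = ∑_{i ∈ I(Σ)} g(v_i) [v_i]` for `g ∈ M = Hom(N, ℤ)`. -/
def Zop (v : Fin k → Fin d → ℤ) (T : Set (Finset (Fin k))) (χ : Fin d → ℝ)
    (g : Module.Dual ℤ (Fin d → ℤ)) : Module.End ℂ (DefModule v χ) :=
  ∑ i, ((g (v i) : ℤ) : ℂ) • D v T χ i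

/-- `(Z_1, …, Z_d) ℂ[Σ; χ]_ξ`, where `Z_j = Z_{g_j}` for a basis `g_1, …, g_d` of `M`. -/
def Zshadow (v : Fin k → Fin d → ℤ) (T : Set (Finset (Fin k))) (χ ξ : Fin d → ℝ)
    (g : Module.Basis (Fin d) ℤ (Module.Dual ℤ (Fin d → ℤ))) : Submodule ℂ (DefModule v χ) :=
  Submodule.span ℂ {m | ∃ j : Fin d, ∃ m' ∈ shadow v T χ ξ, m = Zop v T χ (g j) m'}

/-- The quotient `ℂ[Σ; χ]_ξ / (Z_1, …, Z_d) ℂ[Σ; χ]_ξ`. -/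
abbrev ShadowQuotient (v : Fin k → Fin d → ℤ) (T : Set (Finset (Fin k))) (χ ξ : Fin d → ℝ)
    (g : Module.Basis (Fin d) ℤ (Module.Dual ℤ (Fin d → ℤ))) : Type :=
  (shadow v T χ ξ) ⧸ ((Zshadow v T χ ξ g).submoduleOf (shadow v T χ ξ))

open Classical in
/-- The class of `[w] ∈ ℂ[Σ; χ]_ξ` in the quotient (zero if `[w]` is not in the shadow module). -/
def cls (v : Fin k → Fin d → ℤ) (T : Set (Finset (Fin k))) (χ ξ : Fin d → ℝ)
    (g : Module.Basis (Fin d) ℤ (Module.Dual ℤ (Fin d → ℤ))) (w : Points v χ) : ShadowQuotient v T χ ξ g :=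
  if hw : Finsupp.single w (1 : ℂ) ∈ shadow v T χ ξ then
    Submodule.Quotient.mk ⟨Finsupp.single w 1, hw⟩ else 0

/-! ### The `Γ`-series

There are finitely many `[w]` in each degree, so the completion of the graded module `ℂ[Σ; χ]` is
the space of all functions `Points v χ → ℂ`. -/

/-- The coefficient of `T^m` in the Taylor series at `T = 0` of the entire function
`x^{l + T} / Γ(l + T + 1)`, where `x^z = e^{z y}` for the chosen logarithm `y` of `x`. -/
def taylorCoeff (y l : ℂ) (m : ℕ) : ℂ :=
  iteratedDeriv m (fun z : ℂ => Complex.exp (z * y) / Complex.Gamma (z + 1)) l / (m.factorial : ℂ)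

/-- The operator `D^m = ∏ D_i^{m_i}`. -/
def Dpow (v : Fin k → Fin d → ℤ) (T : Set (Finset (Fin k))) (χ : Fin d → ℝ) (m : Fin k → ℕ) :
    Module.End ℂ (DefModule v χ) :=
  (List.ofFn fun i => D v T χ i ^ m i).prod

/-- The coefficient of `[w]` in `∏_i x_i^{l_i + D_i} / Γ(l_i + D_i + 1) · [c]`, where the product is
expanded as a power series in the `D_i`, and `y_i` is the chosen logarithm of `x_i`. -/
def termCoeff (v : Fin k → Fin d → ℤ) (T : Set (Finset (Fin k))) (χ : Fin d → ℝ)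
    (c : Fin d → ℝ) (y l : Fin k → ℂ) (w : Points v χ) : ℂ :=
  ∑ᶠ m : Fin k → ℕ, (∏ i, taylorCoeff (y i) (l i) (m i)) * (Dpow v T χ m (bas v χ c)) w

/-- The `Γ`-series `Φ_u` with values in the completion of `ℂ[Σ; β_δ]`: the coefficient of `[w]` at
the point with chosen logarithms `y`.  The sum runs over the `c(α_δ) ∈ Box(Σ; β_δ)`, which for small
`δ > 0` correspond bijectively to the `α ∈ Bx(Σ; β)`. -/
def Phi (v : Fin k → Fin d → ℤ) (T : Set (Finset (Fin k))) (β : Fin d → ℂ) (δ : ℝ)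
    (u : Fin d → ℤ) (y : Fin k → ℂ) (w : Points v (betaDelta β δ)) : ℂ :=
  ∑ᶠ α ∈ Bx v T β, ∑' l : L v β α u, termCoeff v T (betaDelta β δ) (cPoint v α δ) y l.1 w

/-- The class of `Φ_u` in `ℂ[Σ; β_δ]_{Re β} / (Z_1, …, Z_d) ℂ[Σ; β_δ]_{Re β}`; only finitely many
`[w]` have a non-zero class. -/
def PhiClass (v : Fin k → Fin d → ℤ) (T : Set (Finset (Fin k))) (β : Fin d → ℂ) (δ : ℝ)
    (g : Module.Basis (Fin d) ℤ (Module.Dual ℤ (Fin d → ℤ)))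
    (u : Fin d → ℤ) (y : Fin k → ℂ) : ShadowQuotient v T (betaDelta β δ) (rePart β) g :=
  ∑ᶠ w : Points v (betaDelta β δ),
    Phi v T β δ u y w • cls v T (betaDelta β δ) (rePart β) g w

/-- `θ` is a choice of arguments `(arg x_1, …, arg x_k)`. -/
def IsArg (x : Fin k → ℂ) (θ : Fin k → ℝ) : Prop :=
  ∀ i, x i = (‖x i‖ : ℂ) * Complex.exp ((θ i : ℂ) * Complex.I)

/-- The logarithms `log|x_i| + √-1 θ_i`. -/
def logOf (x : Fin k → ℂ) (θ : Fin k → ℝ) : Fin k → ℂ :=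
  fun i => (Real.log ‖x i‖ : ℂ) + (θ i : ℂ) * Complex.I

end BBGKZ

end

/-!
The basis elements `[w]` are written in coordinates with respect to the `v_i` of the minimal cone
of `w`.  In these coordinates `D_i` adds one to the `i`-th coordinate (`D_coordBas`), so that each
coefficient of a `Γ`-series comes from a single monomial `D^m` and a single `α` (`termCoeff_eq`).

*Finiteness.*  Modulo the linear system of parameters, `D_i` with `i` in a maximal cone `J` is a
combination of the `D_j` with `j ∉ J`.  A large coordinate of `w` can thus be traded for a larger
support, which is impossible indefinitely (`coordBas_mem_Zshadow`).

*Convergence.*  The Taylor coefficients of `1 / Γ(l + 1)` are bounded by Cauchy's estimates.  As the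
degree of `∑ n_i v_i` is fixed, the factorials cancel up to an exponential factor
(`exists_norm_gammaTerm_le`).  This factor is beaten by `|x^n|` when `-log|x|` lies deep inside the
secondary cone (`exists_summable_gammaTerm`).  A term with a non-zero coefficient at `[w]` has
exponents in `ℤ_{≥ 0}` outside of the minimal cone of `w`; this puts `[w]` into the shadow
(`inShadow_of_termCoeff_ne_zero`).

*Linear independence.*  For a linear function `h` on the quotient, `h(Φ_u)` is a series in the
monomials `y^a e^{(α + n) · y}`, where `y = log x` (`apply_PhiClass`).  If it vanishes on an open set
for a possibly discontinuous choice of arguments, then all its coefficients vanish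
(`coeff_eq_zero_of_exists_translate`): Baire's theorem makes the choice of arguments constant, analytic
continuation extends the vanishing to all arguments, generalized eigenspaces of the monodromy
separate the `α` and the powers `y^a`, and the rest is the uniqueness of Fourier coefficients.  The
coefficient at `l = α + n` says that `h` annihilates `D^a ∏ 1 / Γ(l_i + D_i + 1) · [c(α_δ)]` for all
`a`.  Up to units this element is `D^a ∏ D_i · [c(α_δ)]`, with the product over the `i` such that `l_i` is
a negative integer.  Every `[w]` in the shadow is of this form: take `l = α - M` on the minimal cone of
`w` and `l = 0` elsewhere; for large `M` the vector `β - ∑ l_i v_i` lies in `K` because `w` is in the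
shadow (`clsFun_eq_zero`).
-/

noncomputable section

namespace BBGKZ

/-! ### Coordinates, cones and maximal cones -/

section

variable {d k : ℕ}

/-- The point `∑ a_i v_i` of `N ⊗ ℝ`. -/
def lin (v : Fin k → Fin d → ℤ) : (Fin k → ℝ) →ₗ[ℝ] (Fin d → ℝ) :=
  Fintype.linearCombination ℝ fun i => toReal (v i)

/-- The set of indices of the non-zero coordinates. -/
def supp (a : Fin k → ℝ) : Finset (Fin k) := Finset.univ.filter fun i => a i ≠ 0

theorem mem_supp {a : Fin k → ℝ} {i : Fin k} : i ∈ supp a ↔ a i ≠ 0 := by simp [supp]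

theorem notMem_supp {a : Fin k → ℝ} {i : Fin k} : i ∉ supp a ↔ a i = 0 := by simp [supp]

theorem supp_add {a b : Fin k → ℝ} (ha : 0 ≤ a) (hb : 0 ≤ b) :
    supp (a + b) = supp a ∪ supp b := by
  ext i
  have h1 := ha i
  have h2 := hb i
  simp only [Pi.zero_apply] at h1 h2
  rw [Finset.mem_union, mem_supp, mem_supp, mem_supp, Pi.add_apply, ne_eq,
    add_eq_zero_iff_of_nonneg h1 h2]
  tauto

variable {v : Fin k → Fin d → ℤ}

theorem lin_apply (a : Fin k → ℝ) : lin v a = ∑ i, a i • toReal (v i) := rfl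

theorem map_lin (f : (Fin d → ℝ) →ₗ[ℝ] ℝ) (a : Fin k → ℝ) :
    f (lin v a) = ∑ i, f (toReal (v i)) * a i := by
  rw [lin_apply, map_sum]
  exact Finset.sum_congr rfl fun i _ => by rw [map_smul, smul_eq_mul, mul_comm]

theorem lin_single (i : Fin k) (t : ℝ) : lin v (Pi.single i t) = t • toReal (v i) := by
  simp [lin, Fintype.linearCombination_apply_single]

theorem toReal_add (m n : Fin d → ℤ) : toReal (m + n) = toReal m + toReal n := by
  ext j; simp [toReal]

theorem toReal_zero : toReal (0 : Fin d → ℤ) = 0 := by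
  ext j; simp [toReal]

theorem toReal_sum_zsmul (n : Fin k → ℤ) :
    toReal (∑ i, n i • v i) = lin v fun i => (n i : ℝ) := by
  ext j
  simp [toReal, lin_apply]

theorem mem_cone {I : Finset (Fin k)} {w : Fin d → ℝ} :
    w ∈ cone v I ↔ ∃ a : Fin k → ℝ, 0 ≤ a ∧ supp a ⊆ I ∧ lin v a = w := by
  constructor
  · rintro ⟨a, h0, hI, rfl⟩
    exact ⟨a, h0, fun i hi => by_contra fun h => mem_supp.1 hi (hI i h), rfl⟩
  · rintro ⟨a, h0, hI, rfl⟩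
    exact ⟨a, h0, fun i hi => notMem_supp.1 fun h => hi (hI h), rfl⟩

theorem mem_K {w : Fin d → ℝ} : w ∈ K v ↔ ∃ a : Fin k → ℝ, 0 ≤ a ∧ lin v a = w := by
  rw [K, mem_cone]
  simp

theorem lin_mem_K {a : Fin k → ℝ} (ha : 0 ≤ a) : lin v a ∈ K v := mem_K.2 ⟨a, ha, rfl⟩

theorem add_mem_K {w w' : Fin d → ℝ} (h : w ∈ K v) (h' : w' ∈ K v) : w + w' ∈ K v := by
  obtain ⟨a, ha, rfl⟩ := mem_K.1 h
  obtain ⟨b, hb, rfl⟩ := mem_K.1 h'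
  rw [← map_add]
  exact lin_mem_K (add_nonneg ha hb)

theorem smul_mem_K {w : Fin d → ℝ} {t : ℝ} (ht : 0 ≤ t) (h : w ∈ K v) : t • w ∈ K v := by
  obtain ⟨a, ha, rfl⟩ := mem_K.1 h
  rw [← map_smul]
  exact lin_mem_K (smul_nonneg ht ha)

section Triangulation
variable {T : Set (Finset (Fin k))} (hT : IsTriangulation v T)
include hT

theorem lin_injOn {I : Finset (Fin k)} (hI : I ∈ T) {a b : Fin k → ℝ} (ha : supp a ⊆ I)
    (hb : supp b ⊆ I) (h : lin v a = lin v b) : a = b := by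
  have hz : ∀ i, i ∉ I → (a - b) i = 0 := fun i hi => by
    rw [Pi.sub_apply, notMem_supp.1 fun h => hi (ha h), notMem_supp.1 fun h => hi (hb h), sub_zero]
  have h0 : ∑ i : I, (a - b) i • toReal (v i) = 0 := by
    rw [Finset.sum_coe_sort I fun i => (a - b) i • toReal (v i),
      Finset.sum_subset (Finset.subset_univ I) fun i _ hi => by rw [hz i hi, zero_smul],
      ← lin_apply, map_sub, h, sub_self]
  have h1 := Fintype.linearIndependent_iff.1 (hT.simplicial I hI) (fun i => (a - b) i) h0
  funext i
  by_cases hi : i ∈ I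
  · exact sub_eq_zero.1 (h1 ⟨i, hi⟩)
  · exact sub_eq_zero.1 (hz i hi)

/-- Uniqueness of coordinates across the cones of the fan, by the intersection property. -/
theorem eq_of_lin_eq {a b : Fin k → ℝ} (ha : 0 ≤ a) (hb : 0 ≤ b) (haT : supp a ∈ T)
    (hbT : supp b ∈ T) (h : lin v a = lin v b) : a = b := by
  have hmem : lin v a ∈ cone v (supp a ∩ supp b) := by
    rw [← hT.inter _ haT _ hbT]
    exact ⟨mem_cone.2 ⟨a, ha, subset_rfl, rfl⟩, mem_cone.2 ⟨b, hb, subset_rfl, h.symm⟩⟩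
  obtain ⟨c, -, hc, hc'⟩ := mem_cone.1 hmem
  rw [← lin_injOn hT haT (hc.trans Finset.inter_subset_left) subset_rfl hc']
  exact lin_injOn hT hbT (hc.trans Finset.inter_subset_right) subset_rfl (hc'.trans h)

theorem exists_rep {w : Fin d → ℝ} (hw : w ∈ K v) :
    ∃ a : Fin k → ℝ, 0 ≤ a ∧ supp a ∈ T ∧ lin v a = w := by
  rw [← hT.cover] at hw
  simp only [Set.mem_iUnion] at hw
  obtain ⟨I, hI, hw⟩ := hw
  obtain ⟨a, ha, haI, rfl⟩ := mem_cone.1 hw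
  exact ⟨a, ha, hT.down_closed I hI _ haI, rfl⟩

theorem lin_mem_cone_iff {a : Fin k → ℝ} (ha : 0 ≤ a) (haT : supp a ∈ T) {I : Finset (Fin k)}
    (hI : I ∈ T) : lin v a ∈ cone v I ↔ supp a ⊆ I := by
  refine ⟨fun h => ?_, fun h => mem_cone.2 ⟨a, ha, h, rfl⟩⟩
  obtain ⟨b, hb, hbI, hab⟩ := mem_cone.1 h
  rwa [← eq_of_lin_eq hT hb ha (hT.down_closed I hI _ hbI) haT hab]

end Triangulation

theorem exists_maximal {T : Set (Finset (Fin k))} {I : Finset (Fin k)} (hI : I ∈ T) :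
    ∃ J, Maximal (· ∈ T) J ∧ I ⊆ J := by
  obtain ⟨J, hJ, hJmax⟩ := (Set.toFinite T).exists_le_maximal hI
  exact ⟨J, hJmax, hJ⟩

theorem span_toReal_eq_top (hgen : AddSubgroup.closure (Set.range v) = ⊤) :
    Submodule.span ℝ (Set.range fun i => toReal (v i)) = ⊤ := by
  have h1 : ∀ n : Fin d → ℤ, toReal n ∈ Submodule.span ℝ (Set.range fun i => toReal (v i)) := by
    intro n
    have hn : n ∈ AddSubgroup.closure (Set.range v) := hgen ▸ AddSubgroup.mem_top n
    induction hn using AddSubgroup.closure_induction with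
    | mem x hx =>
      obtain ⟨i, rfl⟩ := hx
      exact Submodule.subset_span ⟨i, rfl⟩
    | zero => rw [toReal_zero]; exact zero_mem _
    | add x y _ _ hx hy => rw [toReal_add]; exact add_mem hx hy
    | neg x _ hx =>
      have : toReal (-x) = - toReal x := by ext j; simp [toReal]
      rw [this]; exact neg_mem hx
  rw [eq_top_iff, ← (Pi.basisFun ℝ (Fin d)).span_eq, Submodule.span_le]
  rintro _ ⟨j, rfl⟩
  have : toReal (Pi.single j 1 : Fin d → ℤ) = Pi.basisFun ℝ (Fin d) j := by
    ext j'
    by_cases h : j' = j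
    · subst h; simp [toReal]
    · simp [toReal, h]
  exact this ▸ h1 _

theorem eq_zero_of_forall_toReal (hgen : AddSubgroup.closure (Set.range v) = ⊤)
    {f : (Fin d → ℝ) →ₗ[ℝ] ℝ} (h : ∀ i, f (toReal (v i)) = 0) : f = 0 := by
  refine LinearMap.ext_on (span_toReal_eq_top hgen) ?_
  rintro _ ⟨i, rfl⟩
  simpa using h i

/-- `e` is the system of coordinate functions with respect to the basis `v_i`, `i ∈ I`, of
`N ⊗ ℝ`, extended by zero to the indices outside of `I`. -/
structure IsDual (v : Fin k → Fin d → ℤ) (I : Finset (Fin k))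
    (e : Fin k → (Fin d → ℝ) →ₗ[ℝ] ℝ) : Prop where
  eq_zero : ∀ i, i ∉ I → e i = 0
  lin_eq : ∀ w, lin v (fun i => e i w) = w
  apply_lin : ∀ a : Fin k → ℝ, supp a ⊆ I → ∀ i, e i (lin v a) = a i

theorem single_nonneg (i : Fin k) {t : ℝ} (ht : 0 ≤ t) : (0 : Fin k → ℝ) ≤ Pi.single i t :=
  fun j => by
    by_cases h : j = i
    · subst h; simpa using ht
    · simp [h]

theorem supp_single (i : Fin k) {t : ℝ} (ht : t ≠ 0) : supp (Pi.single i t) = {i} := by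
  ext j
  rw [mem_supp, Finset.mem_singleton]
  by_cases h : j = i
  · subst h; simpa using ht
  · simp [h]

theorem IsDual.apply_toReal {I : Finset (Fin k)} {e : Fin k → (Fin d → ℝ) →ₗ[ℝ] ℝ}
    (he : IsDual v I e) {j : Fin k} (hj : j ∈ I) (i : Fin k) :
    e i (toReal (v j)) = (Pi.single j 1 : Fin k → ℝ) i := by
  have := he.apply_lin (Pi.single j 1) (by simpa [supp_single]) i
  rwa [lin_single, one_smul] at this

theorem exists_isDual {I : Finset (Fin k)}
    (hli : LinearIndependent ℝ fun i : I => toReal (v i))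
    (hspan : Submodule.span ℝ (Set.range fun i : I => toReal (v i)) = ⊤) :
    ∃ e, IsDual v I e := by
  classical
  let b := Module.Basis.mk hli hspan.ge
  refine ⟨fun i => if h : i ∈ I then b.coord ⟨i, h⟩ else 0, fun i hi => dif_neg hi, fun w => ?_,
    fun a ha i => ?_⟩
  · rw [lin_apply, ← Finset.sum_subset (Finset.subset_univ I) fun i _ hi => by simp [hi],
      ← Finset.sum_coe_sort]
    conv_rhs => rw [← b.sum_repr w]
    exact Finset.sum_congr rfl fun i _ => by simp [b]
  · have hlin : lin v a = ∑ i : I, a i • b i := by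
      rw [lin_apply, ← Finset.sum_subset (Finset.subset_univ I) fun i _ hi => by
        rw [notMem_supp.1 fun h => hi (ha h), zero_smul], ← Finset.sum_coe_sort]
      exact Finset.sum_congr rfl fun i _ => by simp [b]
    by_cases hi : i ∈ I
    · simp only [hi, dite_true, Module.Basis.coord_apply, hlin]
      rw [b.repr_sum_self]
    · simp only [hi, dite_false, LinearMap.zero_apply]
      exact (notMem_supp.1 fun h => hi (ha h)).symm

section Triangulation
variable {T : Set (Finset (Fin k))} (hT : IsTriangulation v T)
include hT

/-- The maximal cones of a triangulation are full-dimensional.  A curve in `K` that starts at an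
interior point of the given cone and leaves every hyperplane meets some cone `J` of the fan
arbitrarily close to its start.  Then `J` spans `N ⊗ ℝ` and contains the given cone. -/
theorem exists_isDual_of_maximal (hgen : AddSubgroup.closure (Set.range v) = ⊤)
    {I : Finset (Fin k)} (hI : Maximal (· ∈ T) I) : ∃ e, IsDual v I e := by
  classical
  let w : (Fin k → ℝ) := fun i => if i ∈ I then 1 else 0
  have hw0 : 0 ≤ w := fun i => by simp only [w]; split_ifs <;> simp
  have hwI : supp w = I := by ext i; simp [mem_supp, w]
  let γ : ℝ → Fin k → ℝ := fun t => w + fun j => t ^ (j.val + 1)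
  have hγ : ∀ n : ℕ, ∃ J : Finset (Fin k), J ∈ T ∧ lin v (γ ((n : ℝ) + 1)⁻¹) ∈ cone v J := by
    intro n
    have : lin v (γ ((n : ℝ) + 1)⁻¹) ∈ K v :=
      lin_mem_K (add_nonneg hw0 fun j => by simp only [Pi.zero_apply]; positivity)
    rw [← hT.cover] at this
    simpa only [Set.mem_iUnion, exists_prop] using this
  choose J hJT hJ using hγ
  -- One cone contains infinitely many of the points of the curve at the times `1 / (n + 1)`.
  obtain ⟨J₀, hJ₀⟩ := Finite.exists_infinite_fiber J
  rw [Set.infinite_coe_iff] at hJ₀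
  obtain ⟨n₀, rfl⟩ : ∃ n, J n = J₀ := hJ₀.nonempty
  have hspan : Submodule.span ℝ (Set.range fun i : J n₀ => toReal (v i)) = ⊤ := by
    by_contra hne
    obtain ⟨f, hf, hle⟩ := Submodule.exists_le_ker_of_lt_top _ (lt_top_iff_ne_top.2 hne)
    refine hf (eq_zero_of_forall_toReal hgen fun j => ?_)
    -- A functional vanishing on `J` restricts to a polynomial on the curve with infinitely many zeros.
    let P : Polynomial ℝ := Polynomial.C (f (lin v w)) +
      ∑ j : Fin k, Polynomial.C (f (toReal (v j))) * Polynomial.X ^ (j.val + 1)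
    have hP : P = 0 := by
      refine Polynomial.eq_zero_of_infinite_isRoot _ ?_
      refine (hJ₀.image (f := fun n : ℕ => ((n : ℝ) + 1)⁻¹) ?_).mono ?_
      · intro a _ b _ hab
        simpa using hab
      · rintro _ ⟨n, hn, rfl⟩
        have hn' : J n = J n₀ := hn
        have h1 := hJ n
        rw [hn'] at h1
        obtain ⟨a, -, ha, ha'⟩ := mem_cone.1 h1
        have h2 : f (lin v (γ ((n : ℝ) + 1)⁻¹)) = 0 := by
          rw [← ha', lin_apply, map_sum]
          refine Finset.sum_eq_zero fun i _ => ?_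
          by_cases hi : i ∈ J n₀
          · rw [map_smul, show f (toReal (v i)) = 0 from hle (Submodule.subset_span ⟨⟨i, hi⟩, rfl⟩),
              smul_zero]
          · rw [notMem_supp.1 fun h => hi (ha h), zero_smul, map_zero]
        rw [show γ ((n : ℝ) + 1)⁻¹ = w + fun j => ((n : ℝ) + 1)⁻¹ ^ (j.val + 1) from rfl, map_add,
          map_add, map_lin f fun j : Fin k => ((n : ℝ) + 1)⁻¹ ^ (j.val + 1)] at h2
        simp only [P, Set.mem_ofPred_eq, Polynomial.IsRoot, Polynomial.eval_add, Polynomial.eval_C,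
          Polynomial.eval_finsetSum, Polynomial.eval_mul, Polynomial.eval_pow, Polynomial.eval_X]
        exact h2
    have h3 := congrArg (fun Q => Polynomial.coeff Q (j.val + 1)) hP
    simp only [P, Polynomial.coeff_add, Polynomial.coeff_C_succ, Polynomial.finsetSum_coeff,
      Polynomial.coeff_C_mul_X_pow, Polynomial.coeff_zero, zero_add, add_left_inj] at h3
    rw [Finset.sum_eq_single j (fun i _ hij => if_neg fun h => hij (Fin.ext h.symm))
      (fun h => absurd (Finset.mem_univ j) h), if_pos rfl] at h3
    exact h3
  obtain ⟨e, he⟩ := exists_isDual (hT.simplicial _ (hJT n₀)) hspan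
  have hmem : lin v w ∈ cone v (J n₀) := by
    refine mem_cone.2 ⟨fun i => e i (lin v w), fun i => ?_, fun i hi => by_contra fun h => ?_,
      he.lin_eq _⟩
    · have ht : Filter.Tendsto (fun n : ℕ => e i (lin v (γ ((n : ℝ) + 1)⁻¹))) Filter.atTop
          (nhds (e i (lin v w))) := by
        have hc : Continuous fun t : ℝ => e i (lin v (γ t)) :=
          ((e i).continuous_of_finiteDimensional.comp
            (lin v).continuous_of_finiteDimensional).comp (by fun_prop)
        have h0 : γ 0 = w := by funext j; simp [γ]
        have := (hc.tendsto 0).comp (tendsto_one_div_add_atTop_nhds_zero_nat (𝕜 := ℝ))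
        simpa [Function.comp_def, h0] using this
      refine isClosed_Ici.mem_of_frequently_of_tendsto (Nat.frequently_atTop_iff_infinite.2
        (hJ₀.mono fun n hn => ?_)) ht
      have hn' : J n = J n₀ := hn
      have h1 := hJ n
      rw [hn'] at h1
      obtain ⟨a, ha0, ha, ha'⟩ := mem_cone.1 h1
      change (0 : ℝ) ≤ _
      rw [← ha', he.apply_lin a ha]
      exact ha0 i
    · rw [mem_supp, he.eq_zero i h] at hi
      exact hi rfl
  have hsub : I ⊆ J n₀ := by
    rw [← hwI]
    exact (lin_mem_cone_iff hT hw0 (hwI ▸ hI.prop) (hJT n₀)).1 hmem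
  rw [hI.eq_of_le (hJT n₀) hsub]
  exact ⟨e, he⟩

end Triangulation

/-- The secondary cone is cut out by finitely many strict linear inequalities. -/
theorem mem_inducingHeights_iff {T : Set (Finset (Fin k))}
    {e : Finset (Fin k) → Fin k → (Fin d → ℝ) →ₗ[ℝ] ℝ}
    (he : ∀ I, Maximal (· ∈ T) I → IsDual v I (e I)) (ψ : Fin k → ℝ) :
    ψ ∈ inducingHeights v T ↔ ∀ I, Maximal (· ∈ T) I → ∀ j, j ∉ I →
      ∑ i, e I i (toReal (v j)) * ψ i < ψ j := by
  constructor
  · intro h I hI j hj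
    obtain ⟨g, hg, hg'⟩ := h I hI
    refine lt_of_eq_of_lt ?_ (hg' j hj)
    conv_rhs => rw [← (he I hI).lin_eq (toReal (v j)), lin_apply, map_sum]
    refine Finset.sum_congr rfl fun i _ => ?_
    rw [map_smul, smul_eq_mul]
    by_cases hi : i ∈ I
    · rw [hg i hi]
    · rw [(he I hI).eq_zero i hi]
      simp
  · intro h I hI
    refine ⟨∑ i, ψ i • e I i, fun i hi => ?_, fun j hj => ?_⟩
    · simp [LinearMap.sum_apply, (he I hI).apply_toReal hi, Pi.single_apply]
    · simpa [LinearMap.sum_apply, mul_comm] using h I hI j hj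

end

/-! ### The action of the `D_i` in coordinates -/

section

variable {d k : ℕ} {v : Fin k → Fin d → ℤ} {T : Set (Finset (Fin k))} {χ ξ : Fin d → ℝ}

theorem bas_val (w : Points v χ) : bas v χ w.1 = Finsupp.single w 1 := dif_pos w.2

/-- The point of `(N + χ) ∩ K` given by a vector. -/
def mkPoint {w : Fin d → ℝ} (hw : w ∈ K v) (h : ∃ n : Fin d → ℤ, w = toReal n + χ) :
    Points v χ := ⟨w, hw, h⟩

theorem bas_eq_single {w : Fin d → ℝ} (hw : w ∈ K v) (h : ∃ n : Fin d → ℤ, w = toReal n + χ) :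
    bas v χ w = Finsupp.single (mkPoint hw h) 1 := dif_pos ⟨hw, h⟩

theorem bas_eq_zero {w : Fin d → ℝ} (h : ¬ ∃ n : Fin d → ℤ, w = toReal n + χ) :
    bas v χ w = 0 := dif_neg fun h' => h h'.2

theorem exists_toReal_add_iff {w : Fin d → ℝ} (m : Fin d → ℤ) :
    (∃ n : Fin d → ℤ, toReal m + w = toReal n + χ) ↔ ∃ n : Fin d → ℤ, w = toReal n + χ := by
  constructor
  · rintro ⟨n, hn⟩
    refine ⟨n - m, ?_⟩
    have : toReal n = toReal m + toReal (n - m) := by rw [← toReal_add, add_sub_cancel]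
    rw [this, add_assoc] at hn
    exact add_left_cancel hn
  · rintro ⟨n, rfl⟩
    exact ⟨m + n, by rw [toReal_add, add_assoc]⟩

open Classical in
theorem mono_bas {w : Fin d → ℝ} (hw : w ∈ K v) (n : Fin d → ℤ) :
    mono v T χ n (bas v χ w) =
      if ∃ I ∈ T, toReal n ∈ cone v I ∧ w ∈ cone v I then bas v χ (toReal n + w) else 0 := by
  by_cases h : ∃ m : Fin d → ℤ, w = toReal m + χ
  · rw [bas_eq_single hw h, mono, Finsupp.linearCombination_single, one_smul]
    rfl
  · rw [bas_eq_zero h, map_zero, bas_eq_zero (by rwa [exists_toReal_add_iff]), ite_self]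

open Classical in
/-- The basis element at the point with coordinates `a`, and zero if the `v_i` with `a_i ≠ 0` do
not span a cone of the fan.  With this convention `D_i` acts by adding one to the `i`-th
coordinate, without exceptions. -/
def coordBas (v : Fin k → Fin d → ℤ) (T : Set (Finset (Fin k))) (χ : Fin d → ℝ)
    (a : Fin k → ℝ) : DefModule v χ :=
  if supp a ∈ T then bas v χ (lin v a) else 0

theorem coordBas_of_mem {a : Fin k → ℝ} (h : supp a ∈ T) : coordBas v T χ a = bas v χ (lin v a) :=
  if_pos h

theorem coordBas_of_notMem {a : Fin k → ℝ} (h : supp a ∉ T) : coordBas v T χ a = 0 := if_neg h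

theorem coordBas_eq_single {a : Fin k → ℝ} (haT : supp a ∈ T) {w : Points v χ}
    (h : lin v a = w.1) : coordBas v T χ a = Finsupp.single w 1 := by
  rw [coordBas_of_mem haT, h, bas_val]

theorem coordBas_apply {a : Fin k → ℝ} (ha : 0 ≤ a) {w : Points v χ} :
    coordBas v T χ a w ≠ 0 → supp a ∈ T ∧ lin v a = w.1 ∧ coordBas v T χ a w = 1 := by
  intro h
  have haT : supp a ∈ T := by
    by_contra haT
    rw [coordBas_of_notMem haT] at h
    exact h rfl
  rw [coordBas_of_mem haT] at h ⊢
  by_cases hn : ∃ n : Fin d → ℤ, lin v a = toReal n + χ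
  · rw [bas_eq_single (lin_mem_K ha) hn] at h ⊢
    by_cases hw : mkPoint (lin_mem_K ha) hn = w
    · rw [hw, Finsupp.single_eq_same]
      exact ⟨haT, congrArg Subtype.val hw, rfl⟩
    · rw [Finsupp.single_eq_of_ne' hw] at h
      exact absurd rfl h
  · rw [bas_eq_zero hn] at h
    exact absurd rfl h

section Triangulation
variable (hT : IsTriangulation v T)
include hT

theorem D_coordBas {a : Fin k → ℝ} (ha : 0 ≤ a) (i : Fin k) :
    D v T χ i (coordBas v T χ a) = coordBas v T χ (a + Pi.single i 1) := by
  have hsupp : supp (a + Pi.single i 1) = supp a ∪ {i} := by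
    rw [supp_add ha (single_nonneg i zero_le_one), supp_single i one_ne_zero]
  by_cases haT : supp a ∈ T
  · by_cases hi : i ∈ rays T
    · rw [D, if_pos hi, coordBas_of_mem haT, mono_bas (lin_mem_K ha)]
      have hiT : supp (Pi.single i (1 : ℝ)) ∈ T := by
        rw [supp_single i one_ne_zero]; exact hi
      have hv : toReal (v i) = lin v (Pi.single i 1) := by rw [lin_single, one_smul]
      have hiff : (∃ I ∈ T, toReal (v i) ∈ cone v I ∧ lin v a ∈ cone v I) ↔
          supp (a + Pi.single i 1) ∈ T := by
        rw [hsupp]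
        constructor
        · rintro ⟨I, hI, h1, h2⟩
          rw [hv, lin_mem_cone_iff hT (single_nonneg i zero_le_one) hiT hI,
            supp_single i one_ne_zero] at h1
          rw [lin_mem_cone_iff hT ha haT hI] at h2
          exact hT.down_closed I hI _ (Finset.union_subset h2 h1)
        · intro h
          refine ⟨_, h, ?_, ?_⟩
          · rw [hv, lin_mem_cone_iff hT (single_nonneg i zero_le_one) hiT h,
              supp_single i one_ne_zero]
            exact Finset.subset_union_right
          · rw [lin_mem_cone_iff hT ha haT h]
            exact Finset.subset_union_left
      by_cases h : supp (a + Pi.single i 1) ∈ T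
      · rw [if_pos (hiff.2 h), coordBas_of_mem h, map_add, hv, add_comm]
      · rw [if_neg (mt hiff.1 h), coordBas_of_notMem h]
    · rw [D, if_neg hi, LinearMap.zero_apply, coordBas_of_notMem]
      rw [hsupp]
      exact fun h => hi (hT.down_closed _ h _ Finset.subset_union_right)
  · rw [coordBas_of_notMem haT, map_zero, coordBas_of_notMem]
    rw [hsupp]
    exact fun h => haT (hT.down_closed _ h _ Finset.subset_union_left)

theorem D_pow_coordBas {a : Fin k → ℝ} (ha : 0 ≤ a) (i : Fin k) (n : ℕ) :
    (D v T χ i ^ n) (coordBas v T χ a) = coordBas v T χ (a + Pi.single i (n : ℝ)) := by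
  induction n with
  | zero => simp
  | succ n ih =>
    rw [pow_succ', Module.End.mul_apply, ih,
      D_coordBas hT (add_nonneg ha (single_nonneg i n.cast_nonneg)), add_assoc, ← Pi.single_add]
    push_cast
    rfl

theorem Dpow_coordBas {a : Fin k → ℝ} (ha : 0 ≤ a) (m : Fin k → ℕ) :
    Dpow v T χ m (coordBas v T χ a) = coordBas v T χ (a + fun i => (m i : ℝ)) := by
  have key : ∀ l : List (Fin k), (l.map fun i => D v T χ i ^ m i).prod (coordBas v T χ a) =
      coordBas v T χ (a + (l.map fun i => (Pi.single i (m i : ℝ) : Fin k → ℝ)).sum) := by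
    intro l
    induction l with
    | nil => simp
    | cons i l ih =>
      have h0 : 0 ≤ (l.map fun i => (Pi.single i (m i : ℝ) : Fin k → ℝ)).sum :=
        List.sum_nonneg fun x hx => by
          obtain ⟨j, -, rfl⟩ := List.mem_map.1 hx
          exact single_nonneg j (Nat.cast_nonneg _)
      rw [List.map_cons, List.prod_cons, Module.End.mul_apply, ih,
        D_pow_coordBas hT (add_nonneg ha h0), List.map_cons, List.sum_cons, add_assoc,
        add_comm (Pi.single i (m i : ℝ) : Fin k → ℝ)]
  rw [Dpow, List.ofFn_eq_map, key, ← List.ofFn_eq_map, List.sum_ofFn, Finset.univ_sum_single]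

theorem exists_coordBas_eq_single (w : Points v χ) : ∃ a : Fin k → ℝ, 0 ≤ a ∧ supp a ∈ T ∧
    lin v a = w.1 ∧ coordBas v T χ a = Finsupp.single w 1 := by
  obtain ⟨a, ha, haT, h⟩ := exists_rep hT w.2.1
  exact ⟨a, ha, haT, h, coordBas_eq_single haT h⟩

end Triangulation

/-! ### The shadow module is spanned by basis elements -/

/-- The points `w` such that `w + ε ξ ∈ K` for all sufficiently small `ε > 0`. -/
def InShadow (v : Fin k → Fin d → ℤ) (ξ w : Fin d → ℝ) : Prop :=
  ∃ ε₀ : ℝ, 0 < ε₀ ∧ ∀ ε : ℝ, 0 < ε → ε < ε₀ → w + ε • ξ ∈ K v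

theorem InShadow.add {w w' : Fin d → ℝ} (h : InShadow v ξ w) (hw' : w' ∈ K v) :
    InShadow v ξ (w + w') := by
  obtain ⟨ε₀, h0, h⟩ := h
  refine ⟨ε₀, h0, fun ε h1 h2 => ?_⟩
  rw [add_right_comm]
  exact add_mem_K (h ε h1 h2) hw'

theorem InShadow.smul {w : Fin d → ℝ} (h : InShadow v ξ w) {t : ℝ} (ht : 0 < t) :
    InShadow v ξ (t • w) := by
  obtain ⟨ε₀, h0, h⟩ := h
  refine ⟨t * ε₀, by positivity, fun ε h1 h2 => ?_⟩
  have := smul_mem_K ht.le (h (ε / t) (by positivity) (by rwa [div_lt_iff₀' ht]))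
  rwa [smul_add, smul_smul, mul_div_cancel₀ _ ht.ne'] at this

/-- Being in the shadow depends only on the minimal cone that contains the point. -/
theorem InShadow.of_supp {a b : Fin k → ℝ} (hb : 0 ≤ b) (hab : supp a ⊆ supp b)
    (h : InShadow v ξ (lin v a)) : InShadow v ξ (lin v b) := by
  obtain ⟨t, ht, htab⟩ : ∃ t : ℝ, 0 < t ∧ t • a ≤ b := by
    have : ∀ᶠ t : ℝ in nhdsWithin 0 (Set.Ioi 0), ∀ i, t * a i ≤ b i := by
      rw [Filter.eventually_all]
      intro i
      by_cases hi : i ∈ supp b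
      · have hbi : 0 < b i := lt_of_le_of_ne (hb i) (Ne.symm (mem_supp.1 hi))
        have hc : Filter.Tendsto (fun t : ℝ => t * a i) (nhdsWithin 0 (Set.Ioi 0)) (nhds 0) :=
          ((continuous_mul_const (a i)).tendsto' 0 0 (zero_mul _)).mono_left nhdsWithin_le_nhds
        exact (hc.eventually_lt_const hbi).mono fun t h => h.le
      · rw [notMem_supp.1 hi, notMem_supp.1 fun h => hi (hab h)]
        simp
    obtain ⟨t, h1, h2⟩ := (this.and self_mem_nhdsWithin).exists
    exact ⟨t, h2, h1⟩
  have := (h.smul ht).add (lin_mem_K (v := v) (sub_nonneg.2 htab))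
  rwa [← map_smul, ← map_add, add_sub_cancel] at this

theorem mono_zero_single (hT : IsTriangulation v T) (w : Points v χ) :
    mono v T χ 0 (Finsupp.single w 1) = Finsupp.single w 1 := by
  obtain ⟨a, ha, haT, hw⟩ := exists_rep hT w.2.1
  rw [← bas_val, mono_bas w.2.1, if_pos, toReal_zero, zero_add]
  refine ⟨_, haT, mem_cone.2 ⟨0, le_rfl, ?_, by rw [map_zero, toReal_zero]⟩,
    mem_cone.2 ⟨a, ha, subset_rfl, hw⟩⟩
  simp [supp]

theorem single_mem_shadow (hT : IsTriangulation v T) {w : Points v χ} (h : InShadow v ξ w.1) :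
    Finsupp.single w (1 : ℂ) ∈ shadow v T χ ξ :=
  Submodule.subset_span ⟨0, w, by rw [toReal_zero]; exact mem_K.2 ⟨0, le_rfl, map_zero _⟩, h,
    (mono_zero_single hT w).symm⟩

theorem mono_single (n : Fin d → ℤ) (w : Points v χ) :
    mono v T χ n (Finsupp.single w 1) = 0 ∨ ∃ w' : Points v χ, w'.1 = toReal n + w.1 ∧
      mono v T χ n (Finsupp.single w 1) = Finsupp.single w' 1 := by
  rw [← bas_val, mono_bas w.2.1]
  split_ifs with h
  · right
    obtain ⟨I, -, hn, hw⟩ := h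
    have hK : ∀ {x}, x ∈ cone v I → x ∈ K v := fun hx => by
      obtain ⟨a, ha, -, h⟩ := mem_cone.1 hx
      exact mem_K.2 ⟨a, ha, h⟩
    exact ⟨mkPoint (add_mem_K (hK hn) (hK hw)) ((exists_toReal_add_iff n).2 w.2.2), rfl,
      bas_eq_single _ _⟩
  · exact Or.inl rfl

/-- The `R`-submodule generated by the `[w]` in the shadow adds no further basis elements, because
`K` is closed under addition. -/
theorem shadow_le_supported :
    shadow v T χ ξ ≤ Finsupp.supported ℂ ℂ {w : Points v χ | InShadow v ξ w.1} := by
  rw [shadow, Submodule.span_le]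
  rintro _ ⟨n, w, hn, hw, rfl⟩
  rcases mono_single (T := T) n w with h | ⟨w', hw', h⟩
  · rw [h]; exact zero_mem _
  · rw [h]
    refine Finsupp.single_mem_supported ℂ _ ?_
    change InShadow v ξ w'.1
    rw [hw', add_comm]
    exact InShadow.add hw hn

theorem inShadow_of_single_mem {w : Points v χ} (h : Finsupp.single w (1 : ℂ) ∈ shadow v T χ ξ) :
    InShadow v ξ w.1 := by
  have := shadow_le_supported h
  rw [Finsupp.mem_supported, Finsupp.support_single _ one_ne_zero] at this
  exact this (by simp)

theorem coordBas_mem_shadow (hT : IsTriangulation v T) {a : Fin k → ℝ} (ha : 0 ≤ a)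
    (h : InShadow v ξ (lin v a)) : coordBas v T χ a ∈ shadow v T χ ξ := by
  by_cases haT : supp a ∈ T
  · by_cases hn : ∃ n : Fin d → ℤ, lin v a = toReal n + χ
    · rw [coordBas_eq_single haT (w := mkPoint (lin_mem_K ha) hn) rfl]
      exact single_mem_shadow hT h
    · rw [coordBas_of_mem haT, bas_eq_zero hn]; exact zero_mem _
  · rw [coordBas_of_notMem haT]; exact zero_mem _

/-! ### The quotient by the linear system of parameters -/

/-- The span of the `Z_j` contains the operators `∑ φ(v_i) D_i` for all real linear functions `φ`. -/
theorem sum_D_mem_Zshadow (g : Module.Basis (Fin d) ℤ (Module.Dual ℤ (Fin d → ℤ)))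
    (φ : (Fin d → ℝ) →ₗ[ℝ] ℝ) {m : DefModule v χ} (hm : m ∈ shadow v T χ ξ) :
    ∑ i, ((φ (toReal (v i)) : ℝ) : ℂ) • D v T χ i m ∈ Zshadow v T χ ξ g := by
  obtain ⟨c, hc⟩ : ∃ c : Fin d → ℝ, ∀ n, φ (toReal n) = ∑ j, c j * (g j n : ℤ) := by
    refine ⟨fun j => ∑ t, φ (Pi.single t 1) * (g.repr (LinearMap.proj t) j : ℤ), fun n => ?_⟩
    have h1 : ∀ t, n t = ∑ j, g.repr (LinearMap.proj t) j * g j n := fun t => by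
      have := LinearMap.congr_fun (g.sum_repr (LinearMap.proj t)) n
      rw [LinearMap.sum_apply] at this
      simpa only [LinearMap.smul_apply, smul_eq_mul, LinearMap.proj_apply] using this.symm
    have h2 : toReal n = ∑ t, (n t : ℝ) • (Pi.single t 1 : Fin d → ℝ) := by
      ext t
      simp [toReal, Pi.single_apply]
    rw [h2, map_sum]
    simp only [map_smul, smul_eq_mul, Finset.sum_mul]
    rw [Finset.sum_comm]
    refine Finset.sum_congr rfl fun t _ => ?_
    rw [h1 t]
    push_cast
    rw [Finset.sum_mul]
    exact Finset.sum_congr rfl fun j _ => by ring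
  have : ∑ i, ((φ (toReal (v i)) : ℝ) : ℂ) • D v T χ i m =
      ∑ j, (c j : ℂ) • Zop v T χ (g j) m := by
    simp only [Zop, LinearMap.sum_apply, LinearMap.smul_apply, Finset.smul_sum, smul_smul]
    rw [Finset.sum_comm]
    refine Finset.sum_congr rfl fun i _ => ?_
    rw [← Finset.sum_smul, hc]
    push_cast
    rfl
  rw [this]
  exact Submodule.sum_mem _ fun j _ => Submodule.smul_mem _ _
    (Submodule.subset_span ⟨j, m, hm, rfl⟩)

/-- For `i` in a maximal cone `J` the coordinate function `e_i` expresses `D_i`, modulo the linear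
system of parameters, by the `D_j` with `j ∉ J`. -/
theorem coordBas_mem_Zshadow_of_forall (hT : IsTriangulation v T)
    (g : Module.Basis (Fin d) ℤ (Module.Dual ℤ (Fin d → ℤ))) {J : Finset (Fin k)}
    {e : Fin k → (Fin d → ℝ) →ₗ[ℝ] ℝ} (he : IsDual v J e) {a : Fin k → ℝ} (ha : 0 ≤ a)
    (h : InShadow v ξ (lin v a)) {i : Fin k} (hiJ : i ∈ J)
    (h' : ∀ j, j ∉ J → coordBas v T χ (a + Pi.single j 1) ∈ Zshadow v T χ ξ g) :
    coordBas v T χ (a + Pi.single i 1) ∈ Zshadow v T χ ξ g := by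
  have hsum := sum_D_mem_Zshadow g (e i) (coordBas_mem_shadow (χ := χ) hT ha h)
  simp only [D_coordBas hT ha] at hsum
  rw [← Finset.add_sum_erase _ _ (Finset.mem_univ i), he.apply_toReal hiJ, Pi.single_eq_same,
    Complex.ofReal_one, one_smul] at hsum
  refine (Submodule.add_mem_iff_left _ (Submodule.sum_mem _ fun j hj => ?_)).1 hsum
  by_cases hjJ : j ∈ J
  · rw [he.apply_toReal hjJ, Pi.single_eq_of_ne (Finset.ne_of_mem_erase hj).symm, Complex.ofReal_zero,
      zero_smul]
    exact zero_mem _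
  · exact Submodule.smul_mem _ _ (h' j hjJ)

/-- Modulo the linear system of parameters a large coordinate can be traded for a new index in the
support.  As the support has at most `k` elements, this stops after `s ≤ k` steps. -/
theorem coordBas_mem_Zshadow_of_card (hT : IsTriangulation v T)
    (hgen : AddSubgroup.closure (Set.range v) = ⊤)
    (g : Module.Basis (Fin d) ℤ (Module.Dual ℤ (Fin d → ℤ))) (s : ℕ) :
    ∀ a : Fin k → ℝ, 0 ≤ a → InShadow v ξ (lin v a) → k ≤ (supp a).card + s →
      (∃ i, (s : ℝ) + 1 < a i) → coordBas v T χ a ∈ Zshadow v T χ ξ g := by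
  have step : ∀ a : Fin k → ℝ, 0 ≤ a → InShadow v ξ (lin v a) → ∀ i, 1 < a i →
      (∀ j, j ∉ supp a → ∀ b, 0 ≤ b → InShadow v ξ (lin v b) → supp b = supp a ∪ {j} →
        b i = a i - 1 → coordBas v T χ b ∈ Zshadow v T χ ξ g) →
      coordBas v T χ a ∈ Zshadow v T χ ξ g := by
    intro a ha h i hi hj
    by_cases haT : supp a ∈ T
    swap
    · rw [coordBas_of_notMem haT]; exact zero_mem _
    obtain ⟨J, hJ, haJ⟩ := exists_maximal haT
    obtain ⟨e, he⟩ := exists_isDual_of_maximal hT hgen hJ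
    set a' := a - Pi.single i 1 with ha'
    have haa' : a = a' + Pi.single i 1 := (sub_add_cancel _ _).symm
    have hpos : ∀ j, 0 ≤ a' j ∧ (a' j ≠ 0 ↔ a j ≠ 0) := fun j => by
      by_cases hji : j = i
      · subst hji
        simp only [ha', Pi.sub_apply, Pi.single_eq_same]
        exact ⟨by linarith, by constructor <;> intro <;> linarith⟩
      · simpa [ha', hji] using ha j
    have ha0 : 0 ≤ a' := fun j => (hpos j).1
    have hsupp : supp a' = supp a := by ext j; rw [mem_supp, mem_supp, (hpos j).2]
    have hsh : InShadow v ξ (lin v a') := h.of_supp ha0 hsupp.ge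
    have hia : i ∈ supp a := mem_supp.2 (by linarith)
    rw [haa']
    refine coordBas_mem_Zshadow_of_forall hT g he ha0 hsh (haJ hia) fun j hjJ => ?_
    have hj0 := single_nonneg j (zero_le_one (α := ℝ))
    refine hj j (fun h => hjJ (haJ h)) _ (add_nonneg ha0 hj0) ?_ ?_ ?_
    · rw [map_add]
      exact hsh.add (lin_mem_K hj0)
    · rw [supp_add ha0 hj0, supp_single j one_ne_zero, hsupp]
    · have : i ≠ j := fun h => hjJ (h ▸ haJ hia)
      simp [ha', this]
  induction s with
  | zero =>
    rintro a ha h hk ⟨i, hi⟩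
    refine step a ha h i (by simpa using hi) fun j hj => absurd ?_ hj
    rw [Finset.eq_univ_of_card (supp a) (le_antisymm (Finset.card_le_univ _) (by simpa using hk))]
    exact Finset.mem_univ j
  | succ s ih =>
    rintro a ha h hk ⟨i, hi⟩
    push_cast at hi
    refine step a ha h i (by linarith [s.cast_nonneg (α := ℝ)]) fun j hj b hb hbs hsupp hbi =>
      ih b hb hbs ?_ ⟨i, by linarith⟩
    rw [hsupp, Finset.card_union_of_disjoint (by simpa using hj), Finset.card_singleton]
    omega

theorem coordBas_mem_Zshadow (hT : IsTriangulation v T)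
    (hgen : AddSubgroup.closure (Set.range v) = ⊤)
    (g : Module.Basis (Fin d) ℤ (Module.Dual ℤ (Fin d → ℤ))) {a : Fin k → ℝ} (ha : 0 ≤ a)
    (h : InShadow v ξ (lin v a)) {i : Fin k} (hi : (k : ℝ) + 1 < a i) :
    coordBas v T χ a ∈ Zshadow v T χ ξ g :=
  coordBas_mem_Zshadow_of_card hT hgen g k a ha h (Nat.le_add_left _ _) ⟨i, hi⟩

theorem coord_le_of_cls_ne_zero (hT : IsTriangulation v T)
    (hgen : AddSubgroup.closure (Set.range v) = ⊤)
    (g : Module.Basis (Fin d) ℤ (Module.Dual ℤ (Fin d → ℤ))) {w : Points v χ}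
    (hw : cls v T χ ξ g w ≠ 0) {a : Fin k → ℝ} (ha : 0 ≤ a) (haT : supp a ∈ T)
    (haw : lin v a = w.1) (i : Fin k) : a i ≤ k + 1 := by
  by_contra! hi
  apply hw
  unfold cls
  split_ifs with hs
  · rw [Submodule.Quotient.mk_eq_zero]
    change Finsupp.single w (1 : ℂ) ∈ Zshadow v T χ ξ g
    rw [← coordBas_eq_single haT haw]
    exact coordBas_mem_Zshadow hT hgen g ha (haw ▸ inShadow_of_single_mem hs) hi
  · rfl

theorem finite_lattice_points (v : Fin k → Fin d → ℤ) (χ : Fin d → ℝ) (c : ℝ) :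
    {n : Fin d → ℤ | ∃ a : Fin k → ℝ, 0 ≤ a ∧ (∀ i, a i ≤ c) ∧
      lin v a = toReal n + χ}.Finite := by
  have hcomp : Bornology.IsBounded (lin v '' Set.Icc 0 fun _ => c) :=
    (isCompact_Icc.image (lin v).continuous_of_finiteDimensional).isBounded
  obtain ⟨R, hR⟩ := hcomp.exists_norm_le
  refine (Set.finite_Icc (fun j => ⌊-R - χ j⌋ : Fin d → ℤ) (fun j => ⌈R - χ j⌉)).subset ?_
  rintro n ⟨a, ha, hac, haw⟩
  have hnorm := hR _ ⟨a, ⟨ha, hac⟩, haw⟩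
  have hj : ∀ j, |(n j : ℝ) + χ j| ≤ R := fun j => by
    simpa [toReal] using (norm_le_pi_norm _ j).trans hnorm
  refine ⟨fun j => ?_, fun j => ?_⟩
  · have := (abs_le.1 (hj j)).1
    have h2 : (⌊-R - χ j⌋ : ℝ) ≤ n j := (Int.floor_le _).trans (by linarith)
    exact_mod_cast h2
  · have := (abs_le.1 (hj j)).2
    have h2 : (n j : ℝ) ≤ ⌈R - χ j⌉ := le_trans (by linarith) (Int.le_ceil _)
    exact_mod_cast h2

theorem finite_cls_ne_zero (hT : IsTriangulation v T)
    (hgen : AddSubgroup.closure (Set.range v) = ⊤)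
    (g : Module.Basis (Fin d) ℤ (Module.Dual ℤ (Fin d → ℤ))) :
    {w : Points v χ | cls v T χ ξ g w ≠ 0}.Finite := by
  choose n hn using fun w : Points v χ => w.2.2
  refine Set.Finite.of_finite_image (f := n) ?_ ?_
  · refine (finite_lattice_points v χ (k + 1)).subset ?_
    rintro _ ⟨w, hw, rfl⟩
    obtain ⟨a, ha, haT, haw⟩ := exists_rep hT w.2.1
    exact ⟨a, ha, fun i => coord_le_of_cls_ne_zero hT hgen g hw ha haT haw i, haw.trans (hn w)⟩
  · intro w _ w' _ h
    exact Subtype.ext (by rw [hn w, hn w', h])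

end

/-! ### The reciprocal Gamma function -/

section

variable {d k : ℕ}

/-- The entire function `1 / Γ(z + 1)`. -/
def recipGamma (z : ℂ) : ℂ := (Complex.Gamma (z + 1))⁻¹

/-- The coefficient of `T^r` in the Taylor series of `1 / Γ(l + 1 + T)` at `T = 0`. -/
def gammaCoeff (r : ℕ) (l : ℂ) : ℂ := iteratedDeriv r recipGamma l / (r.factorial : ℂ)

theorem differentiable_recipGamma : Differentiable ℂ recipGamma :=
  Complex.differentiable_one_div_Gamma.comp (differentiable_id.add_const 1)

theorem recipGamma_sub_one (z : ℂ) : recipGamma (z - 1) = z * recipGamma z := by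
  unfold recipGamma
  rw [sub_add_cancel, Complex.one_div_Gamma_eq_self_mul_one_div_Gamma_add_one]

theorem recipGamma_neg_nat (n : ℕ) : recipGamma (-(n + 1 : ℂ)) = 0 := by
  unfold recipGamma
  rw [inv_eq_zero, Complex.Gamma_eq_zero_iff]
  exact ⟨n, by ring⟩

theorem recipGamma_ne_zero {z : ℂ} (h : ∀ n : ℕ, z ≠ -(n + 1 : ℂ)) : recipGamma z ≠ 0 := by
  unfold recipGamma
  refine inv_ne_zero ?_
  refine Complex.Gamma_ne_zero fun n hn => h n ?_
  rw [← sub_eq_zero] at hn ⊢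
  rw [← hn]
  ring

/-- The zeros of `1 / Γ(z + 1)` at the negative integers are simple. -/
theorem deriv_recipGamma_ne_zero (n : ℕ) : deriv recipGamma (-(n + 1 : ℂ)) ≠ 0 := by
  have key : ∀ z : ℂ, deriv recipGamma (z - 1) = recipGamma z + z * deriv recipGamma z := by
    intro z
    have h1 : HasDerivAt (fun z : ℂ => recipGamma (z - 1)) (deriv recipGamma (z - 1)) z := by
      exact (differentiable_recipGamma (z - 1)).hasDerivAt.comp_sub_const z 1
    have h2 : HasDerivAt (fun z : ℂ => z * recipGamma z)
        (1 * recipGamma z + z * deriv recipGamma z) z :=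
      (hasDerivAt_id z).mul (differentiable_recipGamma z).hasDerivAt
    simp only [recipGamma_sub_one] at h1
    simpa using h1.unique h2
  induction n with
  | zero =>
    have := key 0
    simp only [zero_sub, zero_mul, add_zero] at this
    simp [this, recipGamma]
  | succ n ih =>
    have := key (-(n + 1 : ℂ))
    rw [recipGamma_neg_nat, zero_add] at this
    have e : (-((n + 1 : ℕ) + 1 : ℂ)) = -(n + 1 : ℂ) - 1 := by push_cast; ring
    rw [e, this]
    refine mul_ne_zero (neg_ne_zero.2 ?_) ih
    exact_mod_cast n.succ_ne_zero

theorem gammaCoeff_zero (l : ℂ) : gammaCoeff 0 l = recipGamma l := by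
  simp [gammaCoeff]

theorem gammaCoeff_zero_neg_nat (n : ℕ) : gammaCoeff 0 (-(n + 1 : ℂ)) = 0 := by
  rw [gammaCoeff_zero, recipGamma_neg_nat]

theorem gammaCoeff_one_neg_nat_ne_zero (n : ℕ) : gammaCoeff 1 (-(n + 1 : ℂ)) ≠ 0 := by
  simpa [gammaCoeff, iteratedDeriv_one] using deriv_recipGamma_ne_zero n

theorem taylorCoeff_eq (y l : ℂ) (m : ℕ) :
    taylorCoeff y l m = Complex.exp (l * y) *
      ∑ j ∈ Finset.range (m + 1), y ^ j / (j.factorial : ℂ) * gammaCoeff (m - j) l := by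
  have h1 : (fun z : ℂ => Complex.exp (z * y) / Complex.Gamma (z + 1)) =
      (fun z => Complex.exp (y * z)) * recipGamma := by
    funext z
    simp [recipGamma, div_eq_mul_inv, mul_comm]
  have h2 : ContDiffAt ℂ m (fun z : ℂ => Complex.exp (y * z)) l := by fun_prop
  have h3 : ContDiffAt ℂ m recipGamma l := differentiable_recipGamma.contDiff.contDiffAt
  unfold taylorCoeff gammaCoeff
  rw [h1, iteratedDeriv_mul h2 h3, Finset.sum_div, Finset.mul_sum]
  refine Finset.sum_congr rfl fun j hj => ?_
  have hj' : j ≤ m := Nat.lt_succ_iff.1 (Finset.mem_range.1 hj)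
  rw [iteratedDeriv_cexp_const_mul, Nat.cast_choose ℂ hj']
  have h4 : (m.factorial : ℂ) ≠ 0 := by exact_mod_cast m.factorial_ne_zero
  have h5 : (j.factorial : ℂ) ≠ 0 := by exact_mod_cast j.factorial_ne_zero
  have h6 : ((m - j).factorial : ℂ) ≠ 0 := by exact_mod_cast (m - j).factorial_ne_zero
  field_simp

/-- A sequence whose ratios are eventually at most `b n` is bounded by a multiple of the product
of the `b n`. -/
theorem exists_le_mul_prod {a b : ℕ → ℝ} (ha : ∀ n, 0 ≤ a n) (hb : ∀ n, 0 < b n) (n₀ : ℕ)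
    (h : ∀ n, n₀ ≤ n → a (n + 1) ≤ b n * a n) :
    ∃ C, 0 ≤ C ∧ ∀ n, a n ≤ C * ∏ j ∈ Finset.range n, b j := by
  have hp : ∀ n, 0 < ∏ j ∈ Finset.range n, b j := fun n => Finset.prod_pos fun j _ => hb j
  refine ⟨∑ m ∈ Finset.range (n₀ + 1), a m / ∏ j ∈ Finset.range m, b j,
    Finset.sum_nonneg fun m _ => div_nonneg (ha m) (hp m).le, fun n => ?_⟩
  have small : ∀ n, n ≤ n₀ → a n ≤
      (∑ m ∈ Finset.range (n₀ + 1), a m / ∏ j ∈ Finset.range m, b j) *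
        ∏ j ∈ Finset.range n, b j := fun n hn => by
    rw [← div_le_iff₀ (hp n)]
    exact Finset.single_le_sum (f := fun m => a m / ∏ j ∈ Finset.range m, b j)
      (fun m _ => div_nonneg (ha m) (hp m).le) (Finset.mem_range.2 (by omega))
  induction n with
  | zero => exact small 0 (Nat.zero_le _)
  | succ n ih =>
    by_cases hn : n₀ ≤ n
    · refine (h n hn).trans ?_
      rw [Finset.prod_range_succ, ← mul_assoc, mul_comm _ (b n)]
      exact mul_le_mul_of_nonneg_left ih (hb n).le
    · exact small _ (by omega)

/-- The order of growth of `1 / Γ(z + n + 1)` in the integer `n`: it is `1 / n!` for `n ≥ 0` and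
`(-n)!` for `n ≤ 0`. -/
def growth (n : ℤ) : ℝ := ((-n).toNat.factorial : ℝ) / (n.toNat.factorial : ℝ)

/-- Both bounds follow from the functional equation; the base `2` of the exponential factor does not
depend on the radius `r`, which is what makes the domain of convergence independent of `β`. -/
theorem exists_norm_recipGamma_le (r : ℝ) : ∃ C, 0 ≤ C ∧ ∀ z : ℂ, ‖z‖ ≤ r → ∀ n : ℤ,
    ‖recipGamma (z + n)‖ ≤ C * (2 ^ n.natAbs * growth n) := by
  let M : ℤ → ℝ := fun n => sSup ((fun z : ℂ => ‖recipGamma (z + n)‖) '' Metric.closedBall 0 r)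
  have hcomp : ∀ n : ℤ, BddAbove ((fun z : ℂ => ‖recipGamma (z + n)‖) '' Metric.closedBall 0 r) :=
    fun n => (((isCompact_closedBall (0 : ℂ) r).image (f := fun z : ℂ => ‖recipGamma (z + n)‖)
      (continuous_norm.comp (differentiable_recipGamma.continuous.comp
        (continuous_id.add continuous_const)))).bddAbove)
  have hM : ∀ n : ℤ, ∀ z : ℂ, ‖z‖ ≤ r → ‖recipGamma (z + n)‖ ≤ M n := fun n z hz =>
    le_csSup (hcomp n) ⟨z, by simpa using hz, rfl⟩
  have hM0 : ∀ n, 0 ≤ M n := fun n => Real.sSup_nonneg (by rintro _ ⟨z, _, rfl⟩; positivity)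
  have hMle : ∀ n : ℤ, ∀ B : ℝ, 0 ≤ B → (∀ z : ℂ, ‖z‖ ≤ r → ‖recipGamma (z + n)‖ ≤ B) → M n ≤ B := by
    intro n B hB h
    refine Real.sSup_le ?_ hB
    rintro _ ⟨z, hz, rfl⟩
    exact h z (by simpa using hz)
  obtain ⟨N, hN⟩ := exists_nat_ge (2 * |r|)
  have hr : r ≤ |r| := le_abs_self r
  have step1 : ∀ n : ℕ, N ≤ n → M (n + 1 : ℕ) ≤ 2 * ((n : ℝ) + 1)⁻¹ * M n := by
    intro n hn
    have hn' : (N : ℝ) ≤ n := by exact_mod_cast hn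
    refine hMle _ _ (mul_nonneg (by positivity) (hM0 _)) fun z hz => ?_
    have e : z + ((n : ℤ) : ℂ) = (z + (((n + 1 : ℕ) : ℤ) : ℂ)) - 1 := by push_cast; ring
    have h3 := hM n z hz
    rw [e, recipGamma_sub_one, norm_mul] at h3
    have h4 : ((n : ℝ) + 1) / 2 ≤ ‖z + (((n + 1 : ℕ) : ℤ) : ℂ)‖ := by
      have := norm_sub_norm_le (((n + 1 : ℕ) : ℤ) : ℂ) (-z)
      rw [norm_neg, sub_neg_eq_add, add_comm _ z] at this
      refine le_trans ?_ this
      rw [Int.cast_natCast, Complex.norm_natCast]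
      push_cast
      linarith
    have h5 := (mul_le_mul_of_nonneg_right h4 (norm_nonneg _)).trans h3
    have h6 : (0 : ℝ) < (n : ℝ) + 1 := by positivity
    rw [mul_right_comm, ← div_eq_mul_inv, le_div_iff₀ h6]
    linarith
  have step2 : ∀ n : ℕ, N ≤ n → M (-((n + 1 : ℕ) : ℤ)) ≤ 2 * ((n : ℝ) + 1) * M (-n) := by
    intro n hn
    have hn' : (N : ℝ) ≤ n := by exact_mod_cast hn
    refine hMle _ _ (mul_nonneg (by positivity) (hM0 _)) fun z hz => ?_
    have e : z + ((-((n + 1 : ℕ) : ℤ) : ℤ) : ℂ) = (z + ((-(n : ℤ) : ℤ) : ℂ)) - 1 := by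
      push_cast; ring
    rw [e, recipGamma_sub_one, norm_mul]
    refine mul_le_mul ?_ (hM _ z hz) (norm_nonneg _) (by positivity)
    refine (norm_add_le _ _).trans ?_
    simp only [Int.cast_neg, Int.cast_natCast, norm_neg, Complex.norm_natCast]
    linarith [abs_nonneg r]
  obtain ⟨C₁, hC₁, h1⟩ := exists_le_mul_prod (a := fun n : ℕ => M n)
    (b := fun n => 2 * ((n : ℝ) + 1)⁻¹) (fun n => hM0 _) (fun n => by positivity) N step1
  obtain ⟨C₂, hC₂, h2⟩ := exists_le_mul_prod (a := fun n : ℕ => M (-n))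
    (b := fun n => 2 * ((n : ℝ) + 1)) (fun n => hM0 _) (fun n => by positivity) N step2
  have hprod : ∀ n : ℕ, ∏ j ∈ Finset.range n, ((j : ℝ) + 1) = n.factorial := fun n => by
    rw [← Finset.prod_range_add_one_eq_factorial]
    push_cast
    rfl
  refine ⟨C₁ + C₂, by positivity, fun z hz n => (hM n z hz).trans ?_⟩
  rcases Int.eq_nat_or_neg n with ⟨m, rfl | rfl⟩
  · refine (h1 m).trans ?_
    rw [Finset.prod_mul_distrib, Finset.prod_inv_distrib, hprod]
    simp only [Finset.prod_const, Finset.card_range, Int.natAbs_natCast, growth,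
      Int.toNat_natCast, Int.toNat_neg_natCast, Nat.factorial_zero, Nat.cast_one, one_div]
    gcongr
    linarith
  · refine (h2 m).trans ?_
    rw [Finset.prod_mul_distrib, hprod]
    simp only [Finset.prod_const, Finset.card_range, Int.natAbs_neg, Int.natAbs_natCast,
      growth, neg_neg, Int.toNat_natCast, Int.toNat_neg_natCast, Nat.factorial_zero,
      Nat.cast_one, div_one]
    gcongr
    linarith

/-- Cauchy's estimate on circles of radius one bounds all Taylor coefficients simultaneously. -/
theorem exists_norm_gammaCoeff_le (α : ℂ) : ∃ C, 0 ≤ C ∧ ∀ (r : ℕ) (n : ℤ),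
    ‖gammaCoeff r (α + n)‖ ≤ C * (2 ^ n.natAbs * growth n) := by
  obtain ⟨C, hC, h⟩ := exists_norm_recipGamma_le (‖α‖ + 1)
  refine ⟨C, hC, fun r n => ?_⟩
  have := Complex.norm_iteratedDeriv_le_of_forall_mem_sphere_norm_le (c := α + n) (R := 1) r
    one_pos differentiable_recipGamma.diffContOnCl (C := C * (2 ^ n.natAbs * growth n))
    fun z hz => ?_
  · rw [gammaCoeff, norm_div, Complex.norm_natCast, div_le_iff₀ (by positivity)]
    simpa [mul_comm] using this
  · have e : z = (z - n) + n := by ring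
    rw [e]
    refine h _ ?_ n
    rw [mem_sphere_iff_norm] at hz
    calc ‖z - n‖ = ‖α + (z - (α + n))‖ := by congr 1; ring
      _ ≤ _ := (norm_add_le _ _).trans (by rw [hz])

theorem factorial_sum_le {ι : Type*} (s : Finset ι) (n : ι → ℕ) :
    (∑ i ∈ s, n i).factorial ≤ 2 ^ (s.card * ∑ i ∈ s, n i) * ∏ i ∈ s, (n i).factorial := by
  classical
  induction s using Finset.induction_on with
  | empty => simp
  | insert i s hi ih =>
    rw [Finset.sum_insert hi, Finset.prod_insert hi, Finset.card_insert_of_notMem hi]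
    rw [← Nat.add_choose_mul_factorial_mul_factorial]
    calc (n i + ∑ j ∈ s, n j).choose (∑ j ∈ s, n j) * (n i).factorial * (∑ j ∈ s, n j).factorial
        ≤ 2 ^ (n i + ∑ j ∈ s, n j) * (n i).factorial *
          (2 ^ (s.card * (n i + ∑ j ∈ s, n j)) * ∏ j ∈ s, (n j).factorial) := by
          refine Nat.mul_le_mul (Nat.mul_le_mul_right _ (Nat.choose_le_two_pow _ _)) (ih.trans ?_)
          refine Nat.mul_le_mul_right _ (Nat.pow_le_pow_right two_pos ?_)
          exact Nat.mul_le_mul_left _ (Nat.le_add_left _ _)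
      _ = _ := by ring

/-- Because `∑ n_i` is bounded, the factorials in the numerator are compensated by those in the
denominator, up to an exponential factor. -/
theorem exists_prod_growth_le (k : ℕ) (κ : ℕ) : ∃ C : ℝ, 0 ≤ C ∧ ∀ n : Fin k → ℤ,
    |∑ i, n i| ≤ κ → ∏ i, growth (n i) ≤ C * (2 ^ (k + 1)) ^ (∑ i, (n i).natAbs) := by
  refine ⟨2 ^ κ * κ.factorial, by positivity, fun n hn => ?_⟩
  set P := ∑ i, (n i).toNat with hP
  set Q := ∑ i, (-n i).toNat with hQ
  have hPQ : (P : ℤ) - Q = ∑ i, n i := by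
    rw [hP, hQ]
    push_cast
    rw [← Finset.sum_sub_distrib]
    exact Finset.sum_congr rfl fun i _ => by omega
  have hQP : Q ≤ P + κ := by
    rw [abs_le] at hn
    omega
  have hPn : P ≤ ∑ i, (n i).natAbs := Finset.sum_le_sum fun i _ => by omega
  have h1 : ∏ i, (-n i).toNat.factorial ≤ Q.factorial :=
    Nat.le_of_dvd (Nat.factorial_pos _) (Nat.prod_factorial_dvd_factorial_sum _ _)
  have h2 : Q.factorial ≤ 2 ^ (P + κ) * (P.factorial * κ.factorial) := by
    refine (Nat.factorial_le hQP).trans ?_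
    rw [← Nat.add_choose_mul_factorial_mul_factorial, mul_assoc]
    exact Nat.mul_le_mul_right _ (Nat.choose_le_two_pow _ _)
  have h3 := factorial_sum_le Finset.univ fun i => (n i).toNat
  rw [← hP, Finset.card_univ, Fintype.card_fin] at h3
  have h4 : ∏ i, (-n i).toNat.factorial ≤
      2 ^ κ * κ.factorial * (2 ^ (k + 1)) ^ P * ∏ i, (n i).toNat.factorial := by
    refine (h1.trans h2).trans ?_
    refine (Nat.mul_le_mul_left _ (Nat.mul_le_mul_right _ h3)).trans (le_of_eq ?_)
    rw [← pow_mul]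
    ring
  unfold growth
  rw [Finset.prod_div_distrib, div_le_iff₀ (Finset.prod_pos fun i _ => by positivity)]
  have h5 : 2 ^ κ * κ.factorial * (2 ^ (k + 1)) ^ P * ∏ i, (n i).toNat.factorial ≤
      2 ^ κ * κ.factorial * (2 ^ (k + 1)) ^ (∑ i, (n i).natAbs) * ∏ i, (n i).toNat.factorial := by
    gcongr
    exact Nat.one_le_two_pow
  exact_mod_cast h4.trans h5

end

/-! ### Uniqueness of logarithmic series expansions -/

section

variable {d k : ℕ}

theorem summable_prod_of_nonneg {f : ℤ → ℝ} (h0 : ∀ n, 0 ≤ f n) (hf : Summable f) :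
    Summable fun n : Fin k → ℤ => ∏ i, f (n i) := by
  classical
  refine summable_of_sum_le (c := (∑' n, f n) ^ k)
    (fun n => Finset.prod_nonneg fun i _ => h0 _) fun s => ?_
  have hsub : s ⊆ Fintype.piFinset fun i : Fin k => s.image fun n => n i := by
    intro n hn
    rw [Fintype.mem_piFinset]
    exact fun i => Finset.mem_image_of_mem _ hn
  calc ∑ n ∈ s, ∏ i, f (n i)
      ≤ ∑ n ∈ Fintype.piFinset fun i : Fin k => s.image fun n => n i, ∏ i, f (n i) :=
        Finset.sum_le_sum_of_subset_of_nonneg hsub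
          fun n _ _ => Finset.prod_nonneg fun i _ => h0 _
    _ = ∏ i : Fin k, ∑ j ∈ s.image fun n => n i, f j := (Finset.prod_univ_sum _ _).symm
    _ ≤ ∏ _i : Fin k, ∑' n, f n := by
        refine Finset.prod_le_prod (fun i _ => Finset.sum_nonneg fun j _ => h0 _) fun i _ => ?_
        exact hf.sum_le_tsum _ fun j _ => h0 j
    _ = (∑' n, f n) ^ k := by simp

open UnitAddTorus in
/-- An absolutely convergent Fourier series that vanishes identically has zero coefficients. -/
theorem fourier_coeff_eq_zero {a : (Fin k → ℤ) → ℂ} (ha : Summable fun n => ‖a n‖)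
    (h : ∀ θ : Fin k → ℝ, ∑' n, a n * Complex.exp (∑ i, (n i : ℂ) * (θ i * Complex.I)) = 0)
    (n₀ : Fin k → ℤ) : a n₀ = 0 := by
  have hs : Summable fun n => a n • (mFourier n : C(UnitAddTorus (Fin k), ℂ)) := by
    refine Summable.of_norm ?_
    simpa [norm_smul, mFourier_norm] using ha
  have hzero : ∑' n, a n • (mFourier n : C(UnitAddTorus (Fin k), ℂ)) = 0 := by
    ext x
    obtain ⟨t, rfl⟩ : ∃ t : Fin k → ℝ, (fun i => (t i : UnitAddCircle)) = x :=
      ⟨fun i => (x i).out, by ext i; exact Quotient.out_eq _⟩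
    rw [← ContinuousMap.tsum_apply hs]
    have := h fun i => 2 * Real.pi * t i
    simp only [ContinuousMap.coe_zero, Pi.zero_apply]
    rw [← this]
    refine tsum_congr fun n => ?_
    simp only [ContinuousMap.coe_smul, Pi.smul_apply, smul_eq_mul, mFourier,
      ContinuousMap.coe_mk, fourier_coe_apply]
    rw [← Complex.exp_sum]
    congr 2
    refine Finset.sum_congr rfl fun i _ => ?_
    push_cast
    ring
  have h1 : HasSum (fun n => a n • mFourierLp (d := Fin k) 2 n) 0 := by
    have hs' := hs.hasSum
    rw [hzero] at hs'
    have hmap : ∀ {V : Type} [NormedAddCommGroup V] [NormedSpace ℂ V]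
        (φ : C(UnitAddTorus (Fin k), ℂ) →L[ℂ] V),
        HasSum (fun n => a n • φ (mFourier n)) 0 := fun φ => by
      simpa only [map_zero, map_smul, Function.comp_def] using φ.hasSum hs'
    exact hmap _
  have h2 := (innerSL ℂ (mFourierLp (d := Fin k) 2 n₀)).hasSum h1
  have ho := orthonormal_mFourier (d := Fin k)
  rw [map_zero] at h2
  refine (hasSum_ite_eq n₀ (a n₀)).unique ?_
  convert! h2 using 2 with n
  rw [innerSL_apply_apply, inner_smul_right, orthonormal_iff_ite.1 ho]
  by_cases hn : n = n₀
  · rw [if_pos hn, if_pos hn.symm, hn, mul_one]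
  · rw [if_neg hn, if_neg (Ne.symm hn), mul_zero]

/-- The translation of functions on `ℤ^k` by the `i`-th basis vector. -/
def shift (i : Fin k) : Module.End ℂ ((Fin k → ℤ) → ℂ) :=
  LinearMap.funLeft ℂ ℂ fun n => n + Pi.single i 1

theorem shift_apply (i : Fin k) (f : (Fin k → ℤ) → ℂ) (n : Fin k → ℤ) :
    shift i f n = f (n + Pi.single i 1) := rfl

theorem mem_maxGenEigenspace_of_sub_mem {V : Type*} [AddCommGroup V] [Module ℂ V]
    {f : Module.End ℂ V} {μ : ℂ} {x : V} (h : f x - μ • x ∈ f.maxGenEigenspace μ) :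
    x ∈ f.maxGenEigenspace μ := by
  rw [Module.End.mem_maxGenEigenspace] at h ⊢
  obtain ⟨N, hN⟩ := h
  refine ⟨N + 1, ?_⟩
  rw [pow_succ, Module.End.mul_apply]
  simpa using hN

/-- A monomial of degree `b` in `n_i` times `χ ^ n_i` is a generalized eigenvector of the translation,
since `shift - χ` lowers the degree. -/
theorem mul_zpow_mul_pow_mem_maxGenEigenspace (i : Fin k) {χ : ℂ} (hχ : χ ≠ 0) (z ω : ℂ)
    (q : (Fin k → ℤ) → ℂ) (hq : ∀ n, q (n + Pi.single i 1) = q n) (b : ℕ) :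
    (fun n : Fin k → ℤ => q n * (χ ^ n i * (z + n i * ω) ^ b)) ∈
      (shift i).maxGenEigenspace χ := by
  induction b using Nat.strong_induction_on with
  | _ b ih =>
    apply mem_maxGenEigenspace_of_sub_mem
    have : (shift i (fun n : Fin k → ℤ => q n * (χ ^ n i * (z + n i * ω) ^ b)) -
        χ • fun n : Fin k → ℤ => q n * (χ ^ n i * (z + n i * ω) ^ b)) =
        ∑ j ∈ Finset.range b, (χ * (ω ^ (b - j) * (b.choose j))) •
          fun n : Fin k → ℤ => q n * (χ ^ n i * (z + n i * ω) ^ j) := by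
      ext n
      simp only [Pi.sub_apply, shift_apply, hq, Pi.smul_apply, smul_eq_mul, Pi.add_apply,
        Pi.single_eq_same, Finset.sum_apply]
      have e : (z + ((n i + 1 : ℤ) : ℂ) * ω) = (z + n i * ω) + ω := by push_cast; ring
      rw [e, add_pow, Finset.sum_range_succ, zpow_add_one₀ hχ]
      simp only [Nat.sub_self, pow_zero, Nat.choose_self, Nat.cast_one, mul_one]
      have : ∑ j ∈ Finset.range b, χ * (ω ^ (b - j) * (b.choose j)) *
          (q n * (χ ^ n i * (z + n i * ω) ^ j)) = q n * (χ ^ n i * χ) *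
          ∑ j ∈ Finset.range b, (z + n i * ω) ^ j * ω ^ (b - j) * (b.choose j) := by
        rw [Finset.mul_sum]
        exact Finset.sum_congr rfl fun j _ => by ring
      rw [this]
      ring
    rw [this]
    exact Submodule.sum_mem _ fun j hj => Submodule.smul_mem _ _ (ih j (Finset.mem_range.1 hj))

theorem polyExp_mem (χ : Fin k → ℂ) (hχ : ∀ i, χ i ≠ 0) (z : Fin k → ℂ) (ω : ℂ)
    (S : Finset (Fin k → ℕ)) (b : (Fin k → ℕ) → ℂ) :
    (fun n : Fin k → ℤ => (∏ i, χ i ^ n i) * ∑ a ∈ S, (∏ i, (z i + n i * ω) ^ a i) * b a) ∈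
      ⨅ i, (shift i).maxGenEigenspace (χ i) := by
  rw [Submodule.mem_iInf]
  intro i
  have : (fun n : Fin k → ℤ => (∏ i, χ i ^ n i) *
      ∑ a ∈ S, (∏ i, (z i + n i * ω) ^ a i) * b a) = ∑ a ∈ S, fun n : Fin k → ℤ =>
      (b a * ∏ j ∈ Finset.univ.erase i, (χ j ^ n j * (z j + n j * ω) ^ a j)) *
        (χ i ^ n i * (z i + n i * ω) ^ a i) := by
    ext n
    rw [Finset.sum_apply, Finset.mul_sum]
    refine Finset.sum_congr rfl fun a _ => ?_
    rw [mul_assoc, Finset.prod_erase_mul _ _ (Finset.mem_univ i), Finset.prod_mul_distrib]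
    ring
  rw [this]
  refine Submodule.sum_mem _ fun a _ =>
    mul_zpow_mul_pow_mem_maxGenEigenspace i (hχ i) _ _ _ (fun n => ?_) _
  congr 1
  refine Finset.prod_congr rfl fun j hj => ?_
  simp [Finset.ne_of_mem_erase hj]

/-- Products of polynomials with distinct characters of `ℤ^k` are linearly independent, because they
lie in distinct joint generalized eigenspaces of the translations. -/
theorem polyExp_independent {ι : Type*} (A : Finset ι) (χ : ι → Fin k → ℂ)
    (hχ : ∀ α ∈ A, ∀ i, χ α i ≠ 0) (hinj : Set.InjOn χ A) (z : Fin k → ℂ) {ω : ℂ} (hω : ω ≠ 0)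
    (S : Finset (Fin k → ℕ)) (b : ι → (Fin k → ℕ) → ℂ)
    (h : ∀ n : Fin k → ℤ, ∑ α ∈ A, (∏ i, χ α i ^ n i) *
      ∑ a ∈ S, (∏ i, (z i + n i * ω) ^ a i) * b α a = 0) :
    ∀ α ∈ A, ∀ a ∈ S, b α a = 0 := by
  classical
  have hind : iSupIndep fun χ : Fin k → ℂ => ⨅ i, (shift i).maxGenEigenspace (χ i) := by
    refine Module.End.independent_iInf_maxGenEigenspace_of_forall_mapsTo _ fun i j φ => ?_
    refine Module.End.mapsTo_maxGenEigenspace_of_comm ?_ φ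
    ext f n
    simp [shift_apply, add_right_comm]
  have hind' := hind.comp (f := fun α : A => χ α) (fun α β hαβ =>
    Subtype.ext (hinj α.2 β.2 hαβ))
  intro α hα
  have h0 := (iSupIndep_iff_finsetSum_eq_zero_imp_eq_zero _).1 hind' Finset.univ
    (fun α n => (∏ i, χ α i ^ n i) *
      ∑ a ∈ S, (∏ i, (z i + n i * ω) ^ a i) * b α a)
    (fun α _ => polyExp_mem _ (hχ α α.2) _ _ _ _)
    (by
      ext n
      rw [Finset.sum_apply, Finset.sum_coe_sort A (fun α => (∏ i, χ α i ^ n i) *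
      ∑ a ∈ S, (∏ i, (z i + n i * ω) ^ a i) * b α a)]
      exact h n) ⟨α, hα⟩ (Finset.mem_univ _)
  let P : MvPolynomial (Fin k) ℂ :=
    ∑ a ∈ S, MvPolynomial.monomial (Finsupp.equivFunOnFinite.symm a) (b α a)
  have hP : P = 0 := by
    refine MvPolynomial.funext_set (fun i => Set.range fun n : ℤ => z i + n * ω)
      (fun i => Set.infinite_range_of_injective fun n m hnm => ?_) fun x hx => ?_
    · simpa [hω] using hnm
    · choose n hn using fun i => hx i (Set.mem_univ i)
      obtain rfl : (fun i => z i + n i * ω) = x := funext hn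
      have := congrFun h0 n
      simp only [Pi.zero_apply, mul_eq_zero] at this
      rcases this with h1 | h1
      · exact absurd h1 (Finset.prod_ne_zero_iff.2 fun i _ => zpow_ne_zero _ (hχ α hα i))
      · simp only [P, map_sum, MvPolynomial.eval_monomial, map_zero]
        rw [← h1]
        refine Finset.sum_congr rfl fun a _ => ?_
        rw [Finsupp.prod_fintype _ _ (by simp)]
        simp [mul_comm]
  intro a ha
  have := congrArg (MvPolynomial.coeff (Finsupp.equivFunOnFinite.symm a)) hP
  simpa [P, MvPolynomial.coeff_sum, MvPolynomial.coeff_monomial, Finset.sum_ite_eq', ha] using this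

/-- The Laurent series `∑_n c_n e^{n · y}` in the variables `e^{y_i}`. -/
def expSum (c : (Fin k → ℤ) → ℂ) (y : Fin k → ℂ) : ℂ :=
  ∑' n : Fin k → ℤ, c n * Complex.exp (∑ i, (n i : ℂ) * y i)

theorem norm_exp_sum (n : Fin k → ℤ) (y : Fin k → ℂ) :
    ‖Complex.exp (∑ i, (n i : ℂ) * y i)‖ = Real.exp (∑ i, (n i : ℝ) * (y i).re) := by
  rw [Complex.norm_exp]
  simp

theorem expSum_add_two_pi (c : (Fin k → ℤ) → ℂ) (y : Fin k → ℂ) (m : Fin k → ℤ) :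
    expSum c (fun i => y i + m i * (2 * Real.pi * Complex.I)) = expSum c y := by
  unfold expSum
  refine tsum_congr fun n => ?_
  congr 1
  have : ∑ i, (n i : ℂ) * (y i + m i * (2 * Real.pi * Complex.I)) =
      ∑ i, (n i : ℂ) * y i + (∑ i, n i * m i : ℤ) * (2 * Real.pi * Complex.I) := by
    push_cast
    rw [Finset.sum_mul, ← Finset.sum_add_distrib]
    exact Finset.sum_congr rfl fun i _ => by ring
  rw [this, Complex.exp_add, Complex.exp_int_mul_two_pi_mul_I, mul_one]

theorem continuous_expSum {c : (Fin k → ℤ) → ℂ} {ρ : Fin k → ℝ}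
    (hc : Summable fun n => ‖c n‖ * Real.exp (∑ i, (n i : ℝ) * ρ i)) :
    Continuous fun θ : Fin k → ℝ => expSum c fun i => ρ i + θ i * Complex.I := by
  refine continuous_tsum (fun n => by fun_prop) hc fun n θ => ?_
  rw [norm_mul, norm_exp_sum]
  simp

/-- On a strip the series is dominated by its values at the two boundary lines. -/
theorem differentiableOn_expSum_line {c : (Fin k → ℤ) → ℂ} {ρ η : Fin k → ℝ} {ε : ℝ}
    (h1 : Summable fun n => ‖c n‖ * Real.exp (∑ i, (n i : ℝ) * (ρ i + ε * η i)))
    (h2 : Summable fun n => ‖c n‖ * Real.exp (∑ i, (n i : ℝ) * (ρ i - ε * η i)))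
    (y : Fin k → ℂ) (hy : ∀ i, (y i).re = ρ i) :
    DifferentiableOn ℂ (fun s : ℂ => expSum c fun i => y i + s * (η i * Complex.I))
      {s | |s.im| < ε} := by
  refine Complex.differentiableOn_tsum_of_summable_norm (h1.add h2) (fun n => ?_) ?_ fun n s hs => ?_
  · fun_prop
  · exact isOpen_lt (by fun_prop) continuous_const
  rw [norm_mul, norm_exp_sum, ← mul_add]
  gcongr
  have e : ∀ i, (y i + s * (η i * Complex.I)).re = ρ i - s.im * η i := fun i => by
    simp [hy, sub_eq_add_neg]
  simp only [e]
  have e1 : ∀ t : ℝ, ∑ i, (n i : ℝ) * (ρ i + t * η i) =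
      ∑ i, (n i : ℝ) * ρ i + t * ∑ i, (n i : ℝ) * η i := fun t => by
    rw [Finset.mul_sum, ← Finset.sum_add_distrib]
    exact Finset.sum_congr rfl fun i _ => by ring
  have e2 : ∀ t : ℝ, ∑ i, (n i : ℝ) * (ρ i - t * η i) =
      ∑ i, (n i : ℝ) * ρ i - t * ∑ i, (n i : ℝ) * η i := fun t => by
    rw [Finset.mul_sum, ← Finset.sum_sub_distrib]
    exact Finset.sum_congr rfl fun i _ => by ring
  rw [e1, e2, e2]
  have hs' : |s.im| < ε := hs
  rw [abs_lt] at hs'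
  rcases le_total 0 (∑ i, (n i : ℝ) * η i) with h | h
  · refine le_add_of_le_of_nonneg (Real.exp_le_exp.2 ?_) (Real.exp_pos _).le
    nlinarith
  · refine le_add_of_nonneg_of_le (Real.exp_pos _).le (Real.exp_le_exp.2 ?_)
    nlinarith

/-- A finite sum of Laurent series with complex exponents in `α + ℤ^k`, `α ∈ A`, and with
coefficients that are polynomials in the logarithms `y`, of degree at most `N i` in `y i`. -/
def logSum (A : Finset (Fin k → ℂ)) (N : Fin k → ℕ)
    (c : (Fin k → ℂ) → (Fin k → ℕ) → (Fin k → ℤ) → ℂ) (y : Fin k → ℂ) : ℂ :=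
  ∑ α ∈ A, Complex.exp (∑ i, α i * y i) *
    ∑ a ∈ Finset.Iic N, (∏ i, y i ^ a i) * expSum (c α a) y

/-- The expansion of a logarithmic series is unique.  Translations by `2 π i ℤ^k` separate the exponents
modulo `ℤ^k` and the powers of the logarithms; the remaining series are Fourier series. -/
theorem coeff_eq_zero_of_logSum_eq_zero {A : Finset (Fin k → ℂ)}
    (hA : ∀ α ∈ A, ∀ i, 0 ≤ (α i).re ∧ (α i).re < 1) {N : Fin k → ℕ}
    {c : (Fin k → ℂ) → (Fin k → ℕ) → (Fin k → ℤ) → ℂ} {ρ : Fin k → ℝ}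
    (hc : ∀ α ∈ A, ∀ a ∈ Finset.Iic N,
      Summable fun n => ‖c α a n‖ * Real.exp (∑ i, (n i : ℝ) * ρ i))
    (h : ∀ θ : Fin k → ℝ, logSum A N c (fun i => ρ i + θ i * Complex.I) = 0) :
    ∀ α ∈ A, ∀ a ∈ Finset.Iic N, c α a = 0 := by
  have hπ : (2 * Real.pi * Complex.I : ℂ) ≠ 0 := Complex.two_pi_I_ne_zero
  have key : ∀ θ : Fin k → ℝ, ∀ α ∈ A, ∀ a ∈ Finset.Iic N,
      expSum (c α a) (fun i => ρ i + θ i * Complex.I) = 0 := by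
    intro θ α hα a ha
    set y : Fin k → ℂ := fun i => ρ i + θ i * Complex.I with hy
    have := polyExp_independent A (fun α i => Complex.exp (α i * (2 * Real.pi * Complex.I)))
      (fun α _ i => Complex.exp_ne_zero _) ?_ y hπ (Finset.Iic N)
      (fun α a => Complex.exp (∑ i, α i * y i) * expSum (c α a) y) (fun n => ?_) α hα a ha
    · exact (mul_eq_zero.1 this).resolve_left (Complex.exp_ne_zero _)
    · intro α hα α' hα' he
      funext i
      obtain ⟨m, hm⟩ := Complex.exp_eq_exp_iff_exists_int.1 (congrFun he i)
      rw [← add_mul] at hm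
      have hm' := mul_right_cancel₀ hπ hm
      have h1 := hA α hα i
      have h2 := hA α' hα' i
      have hre := congrArg Complex.re hm'
      simp only [Complex.add_re, Complex.intCast_re] at hre
      have : m = 0 := by
        have h3 : (m : ℝ) < 1 := by linarith
        have h4 : (-1 : ℝ) < m := by linarith
        have h3' : m < 1 := by exact_mod_cast h3
        have h4' : -1 < m := by exact_mod_cast h4
        omega
      simpa [this] using hm'
    · have := h fun i => θ i + n i * (2 * Real.pi)
      have e : (fun i => (ρ i : ℂ) + ((θ i + n i * (2 * Real.pi) : ℝ) : ℂ) * Complex.I) =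
          fun i => y i + n i * (2 * Real.pi * Complex.I) := by
        funext i
        simp only [hy]
        push_cast
        ring
      rw [e] at this
      rw [← this]
      unfold logSum
      refine Finset.sum_congr rfl fun α _ => ?_
      rw [Finset.mul_sum, Finset.mul_sum]
      refine Finset.sum_congr rfl fun a _ => ?_
      rw [expSum_add_two_pi]
      have e2 : Complex.exp (∑ i, α i * (y i + n i * (2 * Real.pi * Complex.I))) =
          (∏ i, Complex.exp (α i * (2 * Real.pi * Complex.I)) ^ n i) *
            Complex.exp (∑ i, α i * y i) := by
        simp only [← Complex.exp_int_mul]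
        rw [← Complex.exp_sum, ← Complex.exp_add, ← Finset.sum_add_distrib]
        congr 1
        exact Finset.sum_congr rfl fun i _ => by ring
      rw [e2]
      ring
  intro α hα a ha
  funext n
  have h1 := fourier_coeff_eq_zero (a := fun n => c α a n *
    Complex.exp (∑ i, (n i : ℂ) * (ρ i : ℂ))) ?_ (fun θ => ?_) n
  · exact (mul_eq_zero.1 h1).resolve_right (Complex.exp_ne_zero _)
  · simpa [norm_mul, norm_exp_sum] using hc α hα a ha
  · rw [← key θ α hα a ha]
    refine tsum_congr fun n => ?_
    rw [mul_assoc, ← Complex.exp_add, ← Finset.sum_add_distrib]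
    simp only [mul_add]

/-- Analytic continuation along complexified lines in the imaginary directions. -/
theorem logSum_eq_zero_of_eventually {A : Finset (Fin k → ℂ)} {N : Fin k → ℕ}
    {c : (Fin k → ℂ) → (Fin k → ℕ) → (Fin k → ℤ) → ℂ} {Ω : Set (Fin k → ℝ)} (hΩ : IsOpen Ω)
    (hc : ∀ α ∈ A, ∀ a ∈ Finset.Iic N, ∀ ρ ∈ Ω,
      Summable fun n => ‖c α a n‖ * Real.exp (∑ i, (n i : ℝ) * ρ i))
    {ρ : Fin k → ℝ} (hρ : ρ ∈ Ω) {θ₀ : Fin k → ℝ}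
    (h : ∀ᶠ θ in nhds θ₀, logSum A N c (fun i => ρ i + θ i * Complex.I) = 0) (θ : Fin k → ℝ) :
    logSum A N c (fun i => ρ i + θ i * Complex.I) = 0 := by
  obtain ⟨ε, hε, hεΩ⟩ : ∃ ε : ℝ, 0 < ε ∧ (ρ + ε • (θ - θ₀) ∈ Ω) ∧ ρ - ε • (θ - θ₀) ∈ Ω := by
    have h1 : ∀ᶠ t : ℝ in nhds 0, ρ + t • (θ - θ₀) ∈ Ω :=
      ContinuousAt.eventually_mem (by fun_prop) (hΩ.mem_nhds (by simpa using hρ))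
    have h2 : ∀ᶠ t : ℝ in nhds 0, ρ - t • (θ - θ₀) ∈ Ω :=
      ContinuousAt.eventually_mem (by fun_prop) (hΩ.mem_nhds (by simpa using hρ))
    have := ((h1.and h2).filter_mono nhdsWithin_le_nhds).and
      (self_mem_nhdsWithin : Set.Ioi (0 : ℝ) ∈ nhdsWithin 0 (Set.Ioi 0))
    obtain ⟨t, ht, ht0⟩ := this.exists
    exact ⟨t, ht0, ht⟩
  let S : Set ℂ := {s | |s.im| < ε}
  let y : ℂ → Fin k → ℂ := fun s i =>
    (ρ i + θ₀ i * Complex.I) + s * (((θ - θ₀) i : ℝ) * Complex.I)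
  have hd : DifferentiableOn ℂ (fun s => logSum A N c (y s)) S := by
    unfold logSum
    refine DifferentiableOn.fun_sum fun α hα => DifferentiableOn.fun_mul (by fun_prop)
      (DifferentiableOn.fun_sum fun a ha => DifferentiableOn.fun_mul (by fun_prop) ?_)
    exact differentiableOn_expSum_line (ρ := ρ) (hc α hα a ha _ hεΩ.1) (hc α hα a ha _ hεΩ.2) _
      (by simp)
  have hS : IsOpen S := isOpen_lt (by fun_prop) continuous_const
  have hconv : Convex ℝ S := by
    have : S = Complex.imLm ⁻¹' (Set.Ioo (-ε) ε) := by
      ext s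
      simp [S, abs_lt]
    rw [this]
    exact (convex_Ioo _ _).linear_preimage _
  have hy : ∀ t : ℝ, y t = fun i => (ρ i : ℂ) + ((θ₀ + t • (θ - θ₀)) i : ℝ) * Complex.I := by
    intro t
    funext i
    simp only [y, Pi.add_apply, Pi.smul_apply, smul_eq_mul]
    push_cast
    ring
  have hfreq : ∃ᶠ s in nhdsWithin (0 : ℂ) {0}ᶜ, logSum A N c (y s) = 0 := by
    have h1 : ∀ᶠ t : ℝ in nhds 0, logSum A N c (y t) = 0 := by
      have ht : Filter.Tendsto (fun t : ℝ => θ₀ + t • (θ - θ₀)) (nhds 0) (nhds θ₀) := by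
        have : Continuous fun t : ℝ => θ₀ + t • (θ - θ₀) := by fun_prop
        simpa using this.tendsto 0
      filter_upwards [ht.eventually h] with t ht
      rwa [hy]
    have h2 := (h1.filter_mono (nhdsWithin_le_nhds (s := {0}ᶜ))).frequently
    refine Filter.Tendsto.frequently (f := fun t : ℝ => (t : ℂ)) ?_ h2
    refine tendsto_nhdsWithin_iff.2 ⟨?_, ?_⟩
    · exact (Complex.continuous_ofReal.tendsto' 0 0 (by simp)).mono_left nhdsWithin_le_nhds
    · filter_upwards [self_mem_nhdsWithin] with t ht
      simpa using ht
  have := (hd.analyticOnNhd hS).eqOn_zero_of_preconnected_of_frequently_eq_zero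
    hconv.isPreconnected (z₀ := 0) (by simpa [S] using hε) hfreq
    (show (1 : ℂ) ∈ S by simpa [S] using hε)
  have h1 := hy 1
  rw [one_smul, add_sub_cancel] at h1
  rw [← h1]
  exact_mod_cast this

/-- An application of Baire's theorem makes the choice of arguments, which need not depend
continuously on the point, constant up to translation on a small open set. -/
theorem coeff_eq_zero_of_exists_translate {ι : Type*} {A : Finset (Fin k → ℂ)}
    (hA : ∀ α ∈ A, ∀ i, 0 ≤ (α i).re ∧ (α i).re < 1) {N : Fin k → ℕ}
    {c : ι → (Fin k → ℂ) → (Fin k → ℕ) → (Fin k → ℤ) → ℂ} {Ω : Set (Fin k → ℝ)} (hΩ : IsOpen Ω)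
    (hc : ∀ u, ∀ α ∈ A, ∀ a ∈ Finset.Iic N, ∀ ρ ∈ Ω,
      Summable fun n => ‖c u α a n‖ * Real.exp (∑ i, (n i : ℝ) * ρ i))
    {ρ : Fin k → ℝ} (hρ : ρ ∈ Ω) {B : Set (Fin k → ℝ)} (hB : IsOpen B) (hB' : B.Nonempty)
    (h : ∀ θ ∈ B, ∃ m : Fin k → ℤ, ∀ u,
      logSum A N (c u) (fun i => ρ i + (θ i + m i * (2 * Real.pi) : ℝ) * Complex.I) = 0)
    (u : ι) : ∀ α ∈ A, ∀ a ∈ Finset.Iic N, c u α a = 0 := by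
  have hcont : ∀ u, Continuous fun θ : Fin k → ℝ =>
      logSum A N (c u) (fun i => ρ i + θ i * Complex.I) := by
    intro u
    unfold logSum
    refine continuous_finsetSum _ fun α hα => Continuous.mul (by fun_prop)
      (continuous_finsetSum _ fun a ha => Continuous.mul (by fun_prop) ?_)
    exact continuous_expSum (hc u α hα a ha ρ hρ)
  -- The complement of `B` is added as one more closed set to obtain a covering of the whole space.
  let f : Option (Fin k → ℤ) → Set (Fin k → ℝ) := fun o => o.elim Bᶜ fun m =>
    {θ | ∀ u, logSum A N (c u) (fun i => ρ i + (θ i + m i * (2 * Real.pi) : ℝ) * Complex.I) = 0}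
  have hf : ∀ o, IsClosed (f o) := by
    rintro (_ | m)
    · exact hB.isClosed_compl
    · simp only [f, Option.elim, Set.ofPred_forall]
      refine isClosed_iInter fun u => isClosed_eq ?_ continuous_const
      exact (hcont u).comp (f := fun θ : Fin k → ℝ => fun i => θ i + m i * (2 * Real.pi))
        (by fun_prop)
  have hU : ⋃ o, f o = Set.univ := by
    refine Set.eq_univ_of_forall fun θ => ?_
    by_cases hθ : θ ∈ B
    · obtain ⟨m, hm⟩ := h θ hθ
      exact Set.mem_iUnion.2 ⟨some m, hm⟩
    · exact Set.mem_iUnion.2 ⟨none, hθ⟩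
  obtain ⟨θ₀, hθ₀, hθ₀B⟩ := (dense_iUnion_interior_of_closed hf hU).exists_mem_open hB hB'
  obtain ⟨o, ho⟩ := Set.mem_iUnion.1 hθ₀
  rcases o with _ | m
  · exact absurd hθ₀B (interior_subset ho)
  refine coeff_eq_zero_of_logSum_eq_zero hA (fun α hα a ha => hc u α hα a ha ρ hρ) fun θ =>
    logSum_eq_zero_of_eventually hΩ (hc u) hρ (θ₀ := fun i => θ₀ i + m i * (2 * Real.pi)) ?_ θ
  have ht : Filter.Tendsto (fun θ : Fin k → ℝ => fun i => θ i - m i * (2 * Real.pi))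
      (nhds fun i => θ₀ i + m i * (2 * Real.pi)) (nhds θ₀) := by
    have : Continuous fun θ : Fin k → ℝ => fun i => θ i - m i * (2 * Real.pi) := by fun_prop
    exact this.tendsto' _ _ (by simp)
  filter_upwards [ht.eventually (mem_interior_iff_mem_nhds.1 ho)] with θ hθ
  simpa using hθ u

end

/-! ### Growth of the coefficients and convergence -/

section

variable {d k : ℕ} {v : Fin k → Fin d → ℤ}

theorem IsDual.sum_abs_le {J : Finset (Fin k)} {e : Fin k → (Fin d → ℝ) →ₗ[ℝ] ℝ}
    (he : IsDual v J e) {B : ℝ} (hB : ∀ i j, |e i (toReal (v j))| ≤ B) {a : Fin k → ℝ}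
    (ha : ∀ j, j ∉ J → 0 ≤ a j) :
    ∑ i, |a i| ≤ ∑ i, |e i (lin v a)| + (k * B + 1) * ∑ j ∈ Jᶜ, a j := by
  have hs : 0 ≤ ∑ j ∈ Jᶜ, a j := Finset.sum_nonneg fun j hj => ha j (Finset.mem_compl.1 hj)
  have key : ∀ i, |a i| ≤ |e i (lin v a)| + B * ∑ j ∈ Jᶜ, a j + if i ∈ Jᶜ then a i else 0 := by
    intro i
    have hB0 : 0 ≤ B := (abs_nonneg _).trans (hB i i)
    by_cases hi : i ∈ J
    · have h1 : e i (lin v a) = a i + ∑ j ∈ Jᶜ, e i (toReal (v j)) * a j := by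
        rw [map_lin, ← Finset.sum_add_sum_compl J]
        congr 1
        rw [Finset.sum_eq_single i]
        · rw [he.apply_toReal hi, Pi.single_eq_same, one_mul]
        · intro j hj hji
          rw [he.apply_toReal hj, Pi.single_eq_of_ne hji.symm, zero_mul]
        · exact fun h => absurd hi h
      have h2 : |∑ j ∈ Jᶜ, e i (toReal (v j)) * a j| ≤ B * ∑ j ∈ Jᶜ, a j := by
        rw [Finset.mul_sum]
        refine (Finset.abs_sum_le_sum_abs _ _).trans (Finset.sum_le_sum fun j hj => ?_)
        rw [abs_mul, abs_of_nonneg (ha j (Finset.mem_compl.1 hj))]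
        exact mul_le_mul_of_nonneg_right (hB i j) (ha j (Finset.mem_compl.1 hj))
      have h3 : a i = e i (lin v a) - ∑ j ∈ Jᶜ, e i (toReal (v j)) * a j := by linarith
      rw [if_neg (by simpa using hi), add_zero]
      calc |a i| = |e i (lin v a) - ∑ j ∈ Jᶜ, e i (toReal (v j)) * a j| := by rw [← h3]
        _ ≤ _ := (abs_sub _ _).trans (by linarith)
    · rw [if_pos (Finset.mem_compl.2 hi), abs_of_nonneg (ha i hi)]
      have := abs_nonneg (e i (lin v a))
      nlinarith
  refine (Finset.sum_le_sum fun i _ => key i).trans (le_of_eq ?_)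
  rw [Finset.sum_add_distrib, Finset.sum_add_distrib, Finset.sum_const, Finset.card_univ,
    Fintype.card_fin, nsmul_eq_mul, Finset.sum_ite_mem, Finset.univ_inter]
  ring

theorem IsDual.sum_mul_eq {J : Finset (Fin k)} {e : Fin k → (Fin d → ℝ) →ₗ[ℝ] ℝ}
    (he : IsDual v J e) (a ψ : Fin k → ℝ) :
    ∑ i, a i * ψ i = ∑ i, e i (lin v a) * ψ i +
      ∑ j ∈ Jᶜ, a j * (ψ j - ∑ i, e i (toReal (v j)) * ψ i) := by
  have h1 : ∑ i, e i (lin v a) * ψ i = ∑ j, a j * ∑ i, e i (toReal (v j)) * ψ i := by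
    simp only [map_lin, Finset.sum_mul, Finset.mul_sum]
    rw [Finset.sum_comm]
    exact Finset.sum_congr rfl fun j _ => Finset.sum_congr rfl fun i _ => by ring
  have h2 : ∑ j ∈ Jᶜ, a j * (ψ j - ∑ i, e i (toReal (v j)) * ψ i) =
      ∑ j, a j * (ψ j - ∑ i, e i (toReal (v j)) * ψ i) := by
    refine Finset.sum_subset (Finset.subset_univ _) fun j _ hj => ?_
    have hj' : j ∈ J := by simpa using hj
    simp [he.apply_toReal hj', Pi.single_apply]
  rw [h1, h2, ← Finset.sum_add_distrib]
  exact Finset.sum_congr rfl fun j _ => by ring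

/-- A linear function on `N ⊗ ℝ` with value one on all `v_i`. -/
theorem exists_degree (hdeg : ∃ deg : (Fin d → ℤ) →+ ℤ, ∀ i, deg (v i) = 1) :
    ∃ f : (Fin d → ℝ) →ₗ[ℝ] ℝ, ∀ i, f (toReal (v i)) = 1 := by
  obtain ⟨deg, hdeg⟩ := hdeg
  refine ⟨Fintype.linearCombination ℝ fun j => ((deg (Pi.single j 1) : ℤ) : ℝ), fun i => ?_⟩
  have h1 : v i = ∑ j, v i j • (Pi.single j 1 : Fin d → ℤ) := by
    ext t
    simp [Pi.single_apply]
  have h2 : ∑ j, v i j * deg (Pi.single j 1) = 1 := by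
    have h3 := congrArg deg h1
    rw [map_sum, hdeg] at h3
    refine Eq.trans ?_ h3.symm
    exact Finset.sum_congr rfl fun j _ => by rw [map_zsmul, smul_eq_mul]
  rw [Fintype.linearCombination_apply]
  simp only [toReal, smul_eq_mul]
  exact_mod_cast h2

theorem summable_half_pow_natAbs : Summable fun n : ℤ => (1 / 2 : ℝ) ^ n.natAbs := by
  refine Summable.of_nat_of_neg ?_ ?_ <;> simpa using summable_geometric_two

open Classical in
/-- The coefficient of `e^{n · y}` in the part of a `Γ`-series that belongs to the monomial
`D^r`, stripped of the factor `e^{α · y}` and of the powers of `y`.  The condition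
`∑ n_i v_i = τ` selects the exponents `α + n`. -/
def gammaTerm (v : Fin k → Fin d → ℤ) (α : Fin k → ℂ) (r : Fin k → ℕ) (τ : Fin d → ℝ)
    (n : Fin k → ℤ) : ℂ :=
  if lin v (fun i => (n i : ℝ)) = τ then ∏ i, gammaCoeff (r i) (α i + n i) else 0

theorem nonneg_of_gammaTerm_ne_zero {α : Fin k → ℂ} {r : Fin k → ℕ} {τ : Fin d → ℝ}
    {n : Fin k → ℤ} (h : gammaTerm v α r τ n ≠ 0) {j : Fin k} (hα : α j = 0) (hr : r j = 0) :
    0 ≤ n j := by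
  by_contra! hn
  apply h
  rw [gammaTerm, ite_eq_right_iff]
  intro _
  refine Finset.prod_eq_zero (Finset.mem_univ j) ?_
  obtain ⟨m, hm⟩ : ∃ m : ℕ, n j = -(m + 1 : ℤ) := ⟨(-n j - 1).toNat, by omega⟩
  rw [hα, hr, hm, zero_add]
  push_cast
  exact gammaCoeff_zero_neg_nat m

theorem exists_norm_gammaTerm_le (hdeg : ∃ deg : (Fin d → ℤ) →+ ℤ, ∀ i, deg (v i) = 1)
    (α : Fin k → ℂ) (τ : Fin d → ℝ) : ∃ C : ℝ, 0 ≤ C ∧ ∀ r n,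
      ‖gammaTerm v α r τ n‖ ≤ C * (2 ^ (k + 2)) ^ (∑ i, (n i).natAbs) := by
  choose C hC hCle using fun i => exists_norm_gammaCoeff_le (α i)
  obtain ⟨f, hf⟩ := exists_degree hdeg
  obtain ⟨κ, hκ⟩ := exists_nat_ge |f τ|
  obtain ⟨C', hC', h'⟩ := exists_prod_growth_le k κ
  refine ⟨(∏ i, C i) * C', mul_nonneg (Finset.prod_nonneg fun i _ => hC i) hC', fun r n => ?_⟩
  rw [gammaTerm]
  split_ifs with hτ
  swap
  · rw [norm_zero]
    exact mul_nonneg (mul_nonneg (Finset.prod_nonneg fun i _ => hC i) hC') (by positivity)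
  have hsum : |∑ i, n i| ≤ κ := by
    have : f τ = ∑ i, (n i : ℝ) := by
      rw [← hτ, map_lin]
      exact Finset.sum_congr rfl fun i _ => by rw [hf, one_mul]
    rw [this] at hκ
    exact_mod_cast hκ
  rw [norm_prod]
  calc ∏ i, ‖gammaCoeff (r i) (α i + n i)‖
      ≤ ∏ i, (C i * (2 ^ (n i).natAbs * growth (n i))) :=
        Finset.prod_le_prod (fun i _ => norm_nonneg _) fun i _ => hCle i _ _
    _ = (∏ i, C i) * 2 ^ (∑ i, (n i).natAbs) * ∏ i, growth (n i) := by
        rw [Finset.prod_mul_distrib, Finset.prod_mul_distrib, Finset.prod_pow_eq_pow_sum, mul_assoc]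
    _ ≤ (∏ i, C i) * 2 ^ (∑ i, (n i).natAbs) *
          (C' * (2 ^ (k + 1)) ^ (∑ i, (n i).natAbs)) :=
        mul_le_mul_of_nonneg_left (h' n hsum)
          (mul_nonneg (Finset.prod_nonneg fun i _ => hC i) (by positivity))
    _ = _ := by
        rw [pow_succ (2 : ℝ) (k + 1), mul_pow]
        ring

/-- The height vector `p` is chosen so deep inside the secondary cone that the exponential decay
on `p + C` beats the exponential growth of the coefficients. -/
theorem exists_summable_gammaTerm (hdeg : ∃ deg : (Fin d → ℤ) →+ ℤ, ∀ i, deg (v i) = 1)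
    (hgen : AddSubgroup.closure (Set.range v) = ⊤) {T : Set (Finset (Fin k))}
    (hT : IsRegularTriangulation v T) :
    ∃ p : Fin k → ℝ, ∀ ρ : Fin k → ℝ, (fun i => -ρ i - p i) ∈ inducingHeights v T →
      ∀ J, Maximal (· ∈ T) J → ∀ (α : Fin k → ℂ) (r : Fin k → ℕ),
        (∀ j, j ∉ J → α j = 0 ∧ r j = 0) → ∀ τ : Fin d → ℝ,
          Summable fun n => ‖gammaTerm v α r τ n‖ * Real.exp (∑ i, (n i : ℝ) * ρ i) := by
  classical
  obtain ⟨hT, ψ₀, hψ₀⟩ := hT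
  choose! e he using fun I (hI : Maximal (· ∈ T) I) => exists_isDual_of_maximal hT hgen hI
  rw [mem_inducingHeights_iff he] at hψ₀
  obtain ⟨η, hη, hηle⟩ : ∃ η : ℝ, 0 < η ∧ ∀ I, Maximal (· ∈ T) I → ∀ j, j ∉ I →
      η ≤ ψ₀ j - ∑ i, e I i (toReal (v j)) * ψ₀ i := by
    have : ∀ᶠ η : ℝ in nhdsWithin 0 (Set.Ioi 0), ∀ I : Finset (Fin k), ∀ j : Fin k,
        Maximal (· ∈ T) I → j ∉ I → η ≤ ψ₀ j - ∑ i, e I i (toReal (v j)) * ψ₀ i := by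
      rw [Filter.eventually_all]
      intro I
      rw [Filter.eventually_all]
      intro j
      by_cases h : Maximal (· ∈ T) I ∧ j ∉ I
      · have := sub_pos.2 (hψ₀ I h.1 j h.2)
        filter_upwards [(eventually_lt_nhds this).filter_mono nhdsWithin_le_nhds] with η hη _ _
        exact hη.le
      · exact Filter.Eventually.of_forall fun η h1 h2 => absurd ⟨h1, h2⟩ h
    obtain ⟨η, h1, h2⟩ := (this.and self_mem_nhdsWithin).exists
    exact ⟨η, h2, fun I hI j hj => h1 I j hI hj⟩
  obtain ⟨B, hB0, hB⟩ : ∃ B : ℝ, 0 ≤ B ∧ ∀ I i j, |e I i (toReal (v j))| ≤ B := by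
    refine ⟨∑ I, ∑ i, ∑ j, |e I i (toReal (v j))|, by positivity, fun I i j => ?_⟩
    refine le_trans ?_ (Finset.single_le_sum (f := fun I => ∑ i, ∑ j, |e I i (toReal (v j))|)
      (fun I _ => by positivity) (Finset.mem_univ I))
    refine le_trans ?_ (Finset.single_le_sum (f := fun i => ∑ j, |e I i (toReal (v j))|)
      (fun i _ => by positivity) (Finset.mem_univ i))
    exact Finset.single_le_sum (f := fun j => |e I i (toReal (v j))|)
      (fun j _ => by positivity) (Finset.mem_univ j)
  have hB' : 0 < k * B + 1 := by positivity
  -- `q` is the rate of decay needed to beat the growth `2 ^ (k + 2)` and to leave a factor `1 / 2`.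
  set q := (k + 3) * Real.log 2 with hq
  have hq0 : 0 < q := by have := Real.log_pos one_lt_two; positivity
  set R := q * (k * B + 1) / η with hR
  have hR0 : 0 ≤ R := by positivity
  refine ⟨fun i => R * ψ₀ i, fun ρ hρ J hJ α r hJα τ => ?_⟩
  rw [mem_inducingHeights_iff he] at hρ
  obtain ⟨C, hC, hCle⟩ := exists_norm_gammaTerm_le hdeg α τ
  set G := ∑ i, e J i τ * ρ i
  set S := ∑ i, |e J i τ|
  refine Summable.of_nonneg_of_le (fun n => by positivity) (fun n => ?_)
    ((summable_prod_of_nonneg (fun n => by positivity) summable_half_pow_natAbs).mul_left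
      (C * Real.exp (G + q * S)))
  by_cases h0 : gammaTerm v α r τ n = 0
  · rw [h0, norm_zero, zero_mul]
    exact mul_nonneg (by positivity) (Finset.prod_nonneg fun i _ => by positivity)
  have hτ : lin v (fun i => (n i : ℝ)) = τ := by
    by_contra h
    exact h0 (if_neg h)
  have hn : ∀ j, j ∉ J → (0 : ℝ) ≤ n j := fun j hj => by
    exact_mod_cast nonneg_of_gammaTerm_ne_zero h0 (hJα j hj).1 (hJα j hj).2
  have h1 := (he J hJ).sum_abs_le (hB J) hn
  have h2 := (he J hJ).sum_mul_eq (fun i => (n i : ℝ)) ρ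
  rw [hτ] at h1 h2
  have h3 : ∑ j ∈ Jᶜ, (n j : ℝ) * (ρ j - ∑ i, e J i (toReal (v j)) * ρ i) ≤
      -(R * η) * ∑ j ∈ Jᶜ, (n j : ℝ) := by
    rw [Finset.mul_sum]
    refine Finset.sum_le_sum fun j hj => ?_
    rw [mul_comm]
    refine mul_le_mul_of_nonneg_right ?_ (hn j (Finset.mem_compl.1 hj))
    have h4 := hρ J hJ j (Finset.mem_compl.1 hj)
    have h5 := mul_le_mul_of_nonneg_left (hηle J hJ j (Finset.mem_compl.1 hj)) hR0
    have h6 : ∑ i, e J i (toReal (v j)) * (-ρ i - R * ψ₀ i) =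
        -(∑ i, e J i (toReal (v j)) * ρ i) - R * ∑ i, e J i (toReal (v j)) * ψ₀ i := by
      rw [Finset.mul_sum, ← Finset.sum_neg_distrib, ← Finset.sum_sub_distrib]
      exact Finset.sum_congr rfl fun i _ => by ring
    rw [h6] at h4
    linarith
  have hRη : R * η = q * (k * B + 1) := by
    rw [hR]
    field_simp
  have h7 : ((∑ i, (n i).natAbs : ℕ) : ℝ) = ∑ i, |(n i : ℝ)| := by
    push_cast
    exact Finset.sum_congr rfl fun i _ => by rw [Nat.cast_natAbs]; push_cast; rfl
  have h8 : ∑ i, (n i : ℝ) * ρ i ≤ G + q * S - q * (∑ i, (n i).natAbs : ℕ) := by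
    have h1' := mul_le_mul_of_nonneg_left h1 hq0.le
    rw [h7, h2]
    rw [hRη] at h3
    nlinarith
  calc ‖gammaTerm v α r τ n‖ * Real.exp (∑ i, (n i : ℝ) * ρ i)
      ≤ C * (2 ^ (k + 2)) ^ (∑ i, (n i).natAbs) *
          Real.exp (G + q * S - q * (∑ i, (n i).natAbs : ℕ)) :=
        mul_le_mul (hCle r n) (Real.exp_le_exp.2 h8) (Real.exp_pos _).le (by positivity)
    _ = C * Real.exp (G + q * S) * ∏ i, (1 / 2 : ℝ) ^ (n i).natAbs := by
        rw [Finset.prod_pow_eq_pow_sum, Real.exp_sub, mul_comm q ((∑ i, (n i).natAbs : ℕ) : ℝ),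
          Real.exp_nat_mul]
        have : Real.exp q = 2 ^ (k + 3) := by
          rw [hq, show ((k : ℝ) + 3) = ((k + 3 : ℕ) : ℝ) by push_cast; ring, Real.exp_nat_mul,
            Real.exp_log two_pos]
        rw [this, pow_succ (2 : ℝ) (k + 2), mul_pow, one_div, inv_pow]
        field_simp

end

/-! ### Openness of `U_Σ` -/

section

variable {d k : ℕ} {v : Fin k → Fin d → ℤ} {T : Set (Finset (Fin k))} {β : Fin d → ℂ} {δ : ℝ}

theorem isOpen_inducingHeights (hT : IsTriangulation v T)
    (hgen : AddSubgroup.closure (Set.range v) = ⊤) : IsOpen (inducingHeights v T) := by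
  choose! e he using fun I (hI : Maximal (· ∈ T) I) => exists_isDual_of_maximal hT hgen hI
  have : inducingHeights v T = ⋂ I : Finset (Fin k), ⋂ j : Fin k,
      {ψ | Maximal (· ∈ T) I → j ∉ I → ∑ i, e I i (toReal (v j)) * ψ i < ψ j} := by
    ext ψ
    rw [mem_inducingHeights_iff he]
    simp only [Set.mem_iInter, Set.mem_ofPred_eq]
    exact ⟨fun h I j hI hj => h I hI j hj, fun h I hI j hj => h I j hI hj⟩
  rw [this]
  refine isOpen_iInter_of_finite fun I => isOpen_iInter_of_finite fun j => ?_
  by_cases h : Maximal (· ∈ T) I ∧ j ∉ I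
  · simp only [h.1, h.2, not_false_eq_true, forall_true_left]
    exact isOpen_lt (by fun_prop) (by fun_prop)
  · convert isOpen_univ
    ext ψ
    simp only [Set.mem_ofPred_eq, Set.mem_univ, iff_true]
    exact fun h1 h2 => absurd ⟨h1, h2⟩ h

theorem isOpen_USigma (hT : IsTriangulation v T)
    (hgen : AddSubgroup.closure (Set.range v) = ⊤) (p : Fin k → ℝ) : IsOpen (USigma v T p) := by
  have h1 : IsOpen {x : Fin k → ℂ | ∀ i, x i ≠ 0} := by
    simp only [Set.ofPred_forall]
    exact isOpen_iInter_of_finite fun i => isOpen_ne_fun (continuous_apply i) continuous_const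
  refine ContinuousOn.isOpen_inter_preimage (s := {x : Fin k → ℂ | ∀ i, x i ≠ 0})
    (f := fun x i => - Real.log ‖x i‖ - p i) ?_ h1 (isOpen_inducingHeights hT hgen)
  refine continuousOn_pi.2 fun i => ContinuousOn.sub (ContinuousOn.neg ?_) continuousOn_const
  exact ContinuousOn.log (by fun_prop) fun x hx => norm_ne_zero_iff.2 (hx i)

theorem nonempty_USigma (h : (inducingHeights v T).Nonempty) (p : Fin k → ℝ) :
    (USigma v T p).Nonempty := by
  obtain ⟨ψ, hψ⟩ := h
  refine ⟨fun i => Complex.exp ((-(p i + ψ i) : ℝ) : ℂ), fun i => Complex.exp_ne_zero _, ?_⟩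
  convert hψ using 2 with i
  rw [Complex.norm_exp, Complex.ofReal_re, Real.log_exp]
  ring

/-! ### Twisted sectors -/

theorem sum_smul_toComplex_eq_iff (α : Fin k → ℂ) (z : Fin d → ℂ) :
    ∑ i, α i • toComplex (v i) = z ↔
      lin v (fun i => (α i).re) = rePart z ∧ lin v (fun i => (α i).im) = fun j => (z j).im := by
  simp only [funext_iff, Complex.ext_iff, forall_and, lin_apply, Finset.sum_apply, Pi.smul_apply,
    smul_eq_mul, toReal, toComplex, rePart, Complex.re_sum, Complex.im_sum, Complex.mul_re, Complex.mul_im,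
    Complex.intCast_re, Complex.intCast_im, mul_zero, sub_zero, zero_add]

theorem mem_Bx_iff {α : Fin k → ℂ} : α ∈ Bx v T β ↔ ∃ I, Maximal (· ∈ T) I ∧
    (∃ n : Fin d → ℤ, lin v (fun i => (α i).re) = toReal n + rePart β) ∧
    (lin v (fun i => (α i).im) = fun j => (β j).im) ∧
    (∀ i, 0 ≤ (α i).re ∧ (α i).re < 1) ∧ (∀ i, i ∉ I → α i = 0) := by
  have : ∀ n : Fin d → ℤ, (toComplex n + β = ∑ i, α i • toComplex (v i)) ↔
      lin v (fun i => (α i).re) = toReal n + rePart β ∧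
        lin v (fun i => (α i).im) = fun j => (β j).im := fun n => by
    rw [eq_comm, sum_smul_toComplex_eq_iff]
    have h1 : rePart (toComplex n + β) = toReal n + rePart β := by
      ext j; simp [rePart, toComplex, toReal]
    have h2 : (fun j => ((toComplex n + β) j).im) = fun j => (β j).im := by
      ext j; simp [toComplex]
    rw [h1, h2]
  simp only [Bx, BxCone, Set.mem_ofPred_eq, this, exists_and_right, and_assoc]

/-- An element of `Bx(σ; β)` is determined by the point of `N + Re β` in the parallelepiped of `σ`. -/
theorem finite_Bx (hT : IsTriangulation v T) (hgen : AddSubgroup.closure (Set.range v) = ⊤)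
    (β : Fin d → ℂ) : (Bx v T β).Finite := by
  choose! e he using fun I (hI : Maximal (· ∈ T) I) => exists_isDual_of_maximal hT hgen hI
  refine ((Set.finite_univ (α := Finset (Fin k))).prod
    (finite_lattice_points v (rePart β) 1)).image
    (fun q => fun i => ((e q.1 i (toReal q.2 + rePart β) : ℝ) : ℂ) +
      ((e q.1 i fun j => (β j).im) : ℝ) * Complex.I) |>.subset fun α hα => ?_
  obtain ⟨I, hI, ⟨n, hn⟩, him, h01, h0⟩ := mem_Bx_iff.1 hα
  refine ⟨(I, n), ⟨Set.mem_univ _, _, fun i => (h01 i).1, fun i => (h01 i).2.le, hn⟩, ?_⟩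
  funext i
  simp only
  rw [← hn, ← him, (he I hI).apply_lin, (he I hI).apply_lin, Complex.re_add_im]
  all_goals
    intro j hj
    by_contra hjI
    rw [mem_supp, h0 j hjI] at hj
    exact hj rfl

theorem alphaDelta_nonneg (α : Fin k → ℂ) (δ : ℝ) : 0 ≤ alphaDelta α δ :=
  fun _ => Int.fract_nonneg _

theorem alphaDelta_eq_zero {α : Fin k → ℂ} (δ : ℝ) {i : Fin k} (h : α i = 0) :
    alphaDelta α δ i = 0 := by simp [alphaDelta, h]

/-- For small `δ > 0` the deformation `α ↦ α_δ` does not move non-zero coordinates to integers. -/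
def IsSmall (v : Fin k → Fin d → ℤ) (T : Set (Finset (Fin k))) (β : Fin d → ℂ) (δ : ℝ) : Prop :=
  ∀ α ∈ Bx v T β, ∀ i, alphaDelta α δ i = 0 → α i = 0

theorem exists_isSmall (hT : IsTriangulation v T) (hgen : AddSubgroup.closure (Set.range v) = ⊤)
    (β : Fin d → ℂ) : ∃ δ₀ : ℝ, 0 < δ₀ ∧ ∀ δ : ℝ, 0 < δ → δ < δ₀ → IsSmall v T β δ := by
  have : ∀ᶠ δ : ℝ in nhdsWithin 0 (Set.Ioi 0), IsSmall v T β δ := by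
    unfold IsSmall
    rw [Filter.eventually_all_finite (finite_Bx hT hgen β)]
    intro α hα
    rw [Filter.eventually_all]
    intro i
    by_cases hi : α i = 0
    · exact Filter.Eventually.of_forall fun _ _ => hi
    obtain ⟨-, -, -, -, h01, -⟩ := mem_Bx_iff.1 hα
    have hc : Filter.Tendsto (fun δ : ℝ => (α i).re + δ * (α i).im) (nhdsWithin 0 (Set.Ioi 0))
        (nhds (α i).re) := by
      have : Continuous fun δ : ℝ => (α i).re + δ * (α i).im := by fun_prop
      exact (this.tendsto' 0 _ (by simp)).mono_left nhdsWithin_le_nhds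
    have h1 : ∀ᶠ δ : ℝ in nhdsWithin 0 (Set.Ioi 0), |(α i).re + δ * (α i).im| < 1 :=
      hc.abs.eventually_lt_const (by rw [abs_of_nonneg (h01 i).1]; exact (h01 i).2)
    have h2 : ∀ᶠ δ : ℝ in nhdsWithin 0 (Set.Ioi 0), (α i).re + δ * (α i).im ≠ 0 := by
      by_cases hre : (α i).re = 0
      · have him : (α i).im ≠ 0 := fun h => hi (Complex.ext hre h)
        filter_upwards [self_mem_nhdsWithin] with δ hδ
        rw [hre, zero_add]
        exact mul_ne_zero (ne_of_gt hδ) him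
      · exact hc.eventually_ne hre
    filter_upwards [h1, h2] with δ h1 h2 h3
    obtain ⟨m, hm⟩ := Int.fract_eq_zero_iff.1 h3
    rw [← hm] at h1 h2
    have h4 : |m| < 1 := by exact_mod_cast h1
    rw [Int.abs_lt_one_iff] at h4
    exact absurd (by rw [h4]; simp) h2
  obtain ⟨δ₀, h0, h⟩ := mem_nhdsGT_iff_exists_Ioo_subset.1 this
  exact ⟨δ₀, h0, fun δ h1 h2 => h ⟨h1, h2⟩⟩

theorem supp_alphaDelta_mem (hT : IsTriangulation v T) {α : Fin k → ℂ} (hα : α ∈ Bx v T β) :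
    supp (alphaDelta α δ) ∈ T := by
  obtain ⟨I, hI, -, -, -, h0⟩ := mem_Bx_iff.1 hα
  refine hT.down_closed I hI.prop _ fun i hi => ?_
  by_contra h
  exact mem_supp.1 hi (alphaDelta_eq_zero δ (h0 i h))

/-- Every point of `(N + β_δ) ∩ K` lies in the sector of some `α`, with non-negative integral
coordinates relative to `c(α_δ)`. -/
theorem exists_alphaDelta_add (hT : IsTriangulation v T)
    (hgen : AddSubgroup.closure (Set.range v) = ⊤) {a : Fin k → ℝ} (ha : 0 ≤ a) (haT : supp a ∈ T)
    {n : Fin d → ℤ} (hn : lin v a = toReal n + betaDelta β δ) :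
    ∃ α ∈ Bx v T β, ∃ m : Fin k → ℕ, a = alphaDelta α δ + fun i => (m i : ℝ) := by
  obtain ⟨J, hJ, haJ⟩ := exists_maximal haT
  obtain ⟨e, he⟩ := exists_isDual_of_maximal hT hgen hJ
  let r : Fin k → ℝ := fun i => e i (toReal n + rePart β)
  let b : Fin k → ℝ := fun i => e i fun j => (β j).im
  have hab : ∀ i, a i = r i + δ * b i := fun i => by
    rw [← he.apply_lin a haJ i, hn]
    have : toReal n + betaDelta β δ = (toReal n + rePart β) + δ • fun j => (β j).im := by
      ext j; simp [betaDelta, rePart, add_assoc]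
    rw [this, map_add, map_smul, smul_eq_mul]
  refine ⟨fun i => (Int.fract (r i) : ℝ) + (b i : ℝ) * Complex.I,
    mem_Bx_iff.2 ⟨J, hJ, ⟨n - ∑ i, ⌊r i⌋ • v i, ?_⟩, ?_, fun i => ?_, fun i hi => ?_⟩,
    fun i => ⌊a i⌋₊, ?_⟩
  · have h1 : toReal (n - ∑ i, ⌊r i⌋ • v i) = toReal n - toReal (∑ i, ⌊r i⌋ • v i) := by
      ext j; simp [toReal]
    have h2 : (fun i => (((Int.fract (r i) : ℝ) : ℂ) + (b i : ℝ) * Complex.I).re) =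
        r - fun i => (⌊r i⌋ : ℝ) := by
      ext i; simp
    rw [h1, h2, toReal_sum_zsmul, map_sub, he.lin_eq]
    abel
  · have h2 : (fun i => (((Int.fract (r i) : ℝ) : ℂ) + (b i : ℝ) * Complex.I).im) = b := by
      ext i; simp
    rw [h2]
    exact he.lin_eq _
  · constructor <;> simp [Int.fract_lt_one]
  · simp [r, b, he.eq_zero i hi]
  · funext i
    have h1 : alphaDelta (fun i => ((Int.fract (r i) : ℝ) : ℂ) + (b i : ℝ) * Complex.I) δ i =
        Int.fract (a i) := by
      simp only [alphaDelta, Complex.add_re, Complex.ofReal_re, Complex.re_ofReal_mul,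
        Complex.I_re, mul_zero, add_zero, Complex.add_im, Complex.ofReal_im,
        Complex.im_ofReal_mul, Complex.I_im, mul_one, zero_add]
      rw [hab i, Int.fract_eq_fract]
      exact ⟨-⌊r i⌋, by rw [Int.fract]; push_cast; ring⟩
    rw [Pi.add_apply, h1, natCast_floor_eq_intCast_floor (ha i), Int.fract_add_floor]

theorem Dpow_bas_cPoint (hT : IsTriangulation v T) {χ : Fin d → ℝ} {α : Fin k → ℂ}
    (hα : α ∈ Bx v T β) (m : Fin k → ℕ) :
    Dpow v T χ m (bas v χ (cPoint v α δ)) =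
      coordBas v T χ (alphaDelta α δ + fun i => (m i : ℝ)) := by
  rw [← Dpow_coordBas hT (alphaDelta_nonneg α δ), coordBas_of_mem (supp_alphaDelta_mem hT hα)]
  rfl

theorem coord_nonneg (α : Fin k → ℂ) (δ : ℝ) (m : Fin k → ℕ) :
    0 ≤ alphaDelta α δ + fun i => (m i : ℝ) :=
  add_nonneg (alphaDelta_nonneg α δ) fun i => Nat.cast_nonneg (m i)

/-- At most one monomial in the `D_i` contributes to a given coefficient of a `Γ`-series. -/
theorem termCoeff_eq (hT : IsTriangulation v T) {χ : Fin d → ℝ} {α : Fin k → ℂ}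
    (hα : α ∈ Bx v T β) {m : Fin k → ℕ} {w : Points v χ}
    (hm : coordBas v T χ (alphaDelta α δ + fun i => (m i : ℝ)) w ≠ 0) (y l : Fin k → ℂ) :
    termCoeff v T χ (cPoint v α δ) y l w = ∏ i, taylorCoeff (y i) (l i) (m i) := by
  obtain ⟨h1, h2, h3⟩ := coordBas_apply (coord_nonneg α δ m) hm
  unfold termCoeff
  simp only [Dpow_bas_cPoint hT hα]
  rw [finsum_eq_single _ m, h3, mul_one]
  intro m' hm'
  by_contra h
  obtain ⟨h1', h2', -⟩ := coordBas_apply (coord_nonneg α δ m') (right_ne_zero_of_mul h)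
  have := eq_of_lin_eq hT (coord_nonneg α δ m') (coord_nonneg α δ m) h1' h1 (h2'.trans h2.symm)
  refine hm' (funext fun i => ?_)
  simpa using congrFun this i

theorem termCoeff_eq_zero (hT : IsTriangulation v T) {χ : Fin d → ℝ} {α : Fin k → ℂ}
    (hα : α ∈ Bx v T β) {w : Points v χ}
    (hm : ∀ m : Fin k → ℕ, coordBas v T χ (alphaDelta α δ + fun i => (m i : ℝ)) w = 0)
    (y l : Fin k → ℂ) : termCoeff v T χ (cPoint v α δ) y l w = 0 := by
  unfold termCoeff
  simp only [Dpow_bas_cPoint hT hα, hm, mul_zero, finsum_zero]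

/-- The vector `τ` such that `α + n ∈ L(α, u)` if and only if `∑ n_i v_i = τ`. -/
def shiftVec (v : Fin k → Fin d → ℤ) (β : Fin d → ℂ) (α : Fin k → ℂ) (u : Fin d → ℤ) :
    Fin d → ℝ :=
  rePart β - toReal u - lin v fun i => (α i).re

theorem mem_L_iff {α : Fin k → ℂ} (hα : α ∈ Bx v T β) (u : Fin d → ℤ) (n : Fin k → ℤ) :
    (fun i => α i + n i) ∈ L v β α u ↔ lin v (fun i => (n i : ℝ)) = shiftVec v β α u := by
  obtain ⟨-, -, -, him, -, -⟩ := mem_Bx_iff.1 hα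
  have h1 : (fun i => (α i + n i).re) = (fun i => (α i).re) + fun i => (n i : ℝ) := by
    ext i; simp
  have h2 : (fun i => (α i + n i).im) = fun i => (α i).im := by
    ext i; simp
  have h3 : rePart (β - toComplex u) = rePart β - toReal u := by
    ext j; simp [rePart, toComplex, toReal]
  have h4 : (fun j => ((β - toComplex u) j).im) = fun j => (β j).im := by
    ext j; simp [toComplex]
  simp only [L, Set.mem_ofPred_eq]
  rw [sum_smul_toComplex_eq_iff, h1, h2, h3, h4, him, map_add, shiftVec, ← eq_sub_iff_add_eq']
  simp

theorem exists_L_param {α : Fin k → ℂ} (hα : α ∈ Bx v T β) (u : Fin d → ℤ) :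
    ∃ f : L v β α u → Fin k → ℤ, Function.Injective f ∧ (∀ l i, l.1 i = α i + f l i) ∧
      Set.range f = {n | lin v (fun i => (n i : ℝ)) = shiftVec v β α u} := by
  choose f hf using fun (l : L v β α u) i => l.2.2 i
  have hf' : ∀ l i, l.1 i = α i + f l i := fun l i => by rw [← hf l i]; ring
  refine ⟨f, fun l l' h => Subtype.ext (funext fun i => by rw [hf' l, hf' l', h]), hf', ?_⟩
  ext n
  rw [Set.mem_ofPred_eq, ← mem_L_iff hα u n]
  constructor
  · rintro ⟨l, rfl⟩
    convert l.2 using 1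
    exact (funext (hf' l)).symm
  · intro h
    refine ⟨⟨_, h⟩, funext fun i => ?_⟩
    have := hf' ⟨_, h⟩ i
    simpa using this.symm

theorem prod_taylorCoeff (y l : Fin k → ℂ) (m : Fin k → ℕ) :
    ∏ i, taylorCoeff (y i) (l i) (m i) = Complex.exp (∑ i, l i * y i) *
      ∑ a ∈ Finset.Iic m, (∏ i, y i ^ a i / ((a i).factorial : ℂ)) *
        ∏ i, gammaCoeff (m i - a i) (l i) := by
  simp only [taylorCoeff_eq]
  rw [Finset.prod_mul_distrib, ← Complex.exp_sum, Finset.prod_univ_sum]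
  congr 1
  refine Finset.sum_congr ?_ fun a _ => Finset.prod_mul_distrib
  ext a
  simp [Fintype.mem_piFinset, Pi.le_def]

/-- The expansion of the contribution of `D^m` to a `Γ`-series into powers of the logarithms. -/
theorem tsum_prod_taylorCoeff {α : Fin k → ℂ} (hα : α ∈ Bx v T β) (u : Fin d → ℤ)
    (m : Fin k → ℕ) (y : Fin k → ℂ)
    (hs : ∀ a ∈ Finset.Iic m, Summable fun n =>
      ‖gammaTerm v α (m - a) (shiftVec v β α u) n‖ * Real.exp (∑ i, (n i : ℝ) * (y i).re)) :
    HasSum (fun l : L v β α u => ∏ i, taylorCoeff (y i) (l.1 i) (m i))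
      (Complex.exp (∑ i, α i * y i) * ∑ a ∈ Finset.Iic m, (∏ i, y i ^ a i /
        ((a i).factorial : ℂ)) * expSum (gammaTerm v α (m - a) (shiftVec v β α u)) y) := by
  obtain ⟨f, hf, hfl, hrange⟩ := exists_L_param hα u
  have h1 : ∀ a ∈ Finset.Iic m, HasSum
      (fun n => gammaTerm v α (m - a) (shiftVec v β α u) n * Complex.exp (∑ i, (n i : ℂ) * y i))
      (expSum (gammaTerm v α (m - a) (shiftVec v β α u)) y) := fun a ha => by
    refine (Summable.of_norm ?_).hasSum
    simpa only [norm_mul, norm_exp_sum] using hs a ha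
  have h2 := (hasSum_sum fun a ha => (h1 a ha).mul_left
    (∏ i, y i ^ a i / ((a i).factorial : ℂ))).mul_left (Complex.exp (∑ i, α i * y i))
  rw [← hf.hasSum_iff] at h2
  · convert! h2 using 1
    funext l
    have hl : lin v (fun i => (f l i : ℝ)) = shiftVec v β α u :=
      (Set.ext_iff.1 hrange (f l)).1 ⟨l, rfl⟩
    rw [prod_taylorCoeff, Function.comp_apply]
    have h3 : ∑ i, l.1 i * y i = ∑ i, α i * y i + ∑ i, (f l i : ℂ) * y i := by
      rw [← Finset.sum_add_distrib]
      exact Finset.sum_congr rfl fun i _ => by rw [hfl, add_mul]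
    rw [h3, Complex.exp_add, mul_assoc, Finset.mul_sum]
    congr 1
    refine Finset.sum_congr rfl fun a _ => ?_
    rw [gammaTerm, if_pos hl]
    simp only [hfl, Pi.sub_apply]
    ring
  · intro n hn
    rw [hrange] at hn
    have : ∀ r, gammaTerm v α r (shiftVec v β α u) n = 0 := fun r => if_neg hn
    simp [this]

end

section

variable {d k : ℕ} {v : Fin k → Fin d → ℤ} {T : Set (Finset (Fin k))} {β : Fin d → ℂ} {δ : ℝ}
  {g : Module.Basis (Fin d) ℤ (Module.Dual ℤ (Fin d → ℤ))}

/-! ### Linear functions on the quotient -/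

/-- The linear function on `ℂ[Σ; χ]` that takes on `[w]` the value of `h` at the class of `[w]`. -/
def clsFun {χ ξ : Fin d → ℝ} (h : ShadowQuotient v T χ ξ g →ₗ[ℂ] ℂ) : DefModule v χ →ₗ[ℂ] ℂ :=
  Finsupp.linearCombination ℂ fun w => h (cls v T χ ξ g w)

theorem clsFun_single {χ ξ : Fin d → ℝ} (h : ShadowQuotient v T χ ξ g →ₗ[ℂ] ℂ) (w : Points v χ) :
    clsFun h (Finsupp.single w 1) = h (cls v T χ ξ g w) := by
  rw [clsFun, Finsupp.linearCombination_single, one_smul]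

theorem eq_zero_of_cls {χ ξ : Fin d → ℝ} {h : ShadowQuotient v T χ ξ g →ₗ[ℂ] ℂ}
    (h0 : ∀ w : Points v χ, InShadow v ξ w.1 → h (cls v T χ ξ g w) = 0) : h = 0 := by
  have key : ∀ m (hm : m ∈ shadow v T χ ξ),
      h (Submodule.Quotient.mk (⟨m, hm⟩ : shadow v T χ ξ)) = 0 := by
    intro m hm
    induction hm using Submodule.span_induction with
    | mem m hm' =>
      have hm : m ∈ shadow v T χ ξ := Submodule.subset_span hm'
      obtain ⟨n, w, -, -, rfl⟩ := hm'
      rcases mono_single (T := T) n w with e | ⟨w', -, e⟩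
      · simp only [e]
        exact map_zero h
      · have hw : Finsupp.single w' (1 : ℂ) ∈ shadow v T χ ξ := by rwa [← e]
        simp only [e]
        rw [← h0 w' (inShadow_of_single_mem hw), cls, dif_pos hw]
    | zero => exact map_zero h
    | add x y hx hy hx' hy' =>
      have := congrArg₂ (· + ·) hx' hy'
      rw [add_zero] at this
      rw [← this, ← map_add]
      rfl
    | smul c x hx hx' =>
      have := congrArg (c • ·) hx'
      rw [smul_zero] at this
      rw [← this, ← map_smul]
      rfl
  refine LinearMap.ext fun q => ?_
  obtain ⟨⟨m, hm⟩, rfl⟩ := Submodule.Quotient.mk_surjective _ q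
  exact key m hm

theorem clsFun_apply {χ ξ : Fin d → ℝ} {h : ShadowQuotient v T χ ξ g →ₗ[ℂ] ℂ}
    {W : Finset (Points v χ)} (hW : ∀ w, cls v T χ ξ g w ≠ 0 → w ∈ W) (x : DefModule v χ) :
    clsFun h x = ∑ w ∈ W, x w * h (cls v T χ ξ g w) := by
  classical
  rw [clsFun, Finsupp.linearCombination_apply, Finsupp.sum]
  simp only [smul_eq_mul]
  refine (Finset.sum_subset (Finset.subset_union_left (s₂ := W)) fun w _ hw => ?_).trans
    (Finset.sum_subset (Finset.subset_union_right (s₁ := x.support)) fun w _ hw => ?_).symm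
  · rw [Finsupp.notMem_support_iff.1 hw, zero_mul]
  · rw [not_not.1 fun h => hw (hW w h), map_zero, mul_zero]

/-- Only finitely many monomials `D^m` contribute to the values of a linear function. -/
theorem le_of_clsFun_ne_zero (hT : IsTriangulation v T)
    (hgen : AddSubgroup.closure (Set.range v) = ⊤) {χ ξ : Fin d → ℝ}
    (h : ShadowQuotient v T χ ξ g →ₗ[ℂ] ℂ)
    (α : Fin k → ℂ) {m : Fin k → ℕ}
    (hm : clsFun h (coordBas v T χ (alphaDelta α δ + fun i => (m i : ℝ))) ≠ 0) :
    supp (alphaDelta α δ + fun i => (m i : ℝ)) ∈ T ∧ m ≤ fun _ => k + 1 := by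
  set a := alphaDelta α δ + fun i => (m i : ℝ) with ha
  have ha0 : 0 ≤ a := coord_nonneg α δ m
  obtain ⟨w, hw⟩ : ∃ w, coordBas v T χ a w ≠ 0 := by
    by_contra! h0
    have : coordBas v T χ a = 0 := Finsupp.ext h0
    rw [this, map_zero] at hm
    exact hm rfl
  obtain ⟨h1, h2, -⟩ := coordBas_apply ha0 hw
  rw [coordBas_eq_single h1 h2, clsFun_single] at hm
  have hcls : cls v T χ ξ g w ≠ 0 := fun h0 => hm (by rw [h0, map_zero])
  refine ⟨h1, fun i => ?_⟩
  have h3 := coord_le_of_cls_ne_zero hT hgen g hcls ha0 h1 h2 i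
  have h4 : (m i : ℝ) ≤ (k + 1 : ℕ) := by
    have : 0 ≤ alphaDelta α δ i := alphaDelta_nonneg α δ i
    push_cast
    simp only [ha, Pi.add_apply] at h3
    linarith
  exact_mod_cast h4

/-- The contribution of `D^m` to a `Γ`-series satisfies the hypotheses of the convergence lemma. -/
theorem exists_maximal_of_supp (hδ : IsSmall v T β δ) {α : Fin k → ℂ} (hα : α ∈ Bx v T β)
    {m : Fin k → ℕ} (hm : supp (alphaDelta α δ + fun i => (m i : ℝ)) ∈ T) :
    ∃ J, Maximal (· ∈ T) J ∧ ∀ j, j ∉ J → α j = 0 ∧ m j = 0 := by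
  obtain ⟨J, hJ, hsub⟩ := exists_maximal hm
  refine ⟨J, hJ, fun j hj => ?_⟩
  have h1 := notMem_supp.1 fun h => hj (hsub h)
  have h2 : 0 ≤ alphaDelta α δ j := alphaDelta_nonneg α δ j
  have h3 : (0 : ℝ) ≤ m j := Nat.cast_nonneg _
  rw [Pi.add_apply, add_eq_zero_iff_of_nonneg h2 h3] at h1
  exact ⟨hδ α hα j h1.1, by exact_mod_cast h1.2⟩

/-! ### Convergence -/

/-- The property of the vector `p` that makes the `Γ`-series converge on `U_Σ(p)`. -/
def IsDeep (v : Fin k → Fin d → ℤ) (T : Set (Finset (Fin k))) (p : Fin k → ℝ) : Prop :=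
  ∀ ρ : Fin k → ℝ, (fun i => -ρ i - p i) ∈ inducingHeights v T →
    ∀ J, Maximal (· ∈ T) J → ∀ (α : Fin k → ℂ) (r : Fin k → ℕ),
      (∀ j, j ∉ J → α j = 0 ∧ r j = 0) → ∀ τ : Fin d → ℝ,
        Summable fun n => ‖gammaTerm v α r τ n‖ * Real.exp (∑ i, (n i : ℝ) * ρ i)

theorem IsDeep.summable {p : Fin k → ℝ} (hp : IsDeep v T p) (hδ : IsSmall v T β δ)
    {α : Fin k → ℂ} (hα : α ∈ Bx v T β) {m : Fin k → ℕ}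
    (hm : supp (alphaDelta α δ + fun i => (m i : ℝ)) ∈ T) {ρ : Fin k → ℝ}
    (hρ : (fun i => -ρ i - p i) ∈ inducingHeights v T) (a : Fin k → ℕ) (τ : Fin d → ℝ) :
    Summable fun n => ‖gammaTerm v α (m - a) τ n‖ * Real.exp (∑ i, (n i : ℝ) * ρ i) := by
  obtain ⟨J, hJ, h0⟩ := exists_maximal_of_supp hδ hα hm
  refine hp ρ hρ J hJ α _ (fun j hj => ⟨(h0 j hj).1, ?_⟩) τ
  rw [Pi.sub_apply, (h0 j hj).2, Nat.zero_sub]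

theorem summable_termCoeff (hT : IsTriangulation v T) {p : Fin k → ℝ} (hp : IsDeep v T p)
    (hδ : IsSmall v T β δ) {α : Fin k → ℂ} (hα : α ∈ Bx v T β) (u : Fin d → ℤ) {y : Fin k → ℂ}
    (hy : (fun i => -(y i).re - p i) ∈ inducingHeights v T) {χ : Fin d → ℝ} (w : Points v χ) :
    Summable fun l : L v β α u => termCoeff v T χ (cPoint v α δ) y l.1 w := by
  by_cases h : ∃ m : Fin k → ℕ, coordBas v T χ (alphaDelta α δ + fun i => (m i : ℝ)) w ≠ 0
  · obtain ⟨m, hm⟩ := h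
    simp only [termCoeff_eq hT hα hm]
    exact (tsum_prod_taylorCoeff hα u m y fun a _ => hp.summable hδ hα
      (coordBas_apply (coord_nonneg α δ m) hm).1 hy a _).summable
  · push Not at h
    simp only [termCoeff_eq_zero hT hα h]
    exact summable_zero

/-- If a term of a `Γ`-series has a non-zero coefficient at `[w]`, then its exponents outside of
the minimal cone of `w` are non-negative integers, which puts `[w]` into the shadow. -/
theorem inShadow_of_termCoeff_ne_zero (hT : IsTriangulation v T) (hδ : IsSmall v T β δ)
    {α : Fin k → ℂ} (hα : α ∈ Bx v T β) {u : Fin d → ℤ} (hu : toReal u ∈ K v) {y : Fin k → ℂ}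
    {χ : Fin d → ℝ} {w : Points v χ} {l : Fin k → ℂ} (hl : l ∈ L v β α u)
    (h : termCoeff v T χ (cPoint v α δ) y l w ≠ 0) : InShadow v (rePart β) w.1 := by
  by_cases hm : ∃ m : Fin k → ℕ, coordBas v T χ (alphaDelta α δ + fun i => (m i : ℝ)) w ≠ 0
  swap
  · push Not at hm
    exact absurd (termCoeff_eq_zero hT hα hm y l) h
  obtain ⟨m, hm⟩ := hm
  rw [termCoeff_eq hT hα hm] at h
  obtain ⟨-, h2, -⟩ := coordBas_apply (coord_nonneg α δ m) hm
  have ha0 := coord_nonneg α δ m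
  set a := alphaDelta α δ + fun i => (m i : ℝ) with ha
  have hnonneg : ∀ i, a i = 0 → 0 ≤ (l i).re := by
    intro i hi
    have h3 : 0 ≤ alphaDelta α δ i := alphaDelta_nonneg α δ i
    rw [ha, Pi.add_apply, add_eq_zero_iff_of_nonneg h3 (Nat.cast_nonneg _)] at hi
    have hαi := hδ α hα i hi.1
    have hmi : m i = 0 := by exact_mod_cast hi.2
    obtain ⟨n, hn⟩ := hl.2 i
    rw [hαi, sub_zero] at hn
    have h4 := Finset.prod_ne_zero_iff.1 h i (Finset.mem_univ i)
    rw [hmi, taylorCoeff_eq, hn] at h4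
    rw [hn, Complex.intCast_re]
    by_contra! hneg
    have hneg' : n < 0 := by exact_mod_cast hneg
    obtain ⟨q, hq⟩ : ∃ q : ℕ, n = -(q + 1 : ℤ) := ⟨(-n - 1).toNat, by omega⟩
    apply h4
    rw [hq]
    push_cast
    simp only [Finset.range_one, Finset.sum_singleton, Nat.sub_zero,
      gammaCoeff_zero_neg_nat q, mul_zero]
  have hβ : rePart β = lin v (fun i => (l i).re) + toReal u := by
    have h5 := ((sum_smul_toComplex_eq_iff l _).1 hl.1).1
    rw [h5]
    ext j
    simp [rePart, toComplex, toReal]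
  have hev : ∀ᶠ ε : ℝ in nhdsWithin 0 (Set.Ioi 0), ∀ i, 0 ≤ a i + ε * (l i).re := by
    rw [Filter.eventually_all]
    intro i
    by_cases hi : a i = 0
    · filter_upwards [self_mem_nhdsWithin] with ε hε
      rw [hi, zero_add]
      exact mul_nonneg (le_of_lt hε) (hnonneg i hi)
    · have hpos : 0 < a i := lt_of_le_of_ne (ha0 i) (Ne.symm hi)
      have hc : Filter.Tendsto (fun ε : ℝ => a i + ε * (l i).re) (nhdsWithin 0 (Set.Ioi 0))
          (nhds (a i)) := by
        have : Continuous fun ε : ℝ => a i + ε * (l i).re := by fun_prop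
        exact (this.tendsto' 0 _ (by simp)).mono_left nhdsWithin_le_nhds
      exact (hc.eventually_const_lt hpos).mono fun ε h => h.le
  obtain ⟨ε₀, h0, hε₀⟩ := mem_nhdsGT_iff_exists_Ioo_subset.1 hev
  refine ⟨ε₀, h0, fun ε h1 h2' => ?_⟩
  have : w.1 + ε • rePart β = lin v (a + ε • fun i => (l i).re) + ε • toReal u := by
    rw [hβ, map_add, map_smul, h2, smul_add, add_assoc]
  rw [this]
  exact add_mem_K (lin_mem_K fun i => hε₀ ⟨h1, h2'⟩ i) (smul_mem_K h1.le hu)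

/-! ### The classes of the `Γ`-series as logarithmic series -/

open Classical in
/-- The coefficient of `y^a e^{(α + n) · y}` in the value of `h` at the class of a `Γ`-series. -/
def seriesCoeff {χ ξ : Fin d → ℝ} (h : ShadowQuotient v T χ ξ g →ₗ[ℂ] ℂ) (β : Fin d → ℂ) (δ : ℝ)
    (u : Fin d → ℤ) (α : Fin k → ℂ) (a : Fin k → ℕ) (n : Fin k → ℤ) : ℂ :=
  ∑ m ∈ Finset.Iic (fun _ : Fin k => k + 1), if a ≤ m then
    clsFun h (coordBas v T χ (alphaDelta α δ + fun i => (m i : ℝ))) *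
      (∏ i, ((a i).factorial : ℂ))⁻¹ * gammaTerm v α (m - a) (shiftVec v β α u) n else 0

theorem summable_seriesCoeff (hT : IsTriangulation v T)
    (hgen : AddSubgroup.closure (Set.range v) = ⊤) {p : Fin k → ℝ} (hp : IsDeep v T p)
    (hδ : IsSmall v T β δ) {χ ξ : Fin d → ℝ} (h : ShadowQuotient v T χ ξ g →ₗ[ℂ] ℂ)
    (u : Fin d → ℤ) {α : Fin k → ℂ} (hα : α ∈ Bx v T β) (a : Fin k → ℕ) {ρ : Fin k → ℝ}
    (hρ : (fun i => -ρ i - p i) ∈ inducingHeights v T) :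
    Summable fun n => ‖seriesCoeff h β δ u α a n‖ * Real.exp (∑ i, (n i : ℝ) * ρ i) := by
  classical
  have key : ∀ m : Fin k → ℕ, Summable fun n : Fin k → ℤ => ‖(if a ≤ m then
      clsFun h (coordBas v T χ (alphaDelta α δ + fun i => (m i : ℝ))) *
        (∏ i, ((a i).factorial : ℂ))⁻¹ * gammaTerm v α (m - a) (shiftVec v β α u) n else 0)‖ *
          Real.exp (∑ i, (n i : ℝ) * ρ i) := by
    intro m
    by_cases h0 : clsFun h (coordBas v T χ (alphaDelta α δ + fun i => (m i : ℝ))) = 0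
    · simp [h0, summable_zero]
    by_cases ham : a ≤ m
    · simp only [if_pos ham, norm_mul, mul_assoc]
      refine Summable.mul_left _ (Summable.mul_left _ ?_)
      exact hp.summable hδ hα (le_of_clsFun_ne_zero hT hgen h α h0).1 hρ a _
    · simp [ham, summable_zero]
  refine Summable.of_nonneg_of_le (fun n => by positivity) (fun n => ?_)
    (summable_sum fun m (_ : m ∈ Finset.Iic (fun _ : Fin k => k + 1)) => key m)
  rw [← Finset.sum_mul]
  exact mul_le_mul_of_nonneg_right (norm_sum_le _ _) (Real.exp_pos _).le

theorem expSum_seriesCoeff (hT : IsTriangulation v T)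
    (hgen : AddSubgroup.closure (Set.range v) = ⊤) {p : Fin k → ℝ} (hp : IsDeep v T p)
    (hδ : IsSmall v T β δ) {χ ξ : Fin d → ℝ} (h : ShadowQuotient v T χ ξ g →ₗ[ℂ] ℂ)
    (u : Fin d → ℤ) {α : Fin k → ℂ} (hα : α ∈ Bx v T β) (a : Fin k → ℕ) {y : Fin k → ℂ}
    (hy : (fun i => -(y i).re - p i) ∈ inducingHeights v T) :
    expSum (seriesCoeff h β δ u α a) y =
      ∑ m ∈ Finset.Iic (fun _ : Fin k => k + 1), if a ∈ Finset.Iic m then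
        clsFun h (coordBas v T χ (alphaDelta α δ + fun i => (m i : ℝ))) *
          (∏ i, ((a i).factorial : ℂ))⁻¹ *
            expSum (gammaTerm v α (m - a) (shiftVec v β α u)) y else 0 := by
  classical
  have key : ∀ m ∈ Finset.Iic (fun _ : Fin k => k + 1), HasSum (fun n : Fin k → ℤ =>
      (if a ≤ m then
      clsFun h (coordBas v T χ (alphaDelta α δ + fun i => (m i : ℝ))) *
        (∏ i, ((a i).factorial : ℂ))⁻¹ * gammaTerm v α (m - a) (shiftVec v β α u) n else 0) *
          Complex.exp (∑ i, (n i : ℂ) * y i)) (if a ∈ Finset.Iic m then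
        clsFun h (coordBas v T χ (alphaDelta α δ + fun i => (m i : ℝ))) *
          (∏ i, ((a i).factorial : ℂ))⁻¹ *
            expSum (gammaTerm v α (m - a) (shiftVec v β α u)) y else 0) := by
    intro m _
    by_cases h0 : clsFun h (coordBas v T χ (alphaDelta α δ + fun i => (m i : ℝ))) = 0
    · simp [h0, hasSum_zero]
    by_cases ham : a ≤ m
    · simp only [if_pos ham, Finset.mem_Iic, mul_assoc]
      refine HasSum.mul_left _ (HasSum.mul_left _ (Summable.hasSum (Summable.of_norm ?_)))
      simp only [norm_mul, norm_exp_sum]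
      exact hp.summable hδ hα (le_of_clsFun_ne_zero hT hgen h α h0).1 hy a _
    · simp [ham, hasSum_zero]
  rw [← (hasSum_sum key).tsum_eq]
  refine tsum_congr fun n => ?_
  rw [seriesCoeff, Finset.sum_mul]

/-- Evaluated by `h`, the class of a `Γ`-series is a logarithmic series in the sense of `logSum`. -/
theorem apply_PhiClass (hT : IsTriangulation v T)
    (hgen : AddSubgroup.closure (Set.range v) = ⊤) {p : Fin k → ℝ} (hp : IsDeep v T p)
    (hδ : IsSmall v T β δ)
    (h : ShadowQuotient v T (betaDelta β δ) (rePart β) g →ₗ[ℂ] ℂ) (u : Fin d → ℤ) {y : Fin k → ℂ}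
    (hy : (fun i => -(y i).re - p i) ∈ inducingHeights v T) :
    h (PhiClass v T β δ g u y) = logSum (finite_Bx hT hgen β).toFinset (fun _ => k + 1)
      (seriesCoeff h β δ u) y := by
  classical
  set W := (finite_cls_ne_zero (χ := betaDelta β δ) (ξ := rePart β) hT hgen g).toFinset with hWdef
  have hW : ∀ w, cls v T (betaDelta β δ) (rePart β) g w ≠ 0 ↔ w ∈ W := fun w => by
    rw [hWdef, Set.Finite.mem_toFinset, Set.mem_ofPred_eq]
  set A := (finite_Bx hT hgen β).toFinset with hAdef
  have hA : ∀ α, α ∈ A ↔ α ∈ Bx v T β := fun α => by rw [hAdef, Set.Finite.mem_toFinset]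
  set N : Fin k → ℕ := fun _ => k + 1
  -- the contribution of `α` to the coefficient of `[w]`
  have h1 : ∀ α ∈ A, ∀ w ∈ W, ∑' l : L v β α u,
      termCoeff v T (betaDelta β δ) (cPoint v α δ) y l.1 w = ∑ m ∈ Finset.Iic N,
        coordBas v T (betaDelta β δ) (alphaDelta α δ + fun i => (m i : ℝ)) w *
          ∑' l : L v β α u, ∏ i, taylorCoeff (y i) (l.1 i) (m i) := by
    intro α hα w hw
    rw [hA] at hα
    by_cases hm : ∃ m : Fin k → ℕ,
        coordBas v T (betaDelta β δ) (alphaDelta α δ + fun i => (m i : ℝ)) w ≠ 0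
    · obtain ⟨m, hm⟩ := hm
      obtain ⟨h2, h3, h4⟩ := coordBas_apply (coord_nonneg α δ m) hm
      simp only [termCoeff_eq hT hα hm]
      rw [Finset.sum_eq_single m]
      · rw [h4, one_mul]
      · intro m' _ hne
        by_contra h0
        obtain ⟨h2', h3', -⟩ := coordBas_apply (coord_nonneg α δ m') (left_ne_zero_of_mul h0)
        have := eq_of_lin_eq hT (coord_nonneg α δ m') (coord_nonneg α δ m) h2' h2
          (h3'.trans h3.symm)
        exact hne (funext fun i => by simpa using congrFun this i)
      · intro hmN
        refine absurd (Finset.mem_Iic.2 fun i => ?_) hmN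
        have h5 := coord_le_of_cls_ne_zero hT hgen g ((hW w).2 hw) (coord_nonneg α δ m) h2 h3 i
        have h6 : 0 ≤ alphaDelta α δ i := alphaDelta_nonneg α δ i
        rw [Pi.add_apply] at h5
        have h7 : (m i : ℝ) ≤ (k + 1 : ℕ) := by push_cast; linarith
        exact_mod_cast h7
    · push Not at hm
      simp only [termCoeff_eq_zero hT hα hm, hm, tsum_zero, zero_mul, Finset.sum_const_zero]
  have h2 : h (PhiClass v T β δ g u y) = ∑ α ∈ A, ∑ m ∈ Finset.Iic N,
      clsFun h (coordBas v T (betaDelta β δ) (alphaDelta α δ + fun i => (m i : ℝ))) *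
        ∑' l : L v β α u, ∏ i, taylorCoeff (y i) (l.1 i) (m i) := by
    rw [PhiClass, finsum_eq_sum_of_support_subset (s := W), map_sum]
    · simp only [map_smul, smul_eq_mul]
      have h3 : ∀ w ∈ W, Phi v T β δ u y w = ∑ α ∈ A, ∑ m ∈ Finset.Iic N,
          coordBas v T (betaDelta β δ) (alphaDelta α δ + fun i => (m i : ℝ)) w *
            ∑' l : L v β α u, ∏ i, taylorCoeff (y i) (l.1 i) (m i) := fun w hw => by
        rw [Phi, finsum_mem_eq_finite_toFinset_sum _ (finite_Bx hT hgen β)]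
        exact Finset.sum_congr rfl fun α hα => h1 α hα w hw
      rw [Finset.sum_congr rfl fun w hw => by rw [h3 w hw]]
      simp only [clsFun_apply fun w hw => (hW w).1 hw, Finset.sum_mul]
      rw [Finset.sum_comm]
      refine Finset.sum_congr rfl fun α _ => ?_
      rw [Finset.sum_comm]
      exact Finset.sum_congr rfl fun m _ => Finset.sum_congr rfl fun w _ => by ring
    · intro w hw
      refine (hW w).1 fun h0 => hw ?_
      simp only [h0, smul_zero]
  rw [h2, logSum]
  refine Finset.sum_congr rfl fun α hα => ?_
  rw [hA] at hα
  have h4 : ∀ m : Fin k → ℕ,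
      clsFun h (coordBas v T (betaDelta β δ) (alphaDelta α δ + fun i => (m i : ℝ))) *
        ∑' l : L v β α u, ∏ i, taylorCoeff (y i) (l.1 i) (m i) =
      Complex.exp (∑ i, α i * y i) * ∑ a ∈ Finset.Iic m, (∏ i, y i ^ a i) *
        (clsFun h (coordBas v T (betaDelta β δ) (alphaDelta α δ + fun i => (m i : ℝ))) *
          (∏ i, ((a i).factorial : ℂ))⁻¹ *
            expSum (gammaTerm v α (m - a) (shiftVec v β α u)) y) := by
    intro m
    by_cases h0 : clsFun h (coordBas v T (betaDelta β δ)
        (alphaDelta α δ + fun i => (m i : ℝ))) = 0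
    · simp [h0]
    rw [(tsum_prod_taylorCoeff hα u m y fun a _ => hp.summable hδ hα
      (le_of_clsFun_ne_zero hT hgen h α h0).1 hy a _).tsum_eq, mul_left_comm, Finset.mul_sum]
    congr 1
    refine Finset.sum_congr rfl fun a _ => ?_
    rw [Finset.prod_div_distrib]
    ring
  simp only [h4, expSum_seriesCoeff hT hgen hp hδ h u hα _ hy]
  rw [← Finset.mul_sum]
  congr 1
  simp only [Finset.mul_sum]
  rw [Finset.sum_comm]
  refine Finset.sum_congr rfl fun m hm => ?_
  simp only [mul_ite, mul_zero]
  rw [Finset.sum_ite_mem]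
  congr 1
  exact (Finset.inter_eq_right.2 (Finset.Iic_subset_Iic.2 (Finset.mem_Iic.1 hm))).symm

/-! ### Recovering the linear function -/

open Classical in
/-- A triangular system of linear equations: the coefficient `γ 0 i` vanishes for `i ∈ Z`, and the
first non-vanishing coefficients are `γ 1 i` for `i ∈ Z` and `γ 0 i` for the other `i`. -/
theorem eq_zero_of_triangular {N : Fin k → ℕ} {f : (Fin k → ℕ) → ℂ}
    (hf : ∀ m, f m ≠ 0 → m ≤ N) {Z : Finset (Fin k)} {γ : ℕ → Fin k → ℂ}
    (h0 : ∀ i ∈ Z, γ 0 i = 0) (h1 : ∀ i, γ (if i ∈ Z then 1 else 0) i ≠ 0)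
    (h : ∀ a ≤ N, ∑ m ∈ Finset.Iic N, (if a ≤ m then f m * ∏ i, γ (m i - a i) i else 0) = 0)
    {m : Fin k → ℕ} (hm : ∀ i ∈ Z, 1 ≤ m i) : f m = 0 := by
  have key : ∀ s : ℕ, ∀ m : Fin k → ℕ, (∀ i ∈ Z, 1 ≤ m i) → ∑ i, N i < ∑ i, m i + s →
      f m = 0 := by
    intro s
    induction s with
    | zero =>
      intro m _ hs
      by_contra hne
      exact absurd (Finset.sum_le_sum fun i _ => hf m hne i) (by simpa using hs)
    | succ s ih =>
      intro m hm hs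
      by_contra hne
      have hmN := hf m hne
      -- With this `a`, all `m' ≠ m` in the sum have a vanishing factor or are larger than `m`.
      let a : Fin k → ℕ := fun i => m i - if i ∈ Z then 1 else 0
      have ham : a ≤ m := fun i => Nat.sub_le _ _
      have hsub : ∀ i, m i - a i = if i ∈ Z then 1 else 0 := fun i => by
        simp only [a]
        split_ifs with hi
        · have := hm i hi
          omega
        · omega
      have h2 := h a (ham.trans hmN)
      rw [Finset.sum_eq_single m, if_pos ham] at h2
      · refine mul_ne_zero hne (Finset.prod_ne_zero_iff.2 fun i _ => ?_) h2
        rw [hsub]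
        exact h1 i
      · intro m' _ hne'
        split_ifs with ham'
        swap
        · rfl
        by_cases hmm' : m ≤ m'
        · have hlt : ∑ i, m i < ∑ i, m' i := by
            refine Finset.sum_lt_sum (fun i _ => hmm' i) ?_
            by_contra! hle
            exact hne' (funext fun i => le_antisymm (hle i (Finset.mem_univ i)) (hmm' i))
          rw [ih m' (fun i hi => (hm i hi).trans (hmm' i)) (by omega), zero_mul]
        · obtain ⟨i, hi⟩ : ∃ i, m' i < m i := by
            by_contra! hle
            exact hmm' hle
          have hai := ham' i
          have hiZ : i ∈ Z := by
            by_contra hiZ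
            simp only [a, hiZ, if_false] at hai
            omega
          have : m' i - a i = 0 := by
            have := hsub i
            rw [if_pos hiZ] at this
            omega
          rw [Finset.prod_eq_zero (Finset.mem_univ i) (by rw [this, h0 i hiZ]), mul_zero]
      · intro hmem
        exact absurd (Finset.mem_Iic.2 hmN) hmem
  exact key (∑ i, N i + 1) m hm (by omega)

end

/-! ### Linear independence -/

section

variable {d k : ℕ} {v : Fin k → Fin d → ℤ} {T : Set (Finset (Fin k))} {β : Fin d → ℂ} {δ : ℝ}
  {g : Module.Basis (Fin d) ℤ (Module.Dual ℤ (Fin d → ℤ))}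

/-- If `h` annihilates the `Γ`-series on an open set, then all coefficients of their expansions vanish. -/
theorem seriesCoeff_eq_zero (hT : IsTriangulation v T)
    (hgen : AddSubgroup.closure (Set.range v) = ⊤) {p : Fin k → ℝ} (hp : IsDeep v T p)
    (hδ : IsSmall v T β δ) {V : Set (Fin k → ℂ)} (hV : IsOpen V) (hV' : V.Nonempty)
    (hVU : V ⊆ USigma v T p) {arg : (Fin k → ℂ) → Fin k → ℝ} (harg : ∀ x ∈ V, IsArg x (arg x))
    {h : ShadowQuotient v T (betaDelta β δ) (rePart β) g →ₗ[ℂ] ℂ}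
    (h0 : ∀ u : Fin d → ℤ, toReal u ∈ K v → ∀ x ∈ V,
      h (PhiClass v T β δ g u (logOf x (arg x))) = 0)
    {u : Fin d → ℤ} (hu : toReal u ∈ K v) {α : Fin k → ℂ} (hα : α ∈ Bx v T β)
    {a : Fin k → ℕ} (ha : a ≤ fun _ => k + 1) (n : Fin k → ℤ) :
    seriesCoeff h β δ u α a n = 0 := by
  obtain ⟨x₀, hx₀⟩ := hV'
  set ρ : Fin k → ℝ := fun i => Real.log ‖x₀ i‖ with hρdef
  have hexp : ∀ i, Real.exp (ρ i) = ‖x₀ i‖ := fun i =>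
    Real.exp_log (norm_pos_iff.2 ((hVU hx₀).1 i))
  let X : (Fin k → ℝ) → Fin k → ℂ := fun θ i => Complex.exp (ρ i + θ i * Complex.I)
  have hX : Continuous X := by fun_prop
  have hXnorm : ∀ θ i, ‖X θ i‖ = Real.exp (ρ i) := fun θ i => by simp [X, Complex.norm_exp]
  have hXlog : ∀ θ i, Real.log ‖X θ i‖ = ρ i := fun θ i => by rw [hXnorm, Real.log_exp]
  have hXρ : ∀ θ i, X θ i = (Real.exp (ρ i) : ℂ) * Complex.exp (θ i * Complex.I) := fun θ i => by
    simp only [X]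
    rw [Complex.exp_add, Complex.ofReal_exp]
  have hΩ : IsOpen {ρ : Fin k → ℝ | (fun i => -ρ i - p i) ∈ inducingHeights v T} :=
    (isOpen_inducingHeights hT hgen).preimage (by fun_prop)
  have hρ : ρ ∈ {ρ : Fin k → ℝ | (fun i => -ρ i - p i) ∈ inducingHeights v T} := (hVU hx₀).2
  have hA : ∀ α, α ∈ (finite_Bx hT hgen β).toFinset ↔ α ∈ Bx v T β := fun α => by
    rw [Set.Finite.mem_toFinset]
  refine congrFun (coeff_eq_zero_of_exists_translate
    (c := fun u : {u : Fin d → ℤ // toReal u ∈ K v} => seriesCoeff h β δ u.1)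
    (fun α hα i => ?_) hΩ (fun u α hα a _ ρ hρ => summable_seriesCoeff hT hgen hp hδ h u.1
      ((hA α).1 hα) a hρ) hρ (hV.preimage hX) ⟨arg x₀, ?_⟩ (fun θ hθ => ?_) ⟨u, hu⟩ α
      ((hA α).2 hα) a (Finset.mem_Iic.2 ha)) n
  · obtain ⟨-, -, -, -, h01, -⟩ := mem_Bx_iff.1 ((hA α).1 hα)
    exact h01 i
  · have : X (arg x₀) = x₀ := funext fun i => by
      rw [hXρ, hexp]
      exact (harg x₀ hx₀ i).symm
    change X (arg x₀) ∈ V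
    rwa [this]
  · have hθV : X θ ∈ V := hθ
    have hm : ∀ i, ∃ m : ℤ, arg (X θ) i = θ i + m * (2 * Real.pi) := by
      intro i
      have h1 := harg _ hθV i
      rw [hXnorm, hXρ] at h1
      have h2 := mul_left_cancel₀ (by exact_mod_cast (Real.exp_pos (ρ i)).ne') h1
      obtain ⟨m, hm⟩ := Complex.exp_eq_exp_iff_exists_int.1 h2.symm
      refine ⟨m, ?_⟩
      have h3 : ((arg (X θ) i : ℝ) : ℂ) = ((θ i + m * (2 * Real.pi) : ℝ) : ℂ) := by
        refine mul_right_cancel₀ Complex.I_ne_zero (hm.trans ?_)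
        push_cast
        ring
      exact_mod_cast h3
    choose m hm using hm
    refine ⟨m, fun u => ?_⟩
    have hlog : logOf (X θ) (arg (X θ)) =
        fun i => (ρ i : ℂ) + (θ i + m i * (2 * Real.pi) : ℝ) * Complex.I := by
      funext i
      rw [logOf, hXlog, hm]
    have h4 := h0 u.1 u.2 _ hθV
    rw [hlog, apply_PhiClass hT hgen hp hδ h] at h4
    · exact h4
    · simpa using hρ

/-- The value of `h` at the class of `[w]` is detected by the exponents `l` that equal `α - M` on
the minimal cone of `w` and `0` outside of it, where `M` is a large integer: as `w` lies in the
shadow, `β - ∑ l_i v_i` is then an element of `K`. -/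
theorem clsFun_eq_zero (hT : IsTriangulation v T)
    (hgen : AddSubgroup.closure (Set.range v) = ⊤) (hδ : IsSmall v T β δ)
    {h : ShadowQuotient v T (betaDelta β δ) (rePart β) g →ₗ[ℂ] ℂ}
    (h0 : ∀ u : Fin d → ℤ, toReal u ∈ K v → ∀ α ∈ Bx v T β, ∀ a : Fin k → ℕ,
      (a ≤ fun _ => k + 1) → ∀ n : Fin k → ℤ, seriesCoeff h β δ u α a n = 0)
    {w : Points v (betaDelta β δ)} (hw : InShadow v (rePart β) w.1) :
    h (cls v T (betaDelta β δ) (rePart β) g w) = 0 := by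
  classical
  obtain ⟨c, hc, hcT, hcw, hcs⟩ := exists_coordBas_eq_single hT w
  obtain ⟨n₀, hn₀⟩ := w.2.2
  obtain ⟨α, hα, m, rfl⟩ := exists_alphaDelta_add hT hgen hc hcT (hcw.trans hn₀)
  set c := alphaDelta α δ + fun i => (m i : ℝ) with hcdef
  rw [← clsFun_single, ← hcs]
  obtain ⟨-, -, ⟨n', hn'⟩, -, h01, -⟩ := mem_Bx_iff.1 hα
  have hαc : ∀ i, i ∉ supp c → α i = 0 := fun i hi => by
    have h1 := notMem_supp.1 hi
    have h2 : 0 ≤ alphaDelta α δ i := alphaDelta_nonneg α δ i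
    rw [hcdef, Pi.add_apply, add_eq_zero_iff_of_nonneg h2 (Nat.cast_nonneg _)] at h1
    exact hδ α hα i h1.1
  obtain ⟨ε₀, hε₀, hK⟩ := hw
  have hK' := hK (ε₀ / 2) (by positivity) (by linarith)
  set ε := ε₀ / 2 with hε
  have hεpos : 0 < ε := by positivity
  obtain ⟨M, hM⟩ : ∃ M : ℕ, ∀ i, c i / ε + 1 ≤ M + 1 := by
    obtain ⟨M, hM⟩ := exists_nat_ge (∑ i, (c i / ε + 1))
    refine ⟨M, fun i => le_trans (le_trans ?_ hM) (by linarith)⟩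
    exact Finset.single_le_sum (f := fun i => c i / ε + 1)
      (fun i _ => by have := hc i; simp only [Pi.zero_apply] at this; positivity)
      (Finset.mem_univ i)
  let n : Fin k → ℤ := fun i => if i ∈ supp c then -(M + 1 : ℤ) else 0
  let u : Fin d → ℤ := -n' - ∑ i, n i • v i
  have hu : toReal u = rePart β - (lin v fun i => (α i).re) - lin v fun i => (n i : ℝ) := by
    have h1 : toReal u = -toReal n' - toReal (∑ i, n i • v i) := by
      ext j; simp [u, toReal]
    rw [h1, toReal_sum_zsmul, hn']
    abel
  have hτ : lin v (fun i => (n i : ℝ)) = shiftVec v β α u := by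
    rw [shiftVec, hu]
    abel
  have huK : toReal u ∈ K v := by
    have h1 : toReal u = ε⁻¹ • (w.1 + ε • rePart β) +
        lin v (-(ε⁻¹ • c) - (fun i => (α i).re) - fun i => (n i : ℝ)) := by
      rw [hu, map_sub, map_sub, map_neg, map_smul, hcw, smul_add, smul_smul,
        inv_mul_cancel₀ hεpos.ne', one_smul]
      abel
    rw [h1]
    refine add_mem_K (smul_mem_K (by positivity) hK') (lin_mem_K fun i => ?_)
    simp only [Pi.zero_apply, Pi.sub_apply, Pi.neg_apply, Pi.smul_apply, smul_eq_mul, n]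
    by_cases hi : i ∈ supp c
    · have h2 := hM i
      have h3 := (h01 i).2
      rw [div_eq_inv_mul] at h2
      simp only [hi, if_true]
      push_cast
      linarith
    · simp [hi, hαc i hi, notMem_supp.1 hi]
  refine eq_zero_of_triangular (N := fun _ => k + 1)
    (f := fun m => clsFun h (coordBas v T (betaDelta β δ) (alphaDelta α δ + fun i => (m i : ℝ))))
    (Z := (supp c).filter fun i => α i = 0) (γ := fun r i => gammaCoeff r (α i + n i))
    (fun m hm => (le_of_clsFun_ne_zero hT hgen h α hm).2) (fun i hi => ?_) (fun i => ?_)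
    (fun a ha => ?_) (fun i hi => ?_)
  · rw [Finset.mem_filter] at hi
    simp only [n, hi.1, hi.2, if_true, zero_add]
    push_cast
    exact gammaCoeff_zero_neg_nat M
  · by_cases hi : i ∈ supp c
    · by_cases hαi : α i = 0
      · simp only [n, hi, hαi, if_true, zero_add, Finset.mem_filter, true_and]
        push_cast
        exact gammaCoeff_one_neg_nat_ne_zero M
      · simp only [n, hi, hαi, if_true, Finset.mem_filter, and_false, if_false]
        rw [gammaCoeff_zero]
        refine recipGamma_ne_zero fun q hq => hαi ?_
        have h1 : α i = ((M - q : ℤ) : ℂ) := by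
          push_cast at hq ⊢
          linear_combination hq
        have h2 := h01 i
        rw [h1, Complex.intCast_re] at h2
        have h3 : (0 : ℤ) ≤ M - q := by exact_mod_cast h2.1
        have h4 : (M - q : ℤ) < 1 := by exact_mod_cast h2.2
        rw [h1, show (M - q : ℤ) = 0 by omega, Int.cast_zero]
    · simp only [n, hi, hαc i hi, if_false, Finset.mem_filter, false_and]
      rw [gammaCoeff_zero]
      refine recipGamma_ne_zero fun q hq => ?_
      have h1 : ((q + 1 : ℕ) : ℂ) = 0 := by
        push_cast at hq ⊢
        linear_combination hq
      exact absurd (by exact_mod_cast h1) q.succ_ne_zero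
  · have h1 := h0 u huK α hα a ha n
    have h2 : (∏ i, ((a i).factorial : ℂ))⁻¹ ≠ 0 := inv_ne_zero (Finset.prod_ne_zero_iff.2
      fun i _ => by exact_mod_cast (a i).factorial_ne_zero)
    refine (mul_eq_zero.1 (Eq.trans ?_ h1)).resolve_left h2
    rw [seriesCoeff, Finset.mul_sum]
    refine Finset.sum_congr rfl fun m' _ => ?_
    rw [gammaTerm, if_pos hτ, mul_ite, mul_zero]
    congr 1
    simp only [Pi.sub_apply]
    ring
  · rw [Finset.mem_filter, mem_supp, hcdef, Pi.add_apply] at hi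
    rw [alphaDelta_eq_zero δ hi.2, zero_add] at hi
    have h1 : m i ≠ 0 := by exact_mod_cast hi.1
    omega

theorem eq_zero_of_apply_PhiClass (hT : IsTriangulation v T)
    (hgen : AddSubgroup.closure (Set.range v) = ⊤) {p : Fin k → ℝ} (hp : IsDeep v T p)
    (hδ : IsSmall v T β δ) {V : Set (Fin k → ℂ)} (hV : IsOpen V) (hV' : V.Nonempty)
    (hVU : V ⊆ USigma v T p) {arg : (Fin k → ℂ) → Fin k → ℝ} (harg : ∀ x ∈ V, IsArg x (arg x))
    {h : ShadowQuotient v T (betaDelta β δ) (rePart β) g →ₗ[ℂ] ℂ}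
    (h0 : ∀ u : Fin d → ℤ, toReal u ∈ K v → ∀ x ∈ V,
      h (PhiClass v T β δ g u (logOf x (arg x))) = 0) : h = 0 :=
  eq_zero_of_cls fun _ hw => clsFun_eq_zero hT hgen hδ
    (fun _ hu _ hα _ ha n => seriesCoeff_eq_zero hT hgen hp hδ hV hV' hVU harg h0 hu hα ha n) hw

end

end BBGKZ

end

theorem mainTheorem4 {d k : ℕ} (v : Fin k → Fin d → ℤ) (hv : Function.Injective v)
    (hdeg : ∃ deg : (Fin d → ℤ) →+ ℤ, ∀ i, deg (v i) = 1)
    (hgen : AddSubgroup.closure (Set.range v) = ⊤)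
    (T : Set (Finset (Fin k))) (hT : BBGKZ.IsRegularTriangulation v T)
    (g : Module.Basis (Fin d) ℤ (Module.Dual ℤ (Fin d → ℤ))) :
    ∃ p : Fin k → ℝ, IsOpen (BBGKZ.USigma v T p) ∧ (BBGKZ.USigma v T p).Nonempty ∧
      ∀ β : Fin d → ℂ, ∃ δ₀ : ℝ, 0 < δ₀ ∧ ∀ δ : ℝ, 0 < δ → δ < δ₀ →
        -- only finitely many basis elements of the shadow module survive in the quotient
        {w | BBGKZ.cls v T (BBGKZ.betaDelta β δ) (BBGKZ.rePart β) g w ≠ 0}.Finite ∧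
        -- the series converge on `U_Σ`, with values in the completed shadow module
        (∀ u : Fin d → ℤ, BBGKZ.toReal u ∈ BBGKZ.K v → ∀ x ∈ BBGKZ.USigma v T p,
          ∀ θ : Fin k → ℝ, BBGKZ.IsArg x θ → ∀ w : BBGKZ.Points v (BBGKZ.betaDelta β δ),
            (∀ α ∈ BBGKZ.Bx v T β, Summable fun l : BBGKZ.L v β α u =>
              BBGKZ.termCoeff v T (BBGKZ.betaDelta β δ) (BBGKZ.cPoint v α δ)
                (BBGKZ.logOf x θ) l.1 w) ∧
            (Finsupp.single w (1 : ℂ) ∉ BBGKZ.shadow v T (BBGKZ.betaDelta β δ) (BBGKZ.rePart β) →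
              BBGKZ.Phi v T β δ u (BBGKZ.logOf x θ) w = 0)) ∧
        -- linear independence, on any non-empty open part of `U_Σ`, for any choice of arguments
        ∀ V : Set (Fin k → ℂ), IsOpen V → V.Nonempty → V ⊆ BBGKZ.USigma v T p →
          ∀ arg : (Fin k → ℂ) → Fin k → ℝ, (∀ x ∈ V, BBGKZ.IsArg x (arg x)) →
            (∀ h : BBGKZ.ShadowQuotient v T (BBGKZ.betaDelta β δ) (BBGKZ.rePart β) g →ₗ[ℂ] ℂ,
              (∀ u : Fin d → ℤ, BBGKZ.toReal u ∈ BBGKZ.K v → ∀ x ∈ V,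
                h (BBGKZ.PhiClass v T β δ g u (BBGKZ.logOf x (arg x))) = 0) → h = 0) ∧
            (∀ (r : ℕ)
              (h : Fin r → BBGKZ.ShadowQuotient v T (BBGKZ.betaDelta β δ) (BBGKZ.rePart β) g →ₗ[ℂ] ℂ),
              LinearIndependent ℂ h →
              LinearIndependent ℂ fun (j : Fin r)
                (z : {u : Fin d → ℤ // BBGKZ.toReal u ∈ BBGKZ.K v} × V) =>
                h j (BBGKZ.PhiClass v T β δ g z.1.1 (BBGKZ.logOf z.2.1 (arg z.2.1)))) := by
  obtain ⟨p, hp⟩ := BBGKZ.exists_summable_gammaTerm hdeg hgen hT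
  obtain ⟨hT, hne⟩ := hT
  refine ⟨p, BBGKZ.isOpen_USigma hT hgen p, BBGKZ.nonempty_USigma hne p, fun β => ?_⟩
  obtain ⟨δ₀, hδ₀, hsmall⟩ := BBGKZ.exists_isSmall hT hgen β
  refine ⟨δ₀, hδ₀, fun δ h1 h2 => ?_⟩
  have hδ := hsmall δ h1 h2
  refine ⟨BBGKZ.finite_cls_ne_zero hT hgen g, fun u hu x hx θ _ w =>
    ⟨fun α hα => BBGKZ.summable_termCoeff hT hp hδ hα u (by simpa [BBGKZ.logOf] using hx.2) w,
      fun hw => ?_⟩, fun V hV hV' hVU arg harg => ?_⟩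
  · have hzero : ∀ α ∈ BBGKZ.Bx v T β, ∀ l : BBGKZ.L v β α u,
        BBGKZ.termCoeff v T (BBGKZ.betaDelta β δ) (BBGKZ.cPoint v α δ) (BBGKZ.logOf x θ) l.1 w =
          0 := fun α hα l => by
      by_contra h
      exact hw (BBGKZ.single_mem_shadow hT
        (BBGKZ.inShadow_of_termCoeff_ne_zero hT hδ hα hu l.2 h))
    rw [BBGKZ.Phi, finsum_mem_congr rfl fun α hα => by rw [tsum_congr (hzero α hα), tsum_zero]]
    exact finsum_mem_zero _
  · have key : ∀ h : BBGKZ.ShadowQuotient v T (BBGKZ.betaDelta β δ) (BBGKZ.rePart β) g →ₗ[ℂ] ℂ,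
        (∀ u : Fin d → ℤ, BBGKZ.toReal u ∈ BBGKZ.K v → ∀ x ∈ V,
          h (BBGKZ.PhiClass v T β δ g u (BBGKZ.logOf x (arg x))) = 0) → h = 0 := fun h h0 =>
      BBGKZ.eq_zero_of_apply_PhiClass hT hgen hp hδ hV hV' hVU harg h0
    refine ⟨key, fun r h hli => ?_⟩
    rw [Fintype.linearIndependent_iff] at hli ⊢
    intro c hc
    refine hli c (key _ fun u hu x hx => ?_)
    have := congrFun hc (⟨u, hu⟩, ⟨x, hx⟩)
    simpa [LinearMap.sum_apply, Finset.sum_apply] using this
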